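/- Let $\Sigma$ be a compact smooth manifold (Hausdorff, of dimension $n\ge 0$, possibly with boundary or corners), let $E_1,E_2,E_3$ be smooth real vector bundles of finite rank over $\Sigma$, and let $\mu\colon E_1\times_\Sigma E_2\to E_3$ be a locally Lipschitz continuous bilinear bundle map: each $\mu_x\colon (E_1)_x\times (E_2)_x\to (E_3)_x$ is bilinear, and in local coordinates of $\Sigma$ and local trivializations of the bundles $(x,v,w)\mapsto \mu_x(v,w)$ is locally Lipschitz. Let $p,r\in[1,\infty]$ with $p>n$. For a smooth vector bundle $E\to\Sigma$ and $q\in[1,\infty]$, a section $\sigma$ is of class $W^{1,q}$ if, in each coordinate patch (a chart of $\Sigma$ together with a trivialization of $E$) and over the interior of each compact subset of the patch, its coordinate expression and the weak first derivative of that expression lie in $L^q$. The space $W^{1,q}(\Sigma;E)$ consists of these sections modulo equality almost everywhere. Its norm is the sum, over finitely many compact subsets of coordinate patches whose interiors cover $\Sigma$, of the $W^{1,q}$-norms of the coordinate expressions; different choices may be made for the three bundles. Then for all sections $\sigma_1\in W^{1,p}(\Sigma;E_1)$ and $\sigma_2\in W^{1,r}(\Sigma;E_2)$ one has $\mu\circ(\sigma_1,\sigma_2)\in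 W^{1,\min(p,r)}(\Sigma;E_3)$. Moreover, for every choice of these norms, the induced map $$A\colon W^{1,p}(\Sigma;E_1)\times W^{1,r}(\Sigma;E_2)\to W^{1,\min(p,r)}(\Sigma;E_3),\qquad (\sigma_1,\sigma_2)\mapsto \mu\circ(\sigma_1,\sigma_2),$$ is well defined, bilinear and continuous. -/

import Mathlib

open MeasureTheory Set Bundle
open scoped ENNReal Topology ContDiff Manifold

noncomputable section

namespace SobolevBundle

/-! ### Sobolev functions of order one on an open subset of Euclidean space -/

section Euclidean

variable {n : ℕ} {F : Type*} [NormedAddCommGroup F] [NormedSpace ℝ F]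

/-- `g` is the weak (distributional) derivative of `u` on the open set `Ω`. -/
def HasWeakFDeriv (Ω : Set (EuclideanSpace ℝ (Fin n))) (u : EuclideanSpace ℝ (Fin n) → F)
    (g : EuclideanSpace ℝ (Fin n) → EuclideanSpace ℝ (Fin n) →L[ℝ] F) : Prop :=
  LocallyIntegrableOn u Ω volume ∧ LocallyIntegrableOn g Ω volume ∧
    ∀ φ : EuclideanSpace ℝ (Fin n) → ℝ, ContDiff ℝ ∞ φ → HasCompactSupport φ →
      tsupport φ ⊆ Ω → ∀ v : EuclideanSpace ℝ (Fin n),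
        ∫ x, (fderiv ℝ φ x v) • u x = - ∫ x, φ x • g x v

/-- `u` belongs to `W^{1,p}(Ω; F)`: `u` and its weak derivative are in `L^p(Ω)`. -/
def MemSobolev (Ω : Set (EuclideanSpace ℝ (Fin n))) (p : ℝ≥0∞)
    (u : EuclideanSpace ℝ (Fin n) → F) : Prop :=
  MemLp u p (volume.restrict Ω) ∧
    ∃ g, HasWeakFDeriv Ω u g ∧ MemLp g p (volume.restrict Ω)

open Classical in
/-- The weak derivative of `u` on `Ω` (unique up to null sets; `0` if there is none). -/
def weakFDeriv (Ω : Set (EuclideanSpace ℝ (Fin n))) (u : EuclideanSpace ℝ (Fin n) → F) :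
    EuclideanSpace ℝ (Fin n) → EuclideanSpace ℝ (Fin n) →L[ℝ] F :=
  if h : ∃ g, HasWeakFDeriv Ω u g then h.choose else 0

/-- The Sobolev norm `‖u‖_{L^p(Ω)} + ‖Du‖_{L^p(Ω)}`. -/
def sobolevENorm (Ω : Set (EuclideanSpace ℝ (Fin n))) (p : ℝ≥0∞)
    (u : EuclideanSpace ℝ (Fin n) → F) : ℝ≥0∞ :=
  eLpNorm u p (volume.restrict Ω) + eLpNorm (weakFDeriv Ω u) p (volume.restrict Ω)

variable {Ω : Set (EuclideanSpace ℝ (Fin n))} {u u' : EuclideanSpace ℝ (Fin n) → F}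
  {g g' : EuclideanSpace ℝ (Fin n) → EuclideanSpace ℝ (Fin n) →L[ℝ] F} {p : ℝ≥0∞}

section Aux

variable {X : Type*} [NormedAddCommGroup X] {w w' : EuclideanSpace ℝ (Fin n) → X}
  {ν : Measure (EuclideanSpace ℝ (Fin n))}

theorem aux_locallyIntegrableOn_add (h : LocallyIntegrableOn w Ω ν)
    (h' : LocallyIntegrableOn w' Ω ν) : LocallyIntegrableOn (w + w') Ω ν := h.add h'

theorem aux_locallyIntegrableOn_zero :
    LocallyIntegrableOn (0 : EuclideanSpace ℝ (Fin n) → X) Ω ν := locallyIntegrableOn_zero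

theorem aux_memLp_add (h : MemLp w p ν) (h' : MemLp w' p ν) : MemLp (w + w') p ν := h.add h'

theorem aux_memLp_zero : MemLp (0 : EuclideanSpace ℝ (Fin n) → X) p ν := MemLp.zero

theorem aux_eLpNorm_zero : eLpNorm (0 : EuclideanSpace ℝ (Fin n) → X) p ν = 0 := eLpNorm_zero

theorem aux_eLpNorm_add_le (h : MemLp w p ν) (h' : MemLp w' p ν) (hp : 1 ≤ p) :
    eLpNorm (w + w') p ν ≤ eLpNorm w p ν + eLpNorm w' p ν := eLpNorm_add_le h.1 h'.1 hp

theorem aux_eLpNorm_const_smul [NormedSpace ℝ X] (c : ℝ) (w : EuclideanSpace ℝ (Fin n) → X) :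
    eLpNorm (c • w) p ν = ‖c‖ₑ * eLpNorm w p ν := eLpNorm_const_smul c w p ν

end Aux

theorem integrable_smul_of_tsupport_subset {X : Type*} [NormedAddCommGroup X] [NormedSpace ℝ X]
    {w : EuclideanSpace ℝ (Fin n) → X} (hw : LocallyIntegrableOn w Ω volume)
    {φ : EuclideanSpace ℝ (Fin n) → ℝ} (hφ : Continuous φ) (hc : HasCompactSupport φ)
    (hs : tsupport φ ⊆ Ω) : Integrable (fun x => φ x • w x) volume := by
  have h1 : IntegrableOn w (tsupport φ) volume := hw.integrableOn_compact_subset hs hc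
  have h2 : IntegrableOn (fun x => φ x • w x) (tsupport φ) volume :=
    h1.continuousOn_smul hφ.continuousOn hc
  refine (integrableOn_iff_integrable_of_support_subset ?_).1 h2
  intro x hx
  by_contra hx'
  exact hx (by simp [image_eq_zero_of_notMem_tsupport hx'])

theorem integrable_fderiv_smul {X : Type*} [NormedAddCommGroup X] [NormedSpace ℝ X]
    {w : EuclideanSpace ℝ (Fin n) → X} (hw : LocallyIntegrableOn w Ω volume)
    {φ : EuclideanSpace ℝ (Fin n) → ℝ} (hφ : ContDiff ℝ ∞ φ) (hc : HasCompactSupport φ)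
    (hs : tsupport φ ⊆ Ω) (v : EuclideanSpace ℝ (Fin n)) :
    Integrable (fun x => (fderiv ℝ φ x v) • w x) volume :=
  integrable_smul_of_tsupport_subset hw
    ((hφ.continuous_fderiv (by simp)).clm_apply continuous_const)
    (hc.fderiv_apply (𝕜 := ℝ) v) ((tsupport_fderiv_apply_subset ℝ v).trans hs)

theorem locallyIntegrableOn_apply (hg : LocallyIntegrableOn g Ω volume)
    (v : EuclideanSpace ℝ (Fin n)) : LocallyIntegrableOn (fun x => g x v) Ω volume :=
  (ContinuousLinearMap.apply ℝ F v).locallyIntegrableOn_comp hg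

theorem HasWeakFDeriv.add (h : HasWeakFDeriv Ω u g) (h' : HasWeakFDeriv Ω u' g') :
    HasWeakFDeriv Ω (u + u') (g + g') := by
  refine ⟨aux_locallyIntegrableOn_add h.1 h'.1, aux_locallyIntegrableOn_add h.2.1 h'.2.1, fun φ hφ hc hs v => ?_⟩
  simp only [Pi.add_apply, smul_add, add_apply]
  rw [integral_add (integrable_fderiv_smul h.1 hφ hc hs v)
      (integrable_fderiv_smul h'.1 hφ hc hs v),
    integral_add
      (integrable_smul_of_tsupport_subset (locallyIntegrableOn_apply h.2.1 v) hφ.continuous hc hs)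
      (integrable_smul_of_tsupport_subset (locallyIntegrableOn_apply h'.2.1 v) hφ.continuous hc hs),
    h.2.2 φ hφ hc hs v, h'.2.2 φ hφ hc hs v, neg_add]

theorem HasWeakFDeriv.const_smul (h : HasWeakFDeriv Ω u g) (c : ℝ) :
    HasWeakFDeriv Ω (c • u) (c • g) := by
  refine ⟨h.1.smul c, h.2.1.smul c, fun φ hφ hc hs v => ?_⟩
  simp only [Pi.smul_apply, smul_apply, smul_comm _ c]
  rw [integral_smul, integral_smul, h.2.2 φ hφ hc hs v, smul_neg]

theorem HasWeakFDeriv.ae_eq [FiniteDimensional ℝ F] (hΩ : IsOpen Ω) (h : HasWeakFDeriv Ω u g)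
    (h' : HasWeakFDeriv Ω u g') : g =ᵐ[volume.restrict Ω] g' := by
  have : CompleteSpace F := FiniteDimensional.complete ℝ F
  have key : ∀ v : EuclideanSpace ℝ (Fin n),
      ∀ᵐ x ∂(volume : Measure (EuclideanSpace ℝ (Fin n))), x ∈ Ω → g x v - g' x v = 0 := by
    intro v
    have l := locallyIntegrableOn_apply h.2.1 v
    have l' := locallyIntegrableOn_apply h'.2.1 v
    refine hΩ.ae_eq_zero_of_integral_contDiff_smul_eq_zero (l.sub l') fun φ hφ hc hs => ?_
    simp only [smul_sub]
    rw [integral_sub (integrable_smul_of_tsupport_subset l hφ.continuous hc hs)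
      (integrable_smul_of_tsupport_subset l' hφ.continuous hc hs), sub_eq_zero]
    exact neg_injective ((h.2.2 φ hφ hc hs v).symm.trans (h'.2.2 φ hφ hc hs v))
  have key' := ae_all_iff.2 fun i : Fin n => key (EuclideanSpace.basisFun (Fin n) ℝ i)
  rw [Filter.EventuallyEq, ae_restrict_iff' hΩ.measurableSet]
  filter_upwards [key'] with x hx hxΩ
  refine ContinuousLinearMap.coe_injective
    ((EuclideanSpace.basisFun (Fin n) ℝ).toBasis.ext fun i => ?_)
  simpa using sub_eq_zero.1 (hx i hxΩ)

theorem weakFDeriv_ae_eq [FiniteDimensional ℝ F] (hΩ : IsOpen Ω) (h : HasWeakFDeriv Ω u g) :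
    weakFDeriv Ω u =ᵐ[volume.restrict Ω] g := by
  have hex : ∃ g, HasWeakFDeriv Ω u g := ⟨g, h⟩
  rw [weakFDeriv, dif_pos hex]
  exact hex.choose_spec.ae_eq hΩ h

theorem sobolevENorm_eq [FiniteDimensional ℝ F] (hΩ : IsOpen Ω) (h : HasWeakFDeriv Ω u g) :
    sobolevENorm Ω p u =
      eLpNorm u p (volume.restrict Ω) + eLpNorm g p (volume.restrict Ω) := by
  rw [sobolevENorm, eLpNorm_congr_ae (weakFDeriv_ae_eq hΩ h)]

theorem hasWeakFDeriv_zero : HasWeakFDeriv Ω (0 : EuclideanSpace ℝ (Fin n) → F) 0 :=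
  ⟨aux_locallyIntegrableOn_zero, aux_locallyIntegrableOn_zero, fun φ _ _ _ v => by simp⟩

theorem MemSobolev.zero : MemSobolev Ω p (0 : EuclideanSpace ℝ (Fin n) → F) :=
  ⟨aux_memLp_zero, 0, hasWeakFDeriv_zero, aux_memLp_zero⟩

theorem MemSobolev.add (h : MemSobolev Ω p u) (h' : MemSobolev Ω p u') :
    MemSobolev Ω p (u + u') := by
  obtain ⟨hu, g, hg, hgp⟩ := h
  obtain ⟨hu', g', hg', hgp'⟩ := h'
  exact ⟨aux_memLp_add hu hu', g + g', hg.add hg', aux_memLp_add hgp hgp'⟩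

theorem MemSobolev.const_smul (h : MemSobolev Ω p u) (c : ℝ) : MemSobolev Ω p (c • u) := by
  obtain ⟨hu, g, hg, hgp⟩ := h
  exact ⟨hu.const_smul c, c • g, hg.const_smul c, hgp.const_smul c⟩

theorem MemSobolev.sobolevENorm_ne_top [FiniteDimensional ℝ F] (hΩ : IsOpen Ω)
    (h : MemSobolev Ω p u) : sobolevENorm Ω p u ≠ ⊤ := by
  obtain ⟨hu, g, hg, hgp⟩ := h
  rw [sobolevENorm_eq hΩ hg]
  exact ENNReal.add_ne_top.2 ⟨hu.eLpNorm_ne_top, hgp.eLpNorm_ne_top⟩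

theorem sobolevENorm_zero [FiniteDimensional ℝ F] (hΩ : IsOpen Ω) :
    sobolevENorm Ω p (0 : EuclideanSpace ℝ (Fin n) → F) = 0 := by
  rw [sobolevENorm_eq hΩ hasWeakFDeriv_zero, aux_eLpNorm_zero, aux_eLpNorm_zero, add_zero]

theorem sobolevENorm_add_le [FiniteDimensional ℝ F] (hΩ : IsOpen Ω) (hp : 1 ≤ p)
    (h : MemSobolev Ω p u) (h' : MemSobolev Ω p u') :
    sobolevENorm Ω p (u + u') ≤ sobolevENorm Ω p u + sobolevENorm Ω p u' := by
  obtain ⟨hu, g, hg, hgp⟩ := h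
  obtain ⟨hu', g', hg', hgp'⟩ := h'
  rw [sobolevENorm_eq hΩ hg, sobolevENorm_eq hΩ hg', sobolevENorm_eq hΩ (hg.add hg'),
    add_add_add_comm]
  exact add_le_add (aux_eLpNorm_add_le hu hu' hp) (aux_eLpNorm_add_le hgp hgp' hp)

theorem sobolevENorm_const_smul [FiniteDimensional ℝ F] (hΩ : IsOpen Ω) (h : MemSobolev Ω p u)
    (c : ℝ) : sobolevENorm Ω p (c • u) = ‖c‖ₑ * sobolevENorm Ω p u := by
  obtain ⟨hu, g, hg, hgp⟩ := h
  have h2 := aux_eLpNorm_const_smul (p := p) (ν := volume.restrict Ω) c g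
  rw [sobolevENorm_eq hΩ hg, sobolevENorm_eq hΩ (hg.const_smul c), aux_eLpNorm_const_smul,
    mul_add]
  exact congrArg _ h2

end Euclidean

/-! ### Sobolev sections of a vector bundle over a manifold -/

section Manifold

variable {n : ℕ} {H : Type*} [TopologicalSpace H]
  (I : ModelWithCorners ℝ (EuclideanSpace ℝ (Fin n)) H)
  {M : Type*} [TopologicalSpace M] [ChartedSpace H M]
  (F : Type*) [NormedAddCommGroup F] [NormedSpace ℝ F]
  (V : M → Type*) [∀ x, AddCommGroup (V x)] [∀ x, Module ℝ (V x)] [∀ x, TopologicalSpace (V x)]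
  [TopologicalSpace (TotalSpace F V)] [FiberBundle F V] [VectorBundle ℝ F V]

/-- The coordinate expression of a section `σ` in the chart of `M` and the trivialization of `V`
around `x₀`. It is only used at points where both are defined. -/
def localRep (x₀ : M) (σ : Π x, V x) (z : EuclideanSpace ℝ (Fin n)) : F :=
  (trivializationAt F V x₀).continuousLinearMapAt ℝ ((extChartAt I x₀).symm z)
    (σ ((extChartAt I x₀).symm z))

/-- The open subset of Euclidean space that corresponds, in the chart around `x₀`, to the set
`K` (deprived of its boundary points, in particular of those in the boundary of `M`). -/
def coordInterior (x₀ : M) (K : Set M) : Set (EuclideanSpace ℝ (Fin n)) :=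
  interior (extChartAt I x₀ '' K)

theorem isOpen_coordInterior (x₀ : M) (K : Set M) : IsOpen (coordInterior I x₀ K) :=
  isOpen_interior

/-- The section `σ` is of class `W^{1,p}` (for compact `M`): its coordinate expression is in
`W^{1,p}` over each compact subset of each coordinate patch. -/
def IsSobolevSection (p : ℝ≥0∞) (σ : Π x, V x) : Prop :=
  ∀ (x₀ : M) (K : Set M), IsCompact K →
    K ⊆ (chartAt H x₀).source ∩ (trivializationAt F V x₀).baseSet →
      MemSobolev (coordInterior I x₀ K) p (localRep I F V x₀ σ)

/-- A finite family of coordinate patches of `V → M` and of compact sets inside them whose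
interiors cover `M`: the choice that goes into a Sobolev norm for sections of `V`. -/
structure SobolevCover where
  N : ℕ
  center : Fin N → M
  K : Fin N → Set M
  isCompact : ∀ i, IsCompact (K i)
  subset : ∀ i, K i ⊆ (chartAt H (center i)).source ∩ (trivializationAt F V (center i)).baseSet
  cover : ⋃ i, interior (K i) = univ

variable {I F V}

theorem localRep_zero (x₀ : M) : localRep I F V x₀ 0 = 0 := by
  funext z; exact map_zero _

theorem localRep_add (x₀ : M) (σ τ : Π x, V x) :
    localRep I F V x₀ (σ + τ) = localRep I F V x₀ σ + localRep I F V x₀ τ := by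
  funext z; exact map_add _ _ _

theorem localRep_smul (x₀ : M) (c : ℝ) (σ : Π x, V x) :
    localRep I F V x₀ (c • σ) = c • localRep I F V x₀ σ := by
  funext z; exact map_smul _ _ _

variable (I F V) in
/-- The vector space of (everywhere defined) sections of class `W^{1,p}`. -/
def sobolevSubmodule (p : ℝ≥0∞) : Submodule ℝ (Π x, V x) where
  carrier := {σ | IsSobolevSection I F V p σ}
  zero_mem' := fun x₀ K _ _ => by rw [localRep_zero]; exact MemSobolev.zero
  add_mem' := fun hσ hτ x₀ K hK hs => by
    rw [localRep_add]; exact (hσ x₀ K hK hs).add (hτ x₀ K hK hs)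
  smul_mem' := fun c σ hσ x₀ K hK hs => by
    rw [localRep_smul]; exact (hσ x₀ K hK hs).const_smul c

variable (I) in
/-- The vector space of sections of class `W^{1,p}`, to be equipped with the Sobolev seminorm
that belongs to the cover `𝒜`. -/
@[nolint unusedArguments]
def SobolevSection (_𝒜 : SobolevCover (H := H) F V) (p : ℝ≥0∞) : Type _ :=
  ↥(sobolevSubmodule I F V p)

namespace SobolevSection

variable {𝒜 : SobolevCover (H := H) F V} {p : ℝ≥0∞}

instance : AddCommGroup (SobolevSection I 𝒜 p) :=
  inferInstanceAs (AddCommGroup ↥(sobolevSubmodule I F V p))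

instance : Module ℝ (SobolevSection I 𝒜 p) :=
  inferInstanceAs (Module ℝ ↥(sobolevSubmodule I F V p))

/-- The section underlying an element of the Sobolev space. -/
def toFun (σ : SobolevSection I 𝒜 p) : Π x, V x := σ.1

theorem isSobolevSection (σ : SobolevSection I 𝒜 p) : IsSobolevSection I F V p σ.toFun := σ.2

variable (𝒜) in
/-- A section of class `W^{1,p}` as an element of the Sobolev space. -/
def ofFun (σ : Π x, V x) (hσ : IsSobolevSection I F V p σ) : SobolevSection I 𝒜 p := ⟨σ, hσ⟩

theorem memSobolev (σ : SobolevSection I 𝒜 p) (i : Fin 𝒜.N) :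
    MemSobolev (coordInterior I (𝒜.center i) (𝒜.K i)) p
      (localRep I F V (𝒜.center i) σ.toFun) :=
  σ.2 _ _ (𝒜.isCompact i) (𝒜.subset i)

/-- The Sobolev seminorm: the sum of the `W^{1,p}`-norms of the coordinate expressions. -/
def sobolevNorm (σ : SobolevSection I 𝒜 p) : ℝ :=
  ∑ i : Fin 𝒜.N, (sobolevENorm (coordInterior I (𝒜.center i) (𝒜.K i)) p
    (localRep I F V (𝒜.center i) σ.toFun)).toReal

theorem sobolevNorm_zero [FiniteDimensional ℝ F] : sobolevNorm (0 : SobolevSection I 𝒜 p) = 0 := by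
  refine Finset.sum_eq_zero fun i _ => ?_
  have h : localRep I F V (𝒜.center i) (0 : SobolevSection I 𝒜 p).toFun = 0 := localRep_zero _
  rw [h, sobolevENorm_zero (isOpen_coordInterior _ _ _), ENNReal.toReal_zero]

theorem sobolevNorm_add_le [FiniteDimensional ℝ F] (hp : 1 ≤ p) (σ τ : SobolevSection I 𝒜 p) :
    sobolevNorm (σ + τ) ≤ sobolevNorm σ + sobolevNorm τ := by
  rw [sobolevNorm, sobolevNorm, sobolevNorm, ← Finset.sum_add_distrib]
  refine Finset.sum_le_sum fun i _ => ?_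
  have h : localRep I F V (𝒜.center i) (σ + τ).toFun =
      localRep I F V (𝒜.center i) σ.toFun + localRep I F V (𝒜.center i) τ.toFun :=
    localRep_add _ _ _
  have hσ := (σ.memSobolev i).sobolevENorm_ne_top (isOpen_coordInterior _ _ _)
  have hτ := (τ.memSobolev i).sobolevENorm_ne_top (isOpen_coordInterior _ _ _)
  rw [h, ← ENNReal.toReal_add hσ hτ]
  exact ENNReal.toReal_mono (ENNReal.add_ne_top.2 ⟨hσ, hτ⟩)
    (sobolevENorm_add_le (isOpen_coordInterior _ _ _) hp (σ.memSobolev i) (τ.memSobolev i))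

theorem sobolevNorm_smul [FiniteDimensional ℝ F] (c : ℝ) (σ : SobolevSection I 𝒜 p) :
    sobolevNorm (c • σ) = ‖c‖ * sobolevNorm σ := by
  rw [sobolevNorm, sobolevNorm, Finset.mul_sum]
  refine Finset.sum_congr rfl fun i _ => ?_
  have h : localRep I F V (𝒜.center i) (c • σ).toFun =
      c • localRep I F V (𝒜.center i) σ.toFun := localRep_smul _ _ _
  rw [h, sobolevENorm_const_smul (isOpen_coordInterior _ _ _) (σ.memSobolev i), ENNReal.toReal_mul,
    toReal_enorm]

instance [FiniteDimensional ℝ F] [hp : Fact (1 ≤ p)] : SeminormedAddCommGroup (SobolevSection I 𝒜 p) :=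
  AddGroupSeminorm.toSeminormedAddCommGroup
    { toFun := sobolevNorm
      map_zero' := sobolevNorm_zero
      add_le' := sobolevNorm_add_le hp.out
      neg' := fun σ => by rw [← neg_one_smul ℝ σ, sobolevNorm_smul]; simp }

instance [FiniteDimensional ℝ F] [Fact (1 ≤ p)] : NormedSpace ℝ (SobolevSection I 𝒜 p) where
  norm_smul_le c σ := (sobolevNorm_smul c σ).le

end SobolevSection

variable (I) in
/-- The normed space `W^{1,p}(M; V)`: sections of class `W^{1,p}`, two of them being identified
when the norm of their difference vanishes, that is, when they agree almost everywhere. -/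
abbrev SobolevSpace (𝒜 : SobolevCover (H := H) F V) (p : ℝ≥0∞) [FiniteDimensional ℝ F]
    [Fact (1 ≤ p)] : Type _ :=
  SeparationQuotient (SobolevSection I 𝒜 p)

theorem SobolevSpace.mk_eq_mk_iff {𝒜 : SobolevCover (H := H) F V} {p : ℝ≥0∞}
    [FiniteDimensional ℝ F] [hp : Fact (1 ≤ p)] (σ τ : SobolevSection I 𝒜 p) :
    (SeparationQuotient.mk σ : SobolevSpace I 𝒜 p) = SeparationQuotient.mk τ ↔
      ∀ i, localRep I F V (𝒜.center i) σ.toFun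
        =ᵐ[volume.restrict (coordInterior I (𝒜.center i) (𝒜.K i))]
          localRep I F V (𝒜.center i) τ.toFun := by
  have hp0 : p ≠ 0 := (zero_lt_one.trans_le hp.out).ne'
  have hsub : ∀ i, localRep I F V (𝒜.center i) (σ - τ).toFun =
      localRep I F V (𝒜.center i) σ.toFun - localRep I F V (𝒜.center i) τ.toFun := by
    intro i; funext z; exact map_sub _ _ _
  rw [SeparationQuotient.mk_eq_mk, Metric.inseparable_iff, dist_eq_norm]
  change SobolevSection.sobolevNorm (σ - τ) = 0 ↔ _
  rw [SobolevSection.sobolevNorm, Finset.sum_eq_zero_iff_of_nonneg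
    (fun _ _ => ENNReal.toReal_nonneg)]
  refine forall_congr' fun i => ?_
  have hmem := (σ - τ).memSobolev i
  have hopen := isOpen_coordInterior I (𝒜.center i) (𝒜.K i)
  rw [ENNReal.toReal_eq_zero_iff, or_iff_left (hmem.sobolevENorm_ne_top hopen)]
  constructor
  · intro h
    have h0 := (add_eq_zero.1 (h (Finset.mem_univ i))).1
    rw [eLpNorm_eq_zero_iff hmem.1.1 hp0, hsub] at h0
    filter_upwards [h0] with z hz
    exact sub_eq_zero.1 hz
  · intro h _
    have h0 : localRep I F V (𝒜.center i) (σ - τ).toFun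
        =ᵐ[volume.restrict (coordInterior I (𝒜.center i) (𝒜.K i))] 0 := by
      rw [hsub]
      filter_upwards [h] with z hz
      exact sub_eq_zero.2 hz
    have hd : HasWeakFDeriv (coordInterior I (𝒜.center i) (𝒜.K i))
        (localRep I F V (𝒜.center i) (σ - τ).toFun) 0 := by
      refine ⟨hmem.2.choose_spec.1.1, aux_locallyIntegrableOn_zero, fun φ _ _ hs v => ?_⟩
      have h1 : (fun x => (fderiv ℝ φ x v) •
          localRep I F V (𝒜.center i) (σ - τ).toFun x) =ᵐ[volume] 0 := by
        filter_upwards [(ae_restrict_iff' hopen.measurableSet).1 h0] with z hz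
        by_cases hzΩ : z ∈ coordInterior I (𝒜.center i) (𝒜.K i)
        · simp [hz hzΩ]
        · have : fderiv ℝ φ z = 0 := image_eq_zero_of_notMem_tsupport
            (fun hz' => hzΩ (hs (tsupport_fderiv_subset ℝ hz')))
          simp [this]
      rw [integral_congr_ae h1]
      simp
    rw [sobolevENorm_eq hopen hd, eLpNorm_congr_ae h0, aux_eLpNorm_zero, aux_eLpNorm_zero,
      add_zero]

variable (F V) in
theorem SobolevCover.nonempty (J : ModelWithCorners ℝ (EuclideanSpace ℝ (Fin n)) H)
    [CompactSpace M] : Nonempty (SobolevCover (H := H) F V) := by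
  have : LocallyCompactSpace M := Manifold.locallyCompact_of_finiteDimensional J
  have h : ∀ x : M, ∃ K : Set M, IsCompact K ∧ x ∈ interior K ∧
      K ⊆ (chartAt H x).source ∩ (trivializationAt F V x).baseSet := fun x =>
    exists_compact_subset ((chartAt H x).open_source.inter (trivializationAt F V x).open_baseSet)
      ⟨mem_chart_source H x, mem_baseSet_trivializationAt F V x⟩
  choose K hK hx hs using h
  obtain ⟨t, ht⟩ := CompactSpace.elim_nhds_subcover (fun x => interior (K x))
    (fun x => isOpen_interior.mem_nhds (hx x))
  refine ⟨⟨t.card, fun i => t.equivFin.symm i, fun i => K (t.equivFin.symm i),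
    fun i => hK _, fun i => hs _, ?_⟩⟩
  refine eq_univ_of_forall fun x => ?_
  have hxt : x ∈ ⋃ y ∈ t, interior (K y) := by rw [ht]; trivial
  simp only [mem_iUnion] at hxt ⊢
  obtain ⟨y, hy, hxy⟩ := hxt
  exact ⟨t.equivFin ⟨y, hy⟩, by simpa using hxy⟩

instance fact_one_le_min (p r : ℝ≥0∞) [hp : Fact (1 ≤ p)] [hr : Fact (1 ≤ r)] :
    Fact (1 ≤ min p r) :=
  ⟨le_min hp.out hr.out⟩

end Manifold

/-! ### Locally Lipschitz bilinear bundle maps -/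

section Lipschitz

variable {n : ℕ} {H : Type*} [TopologicalSpace H]
  (I : ModelWithCorners ℝ (EuclideanSpace ℝ (Fin n)) H)
  {M : Type*} [TopologicalSpace M] [ChartedSpace H M]
  (F₁ : Type*) [NormedAddCommGroup F₁] [NormedSpace ℝ F₁]
  (V₁ : M → Type*) [∀ x, AddCommGroup (V₁ x)] [∀ x, Module ℝ (V₁ x)]
  [∀ x, TopologicalSpace (V₁ x)]
  [TopologicalSpace (TotalSpace F₁ V₁)] [FiberBundle F₁ V₁] [VectorBundle ℝ F₁ V₁]
  (F₂ : Type*) [NormedAddCommGroup F₂] [NormedSpace ℝ F₂]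
  (V₂ : M → Type*) [∀ x, AddCommGroup (V₂ x)] [∀ x, Module ℝ (V₂ x)]
  [∀ x, TopologicalSpace (V₂ x)]
  [TopologicalSpace (TotalSpace F₂ V₂)] [FiberBundle F₂ V₂] [VectorBundle ℝ F₂ V₂]
  (F₃ : Type*) [NormedAddCommGroup F₃] [NormedSpace ℝ F₃]
  (V₃ : M → Type*) [∀ x, AddCommGroup (V₃ x)] [∀ x, Module ℝ (V₃ x)]
  [∀ x, TopologicalSpace (V₃ x)]
  [TopologicalSpace (TotalSpace F₃ V₃)] [FiberBundle F₃ V₃] [VectorBundle ℝ F₃ V₃]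

/-- The points of the chart around `x₀`, in coordinates, over which all three trivializations
around `x₀` are defined. -/
def commonCoordDomain (x₀ : M) : Set (EuclideanSpace ℝ (Fin n)) :=
  (extChartAt I x₀).target ∩ (extChartAt I x₀).symm ⁻¹'
    ((trivializationAt F₁ V₁ x₀).baseSet ∩ (trivializationAt F₂ V₂ x₀).baseSet ∩
      (trivializationAt F₃ V₃ x₀).baseSet)

/-- The bilinear bundle map `μ : V₁ ×_M V₂ → V₃` is locally Lipschitz continuous: around each
point `x₀` of `M`, its expression `(z, a, b) ↦ μ_z(a, b)` in coordinates of the base and of the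
three bundles is a locally Lipschitz function of all its arguments. -/
def IsLocallyLipschitzBundleMap (μ : Π x, V₁ x →ₗ[ℝ] V₂ x →ₗ[ℝ] V₃ x) : Prop :=
  ∀ x₀ : M, LocallyLipschitzOn (commonCoordDomain I F₁ V₁ F₂ V₂ F₃ V₃ x₀ ×ˢ univ)
    (fun q : EuclideanSpace ℝ (Fin n) × (F₁ × F₂) =>
      (trivializationAt F₃ V₃ x₀).continuousLinearMapAt ℝ ((extChartAt I x₀).symm q.1)
        (μ ((extChartAt I x₀).symm q.1)
          ((trivializationAt F₁ V₁ x₀).symmL ℝ ((extChartAt I x₀).symm q.1) q.2.1)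
          ((trivializationAt F₂ V₂ x₀).symmL ℝ ((extChartAt I x₀).symm q.1) q.2.2)))

end Lipschitz

end SobolevBundle

end

noncomputable section

namespace SobolevBundle

open ContinuousLinearMap Metric
open scoped Convolution NNReal

/-! ### Mollification and local density of smooth functions in W^{1,1}. -/

section Mollification

variable {n : ℕ} {X : Type*} [NormedAddCommGroup X] [NormedSpace ℝ X]

local notation "𝔼" => EuclideanSpace ℝ (Fin n)

/-! In coordinates `μ` is a Lipschitz family `m` of bilinear maps, and the composite is `m x (u x)
(v x)` with `u` in W^{1,p} and `v` in W^{1,r}. Put s = min(p, r). On a set of finite measure `v` is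
also in W^{1,s}, and `m` is of class W^{1,∞}, so it is enough to multiply W^{1,p} by W^{1,s} into
W^{1,s} when s ≤ p and n < p. By the Leibniz rule (`HasWeakFDeriv.bilin`) the derivative has two
terms. The term u·Dv is harmless because u is bounded by Morrey's embedding
(`exists_eLpNorm_top_le`). The term Du·v is the heart of the matter: Du is only in L^p, v need not
be bounded, and the product must lie in L^s (`exists_eLpNorm_mul_le`).

Sobolev embeddings of v would require the cases s < n, s = n and s > n. One representation replaces
them: on a bounded convex domain, |v(x)| is controlled almost everywhere by the mean of |v| over a
fixed ball B and by the potential ∫₀¹∫_B |Dv|(x + t(y - x)) dy dt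
(`HasWeakFDeriv.ae_volume_mul_enorm_le`). For fixed t the inner integral is at most t^{-n} times
‖Dv‖_{L¹}, while its L¹-norm in x is bounded uniformly in t. Hölder's inequality with the weight
t^{-n/p}, followed by interpolation between these two bounds, leaves exactly ∫₀¹ t^{-n/p} dt, which
is finite because n < p.

Globally, small half-balls in charts (`chartBall`) are convex, also at boundary and corner points,
since the range of the model is convex. There the product estimate holds in the chart around the
point. Changes of charts and trivializations preserve Sobolev bounds (`exists_sobolevENorm_comp_le`,
`eventually_exists_sobolevENorm_localRep_le`), so the estimate may be moved into any patch; finitely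
many half-balls cover a compact subset of a patch up to boundary points, and `memSobolev_iUnion`
glues. The outcome is a bound of the product norm by a constant times the product of the norms, for
arbitrary covers, and a bounded bilinear map descends to the quotients by the null sections. -/

theorem integrable_indicator_of_isCompact {Y : Type*} [NormedAddCommGroup Y] {Ω T : Set 𝔼}
    {w : 𝔼 → Y}
    (h : LocallyIntegrableOn w Ω volume) (hT : IsCompact T) (hTΩ : T ⊆ Ω) :
    Integrable (T.indicator w) volume :=
  (h.integrableOn_compact_subset hTΩ hT).integrable_indicator hT.measurableSet

/-- Young's inequality for L¹: Tonelli, translation invariance, and total mass one of the kernel. -/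
theorem lintegral_enorm_normed_convolution_le (ψ : ContDiffBump (0 : 𝔼)) {f : 𝔼 → X}
    (hf : AEStronglyMeasurable f volume) :
    ∫⁻ x, ‖(ψ.normed volume ⋆[lsmul ℝ ℝ, volume] f : 𝔼 → X) x‖ₑ ≤ ∫⁻ x, ‖f x‖ₑ := by
  have hψ : AEStronglyMeasurable (ψ.normed (volume : Measure 𝔼)) volume :=
    ψ.continuous_normed.aestronglyMeasurable
  have hψ1 : ∫⁻ t, ‖ψ.normed (volume : Measure 𝔼) t‖ₑ = 1 := by
    have h := ofReal_integral_eq_lintegral_ofReal (ψ.integrable_normed (μ := (volume : Measure 𝔼)))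
      (Filter.Eventually.of_forall ψ.nonneg_normed)
    rw [ψ.integral_normed, ENNReal.ofReal_one] at h
    rw [h]
    exact lintegral_congr fun t => Real.enorm_of_nonneg (ψ.nonneg_normed t)
  calc ∫⁻ x, ‖(ψ.normed volume ⋆[lsmul ℝ ℝ, volume] f : 𝔼 → X) x‖ₑ
      ≤ ∫⁻ x, ∫⁻ t, ‖ψ.normed volume t‖ₑ * ‖f (x - t)‖ₑ := by
        refine lintegral_mono fun x => ?_
        rw [convolution_def]
        refine (enorm_integral_le_lintegral_enorm _).trans (lintegral_mono fun t => ?_)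
        simp [enorm_smul]
    _ = ∫⁻ t, ∫⁻ x, ‖ψ.normed volume t‖ₑ * ‖f (x - t)‖ₑ := by
        refine lintegral_lintegral_swap ?_
        have := (hψ.convolution_integrand (lsmul ℝ ℝ) hf (μ := volume) (ν := volume)).enorm
        simpa [enorm_smul, Function.uncurry_def] using! this
    _ = ∫⁻ t, ‖ψ.normed volume t‖ₑ * ∫⁻ x, ‖f x‖ₑ := by
        refine lintegral_congr fun t => ?_
        rw [lintegral_const_mul' _ _ enorm_ne_top,
          lintegral_sub_right_eq_self (fun x => ‖f x‖ₑ) t]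
    _ = ∫⁻ x, ‖f x‖ₑ := by
        rw [lintegral_mul_const'' _ hψ.enorm, hψ1, one_mul]

/-- Replace `f` by a continuous compactly supported `h`. Young's inequality controls the
mollification of `f - h`, uniform continuity controls that of `h` on the set `S` of finite measure,
and `h - f` is small in L¹. The radius `δ` works for every kernel, so one kernel can later serve a
function and its derivative at once. -/
theorem exists_lintegral_normed_convolution_sub_le [CompleteSpace X] {f : 𝔼 → X} (hf : Integrable f volume)
    {S : Set 𝔼} (hS : volume S ≠ ⊤) {ε : ℝ≥0∞} (hε : ε ≠ 0) :
    ∃ δ > 0, ∀ ψ : ContDiffBump (0 : 𝔼), ψ.rOut ≤ δ →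
      ∫⁻ x in S, ‖(ψ.normed volume ⋆[lsmul ℝ ℝ, volume] f : 𝔼 → X) x - f x‖ₑ ≤ ε := by
  have hε3 : ε / 3 ≠ 0 := by simp [hε]
  obtain ⟨h, hhc, hfh, hh, hhi⟩ := hf.exists_hasCompactSupport_lintegral_sub_le hε3
  obtain ⟨η, hη0, hη⟩ : ∃ η : ℝ≥0, 0 < η ∧ η * volume S ≤ ε / 3 := by
    rcases eq_or_ne (volume S) 0 with h0 | h0
    · exact ⟨1, one_pos, by simp [h0]⟩
    · obtain ⟨η, h1, h2⟩ := ENNReal.exists_nnreal_pos_mul_lt hS hε3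
      exact ⟨η, h1, h2.le⟩
  obtain ⟨δ, hδ, hδh⟩ := Metric.uniformContinuous_iff.1
    (hhc.uniformContinuous_of_continuous hh) η (by exact_mod_cast hη0)
  refine ⟨δ, hδ, fun ψ hψ => ?_⟩
  have hconv : ∀ x, (ψ.normed volume ⋆[lsmul ℝ ℝ, volume] f : 𝔼 → X) x - f x =
      (ψ.normed volume ⋆[lsmul ℝ ℝ, volume] (f - h) : 𝔼 → X) x +
      ((ψ.normed volume ⋆[lsmul ℝ ℝ, volume] h : 𝔼 → X) x - h x) + (h x - f x) := by
    intro x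
    have e1 : ConvolutionExistsAt (ψ.normed volume) (f - h) x (lsmul ℝ ℝ) volume :=
      ψ.hasCompactSupport_normed.convolutionExists_left (lsmul ℝ ℝ) ψ.continuous_normed
        (hf.sub hhi).locallyIntegrable x
    have e2 : ConvolutionExistsAt (ψ.normed volume) h x (lsmul ℝ ℝ) volume :=
      ψ.hasCompactSupport_normed.convolutionExists_left (lsmul ℝ ℝ) ψ.continuous_normed
        hhi.locallyIntegrable x
    have := e1.distrib_add e2
    rw [sub_add_cancel] at this
    rw [this]; abel
  have hunif : ∀ x, ‖(ψ.normed volume ⋆[lsmul ℝ ℝ, volume] h : 𝔼 → X) x - h x‖ₑ ≤ η := by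
    intro x
    have := ψ.dist_normed_convolution_le (μ := volume) (x₀ := x) hh.aestronglyMeasurable
      (fun y hy => (hδh (lt_of_lt_of_le hy hψ)).le)
    rw [dist_eq_norm] at this
    rw [← ofReal_norm, ← ENNReal.ofReal_coe_nnreal]
    exact ENNReal.ofReal_le_ofReal this
  have hm1 : AEStronglyMeasurable (ψ.normed volume ⋆[lsmul ℝ ℝ, volume] (f - h) : 𝔼 → X)
      volume :=
    (ψ.hasCompactSupport_normed.continuous_convolution_left (lsmul ℝ ℝ) ψ.continuous_normed
      (hf.sub hhi).locallyIntegrable).aestronglyMeasurable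
  calc ∫⁻ x in S, ‖(ψ.normed volume ⋆[lsmul ℝ ℝ, volume] f : 𝔼 → X) x - f x‖ₑ
      ≤ ∫⁻ x in S, ((‖(ψ.normed volume ⋆[lsmul ℝ ℝ, volume] (f - h) : 𝔼 → X) x‖ₑ + η)
          + ‖f x - h x‖ₑ) := by
        refine lintegral_mono fun x => ?_
        rw [hconv x]
        refine (enorm_add_le _ _).trans (add_le_add ((enorm_add_le _ _).trans
          (add_le_add le_rfl (hunif x))) ?_)
        rw [← enorm_neg, neg_sub]
    _ = ((∫⁻ x in S, ‖(ψ.normed volume ⋆[lsmul ℝ ℝ, volume] (f - h) : 𝔼 → X) x‖ₑ)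
          + η * volume S) + ∫⁻ x in S, ‖f x - h x‖ₑ := by
        rw [lintegral_add_left' (hm1.enorm.restrict.add_const _),
          lintegral_add_right _ measurable_const, setLIntegral_const]
    _ ≤ (ε / 3 + ε / 3) + ε / 3 := by
        refine add_le_add (add_le_add ?_ hη) ((setLIntegral_le_lintegral _ _).trans hfh)
        exact (setLIntegral_le_lintegral _ _).trans
          ((lintegral_enorm_normed_convolution_le ψ (hf.sub hhi).1).trans hfh)
    _ = ε := ENNReal.add_thirds ε

/-- The derivative of a mollification is the mollification of the weak derivative. -/
theorem HasWeakFDeriv.fderiv_convolution_eq {Ω T : Set 𝔼} {w : 𝔼 → X} {g : 𝔼 → 𝔼 →L[ℝ] X}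
    [CompleteSpace X]
    (h : HasWeakFDeriv Ω w g) (hT : IsCompact T) (hTΩ : T ⊆ Ω) (ψ : ContDiffBump (0 : 𝔼))
    {x : 𝔼} (hx : closedBall x ψ.rOut ⊆ T) :
    fderiv ℝ (ψ.normed volume ⋆[lsmul ℝ ℝ, volume] (T.indicator w) : 𝔼 → X) x =
      (ψ.normed volume ⋆[lsmul ℝ ℝ, volume] (T.indicator g) : 𝔼 → 𝔼 →L[ℝ] X) x := by
  have hw : Integrable (T.indicator w) volume :=
    integrable_indicator_of_isCompact h.1 hT hTΩ
  have hg : Integrable (T.indicator g) volume :=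
    integrable_indicator_of_isCompact h.2.1 hT hTΩ
  have hψ : ContDiff ℝ ∞ (ψ.normed (volume : Measure 𝔼)) := ψ.contDiff_normed (n := ⊤)
  have hd := ψ.hasCompactSupport_normed.hasFDerivAt_convolution_left (lsmul ℝ ℝ)
    (hψ.of_le (by simp)) hw.locallyIntegrable x
  rw [hd.fderiv]
  -- The reflected, translated kernel is an admissible test function, because its support lies in
  -- the ball around `x` and hence in `T ⊆ Ω`. The claim is the defining identity of the weak
  -- derivative tested against it.
  set φ : 𝔼 → ℝ := fun y => ψ.normed volume (x - y) with hφ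
  have hφs : ContDiff ℝ ∞ φ := hψ.comp (contDiff_const.sub contDiff_id)
  have hsupp : tsupport φ ⊆ closedBall x ψ.rOut := by
    refine closure_minimal (fun y hy => ?_) isClosed_closedBall
    have : x - y ∈ Function.support (ψ.normed (volume : Measure 𝔼)) := hy
    rw [ψ.support_normed_eq, mem_ball_zero_iff] at this
    rw [mem_closedBall, dist_comm, dist_eq_norm]
    exact this.le
  have hφc : HasCompactSupport φ :=
    (isCompact_closedBall x ψ.rOut).of_isClosed_subset (isClosed_tsupport _) hsupp
  have hφd : ∀ y v, fderiv ℝ φ y v = -fderiv ℝ (ψ.normed volume) (x - y) v := by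
    intro y v
    have h1 : HasFDerivAt (fun y : 𝔼 => x - y) (-ContinuousLinearMap.id ℝ 𝔼) y := by
      simpa using (hasFDerivAt_id y).const_sub x
    have h2 := ((hψ.differentiable (by simp)).differentiableAt
      (x := x - y)).hasFDerivAt.comp y h1
    rw [show φ = ψ.normed volume ∘ fun y => x - y from rfl, h2.fderiv]
    simp
  have hout : ∀ y, y ∉ T → y ∉ tsupport φ := fun y hy hy' => hy (hx (hsupp hy'))
  ext v
  have i1 : Integrable (fun y => (lsmul ℝ ℝ).precompL 𝔼 (fderiv ℝ (ψ.normed volume) (x - y))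
      (T.indicator w y)) volume := by
    have := (((ψ.hasCompactSupport_normed (μ := volume)).fderiv ℝ).convolutionExists_left
      ((lsmul ℝ ℝ : ℝ →L[ℝ] X →L[ℝ] X).precompL 𝔼)
      (hψ.continuous_fderiv (by simp)) hw.locallyIntegrable x)
    exact this.integrable_swap
  have i2 : Integrable (fun y => ψ.normed volume (x - y) • T.indicator g y) volume := by
    have := ((ψ.hasCompactSupport_normed (μ := volume)).convolutionExists_left
      (lsmul ℝ ℝ : ℝ →L[ℝ] (𝔼 →L[ℝ] X) →L[ℝ] (𝔼 →L[ℝ] X)) ψ.continuous_normed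
      hg.locallyIntegrable x)
    exact this.integrable_swap
  rw [convolution_eq_swap, convolution_lsmul_swap, ContinuousLinearMap.integral_apply i1,
    ContinuousLinearMap.integral_apply i2]
  have e1 : ∀ y, ((lsmul ℝ ℝ : ℝ →L[ℝ] X →L[ℝ] X).precompL 𝔼
      (fderiv ℝ (ψ.normed volume) (x - y)) (T.indicator w y)) v = -(fderiv ℝ φ y v • w y) := by
    intro y
    by_cases hy : y ∈ T
    · simp [hφd, hy, ContinuousLinearMap.precompL_apply]
    · have hz : fderiv ℝ φ y = 0 := image_eq_zero_of_notMem_tsupport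
        (fun hz => hout y hy (tsupport_fderiv_subset ℝ hz))
      simp [hz, hy]
  have e2 : ∀ y, (ψ.normed volume (x - y) • T.indicator g y) v = φ y • g y v := by
    intro y
    by_cases hy : y ∈ T
    · simp [hφ, hy]
    · have hz : φ y = 0 := image_eq_zero_of_notMem_tsupport (hout y hy)
      simp [hz, hy]
  simp_rw [e1, e2]
  rw [integral_neg, h.2.2 φ hφs hφc ((hsupp.trans hx).trans hTΩ) v, neg_neg]

/-- Local density of smooth functions in `W^{1,1}`. -/
theorem HasWeakFDeriv.exists_contDiff_lintegral_sub_le [CompleteSpace X] {Ω S : Set 𝔼}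
    {w : 𝔼 → X} {g : 𝔼 → 𝔼 →L[ℝ] X} (h : HasWeakFDeriv Ω w g) (hΩ : IsOpen Ω)
    (hS : IsCompact S) (hSΩ : S ⊆ Ω) {ε : ℝ≥0∞} (hε : ε ≠ 0) :
    ∃ φ : 𝔼 → X, ContDiff ℝ ∞ φ ∧ ∫⁻ x in S, ‖φ x - w x‖ₑ ≤ ε ∧
      ∫⁻ x in S, ‖fderiv ℝ φ x - g x‖ₑ ≤ ε := by
  -- Cutting `w` and `g` off outside a thickening `T` of `S` makes them integrable. Kernels of
  -- radius at most `δ` centred at points of `S` do not see the cut.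
  obtain ⟨δ, hδ, hδΩ⟩ := hS.exists_cthickening_subset_open hΩ hSΩ
  set T := cthickening δ S with hTdef
  have hT : IsCompact T := hS.cthickening
  have hST : S ⊆ T := self_subset_cthickening S
  have hw : Integrable (T.indicator w) volume :=
    integrable_indicator_of_isCompact h.1 hT hδΩ
  have hg : Integrable (T.indicator g) volume :=
    integrable_indicator_of_isCompact h.2.1 hT hδΩ
  obtain ⟨δ₁, hδ₁, h₁⟩ := exists_lintegral_normed_convolution_sub_le hw hS.measure_ne_top hε
  obtain ⟨δ₂, hδ₂, h₂⟩ := exists_lintegral_normed_convolution_sub_le hg hS.measure_ne_top hε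
  have hm : 0 < min δ (min δ₁ δ₂) := lt_min hδ (lt_min hδ₁ hδ₂)
  let ψ : ContDiffBump (0 : 𝔼) := ⟨min δ (min δ₁ δ₂) / 2, min δ (min δ₁ δ₂), by positivity,
    by linarith⟩
  refine ⟨(ψ.normed volume ⋆[lsmul ℝ ℝ, volume] (T.indicator w) : 𝔼 → X),
    ψ.hasCompactSupport_normed.contDiff_convolution_left _ (ψ.contDiff_normed (n := ⊤))
      hw.locallyIntegrable, ?_, ?_⟩
  · refine le_trans (le_of_eq ?_)
      (h₁ ψ ((min_le_right _ _).trans (min_le_left _ _)))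
    refine setLIntegral_congr_fun hS.measurableSet fun x hx => ?_
    simp only [indicator_of_mem (hST hx)]
  · refine le_trans (le_of_eq ?_)
      (h₂ ψ ((min_le_right _ _).trans (min_le_right _ _)))
    refine setLIntegral_congr_fun hS.measurableSet fun x hx => ?_
    simp only [indicator_of_mem (hST hx)]
    rw [h.fderiv_convolution_eq hT hδΩ ψ]
    exact (closedBall_subset_closedBall (min_le_left _ _)).trans
      (closedBall_subset_cthickening hx δ)

end Mollification

/-! ### Stability of weak derivatives and Sobolev norms. -/

section Calculus

variable {n : ℕ} {X : Type*} [NormedAddCommGroup X] [NormedSpace ℝ X]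

local notation "𝔼" => EuclideanSpace ℝ (Fin n)

theorem HasWeakFDeriv.mono {Ω Ω' : Set 𝔼} {u : 𝔼 → X} {g : 𝔼 → 𝔼 →L[ℝ] X}
    (h : HasWeakFDeriv Ω u g) (hs : Ω' ⊆ Ω) : HasWeakFDeriv Ω' u g :=
  ⟨h.1.mono_set hs, h.2.1.mono_set hs, fun φ hφ hc ht v => h.2.2 φ hφ hc (ht.trans hs) v⟩

theorem HasWeakFDeriv.sub {Ω : Set 𝔼} {u u' : 𝔼 → X} {g g' : 𝔼 → 𝔼 →L[ℝ] X}
    (h : HasWeakFDeriv Ω u g) (h' : HasWeakFDeriv Ω u' g') :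
    HasWeakFDeriv Ω (u - u') (g - g') := by
  have h1 := h.add (h'.const_smul (-1))
  rwa [neg_one_smul, neg_one_smul, ← sub_eq_add_neg, ← sub_eq_add_neg] at h1

/-- Integration by parts against a compactly supported function; differentiability of `f` is needed
only on the support of the test function. -/
theorem hasWeakFDeriv_of_hasFDerivAt {U : Set 𝔼} (hU : IsOpen U) {f : 𝔼 → X}
    {f' : 𝔼 → 𝔼 →L[ℝ] X} (hf : ∀ x ∈ U, HasFDerivAt f (f' x) x) (hf' : ContinuousOn f' U) :
    HasWeakFDeriv U f f' := by
  have hfc : ContinuousOn f U := fun x hx => (hf x hx).continuousAt.continuousWithinAt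
  have l1 : LocallyIntegrableOn f U volume := hfc.locallyIntegrableOn hU.measurableSet
  have l2 : LocallyIntegrableOn f' U volume := hf'.locallyIntegrableOn hU.measurableSet
  refine ⟨l1, l2, fun φ hφ hc hs v => ?_⟩
  have := integral_bilinear_hasFDerivAt_right_eq_neg_left_of_integrable
    (μ := (volume : Measure 𝔼)) (f := φ) (f' := fderiv ℝ φ) (g := f) (g' := f') (v := v)
    (B := lsmul ℝ ℝ) (integrable_fderiv_smul l1 hφ hc hs v)
    (integrable_smul_of_tsupport_subset (locallyIntegrableOn_apply l2 v) hφ.continuous hc hs)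
    (integrable_smul_of_tsupport_subset l1 hφ.continuous hc hs)
    (fun x _ => (hφ.differentiable (by simp)).differentiableAt.hasFDerivAt)
    (fun x hx => hf x (hs hx))
  simp only [lsmul_apply] at this
  rw [this, neg_neg]

/-- Weak derivatives are stable under local approximation in `L¹`. -/
theorem hasWeakFDeriv_of_forall_approx {U : Set 𝔼} {f : 𝔼 → X} {f' : 𝔼 → 𝔼 →L[ℝ] X}
    (hf : LocallyIntegrableOn f U volume) (hf' : LocallyIntegrableOn f' U volume)
    (H : ∀ S : Set 𝔼, IsCompact S → S ⊆ U → ∀ ε : ℝ≥0∞, ε ≠ 0 → ε ≠ ⊤ →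
      ∃ (V : Set 𝔼) (k : 𝔼 → X) (k' : 𝔼 → 𝔼 →L[ℝ] X), S ⊆ V ∧ HasWeakFDeriv V k k' ∧
        ∫⁻ x in S, ‖k x - f x‖ₑ ≤ ε ∧ ∫⁻ x in S, ‖k' x - f' x‖ₑ ≤ ε) :
    HasWeakFDeriv U f f' := by
  refine ⟨hf, hf', fun φ hφ hc hs v => ?_⟩
  obtain ⟨M₀, hM₀⟩ := hc.exists_bound_of_continuous hφ.continuous
  obtain ⟨M₁, hM₁⟩ := (hc.fderiv_apply (𝕜 := ℝ) v).exists_bound_of_continuous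
    ((hφ.continuous_fderiv (by simp)).clm_apply continuous_const)
  set S := tsupport φ
  have i1 := integrable_fderiv_smul hf hφ hc hs v
  have i2 := integrable_smul_of_tsupport_subset (locallyIntegrableOn_apply hf' v) hφ.continuous hc hs
  rw [← add_eq_zero_iff_eq_neg, ← enorm_eq_zero]
  -- The defect of the identity is linear in the pair. It vanishes for `(k, k')`, so for `(f, f')`
  -- it is at most `c` times the L¹-error on the support of the test function.
  set c : ℝ≥0∞ := ENNReal.ofReal M₁ + ENNReal.ofReal M₀ * ‖v‖ₑ with hcdef
  have hctop : c ≠ ⊤ := by finiteness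
  have key : ∀ ε : ℝ≥0∞, ε ≠ 0 → ε ≠ ⊤ →
      ‖(∫ x, fderiv ℝ φ x v • f x) + ∫ x, φ x • f' x v‖ₑ ≤ c * ε := by
    intro ε hε hεt
    obtain ⟨V, k, k', hSV, hk, hk1, hk2⟩ := H S hc hs ε hε hεt
    have j1 := integrable_fderiv_smul hk.1 hφ hc hSV v
    have j2 := integrable_smul_of_tsupport_subset (locallyIntegrableOn_apply hk.2.1 v)
      hφ.continuous hc hSV
    have e := hk.2.2 φ hφ hc hSV v
    have e' : (∫ x, fderiv ℝ φ x v • f x) + ∫ x, φ x • f' x v =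
        -((∫ x, fderiv ℝ φ x v • (k x - f x)) + ∫ x, φ x • (k' x v - f' x v)) := by
      simp only [smul_sub]
      rw [integral_sub j1 i1, integral_sub j2 i2, e]; abel
    rw [e', enorm_neg]
    refine (enorm_add_le _ _).trans ?_
    rw [hcdef, add_mul]
    refine add_le_add ?_ ?_
    · calc ‖∫ x, fderiv ℝ φ x v • (k x - f x)‖ₑ ≤ ∫⁻ x, ‖fderiv ℝ φ x v • (k x - f x)‖ₑ :=
            enorm_integral_le_lintegral_enorm _
        _ = ∫⁻ x in S, ‖fderiv ℝ φ x v • (k x - f x)‖ₑ := by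
            refine (setLIntegral_eq_of_support_subset ?_).symm
            intro x hx
            by_contra hxS
            refine hx ?_
            have : fderiv ℝ φ x = 0 := image_eq_zero_of_notMem_tsupport
              (fun h => hxS (tsupport_fderiv_subset ℝ h))
            simp [this]
        _ ≤ ∫⁻ x in S, ENNReal.ofReal M₁ * ‖k x - f x‖ₑ := by
            refine lintegral_mono fun x => ?_
            rw [enorm_smul, ← ofReal_norm (fderiv ℝ φ x v)]
            exact mul_le_mul_left (ENNReal.ofReal_le_ofReal (hM₁ x)) _
        _ ≤ ENNReal.ofReal M₁ * ε := by
            rw [lintegral_const_mul' _ _ ENNReal.ofReal_ne_top]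
            exact mul_le_mul_right hk1 _
    · calc ‖∫ x, φ x • (k' x v - f' x v)‖ₑ ≤ ∫⁻ x, ‖φ x • (k' x v - f' x v)‖ₑ :=
            enorm_integral_le_lintegral_enorm _
        _ = ∫⁻ x in S, ‖φ x • (k' x v - f' x v)‖ₑ := by
            refine (setLIntegral_eq_of_support_subset ?_).symm
            intro x hx
            by_contra hxS
            refine hx ?_
            have : φ x = 0 := image_eq_zero_of_notMem_tsupport hxS
            simp [this]
        _ ≤ ∫⁻ x in S, (ENNReal.ofReal M₀ * ‖v‖ₑ) * ‖k' x - f' x‖ₑ := by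
            refine lintegral_mono fun x => ?_
            rw [enorm_smul, ← ofReal_norm (φ x), mul_assoc]
            refine mul_le_mul' (ENNReal.ofReal_le_ofReal (hM₀ x)) ?_
            rw [mul_comm]
            exact (k' x - f' x).le_opENorm v
        _ ≤ ENNReal.ofReal M₀ * ‖v‖ₑ * ε := by
            rw [lintegral_const_mul' _ _ (by finiteness)]
            exact mul_le_mul_right hk2 _
  refine le_antisymm (ENNReal.le_of_forall_pos_le_add fun ε hε _ => ?_) bot_le
  rw [zero_add]
  have hc1 : c + 1 ≠ 0 := by simp
  refine (key (ε / (c + 1)) ?_ ?_).trans ?_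
  · exact (ENNReal.div_pos (by exact_mod_cast hε.ne') (by finiteness)).ne'
  · exact (ENNReal.div_lt_top (by finiteness) hc1).ne
  · calc c * (ε / (c + 1)) ≤ (c + 1) * (ε / (c + 1)) := by gcongr; exact le_self_add
      _ = ε := ENNReal.mul_div_cancel hc1 (by finiteness)

theorem MemSobolev.mono_set {Ω Ω' : Set 𝔼} {u : 𝔼 → X} {q : ℝ≥0∞}
    (h : MemSobolev Ω q u) (hs : Ω' ⊆ Ω) : MemSobolev Ω' q u := by
  obtain ⟨hu, g, hg, hgq⟩ := h
  exact ⟨hu.mono_measure (Measure.restrict_mono hs le_rfl), g, hg.mono hs,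
    hgq.mono_measure (Measure.restrict_mono hs le_rfl)⟩

theorem MemSobolev.sobolevENorm_mono_set [FiniteDimensional ℝ X] {Ω Ω' : Set 𝔼} {u : 𝔼 → X}
    {q : ℝ≥0∞} (h : MemSobolev Ω q u) (hΩ : IsOpen Ω) (hΩ' : IsOpen Ω') (hs : Ω' ⊆ Ω) :
    sobolevENorm Ω' q u ≤ sobolevENorm Ω q u := by
  obtain ⟨hu, g, hg, hgq⟩ := h
  rw [sobolevENorm_eq hΩ hg, sobolevENorm_eq hΩ' (hg.mono hs)]
  exact add_le_add (eLpNorm_mono_measure _ (Measure.restrict_mono hs le_rfl))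
    (eLpNorm_mono_measure _ (Measure.restrict_mono hs le_rfl))

theorem locallyIntegrableOn_of_memLp {Y : Type*} [NormedAddCommGroup Y] {Ω : Set 𝔼}
    {w : 𝔼 → Y} {q : ℝ≥0∞} (hq : 1 ≤ q) (h : MemLp w q (volume.restrict Ω)) :
    LocallyIntegrableOn w Ω volume :=
  locallyIntegrableOn_of_locallyIntegrable_restrict (h.locallyIntegrable hq)

theorem HasWeakFDeriv.congr_ae {Ω : Set 𝔼} (hΩ : IsOpen Ω) {u u' : 𝔼 → X}
    {g g' : 𝔼 → 𝔼 →L[ℝ] X}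
    (h : HasWeakFDeriv Ω u g) (hu : u =ᵐ[volume.restrict Ω] u')
    (hg : g =ᵐ[volume.restrict Ω] g') : HasWeakFDeriv Ω u' g' := by
  have aux : ∀ {Y : Type _} [NormedAddCommGroup Y] {w w' : 𝔼 → Y},
      LocallyIntegrableOn w Ω volume → w =ᵐ[volume.restrict Ω] w' →
      LocallyIntegrableOn w' Ω volume := by
    intro Y _ w w' hw he
    refine (locallyIntegrableOn_iff hΩ.isLocallyClosed).2 fun k hk hkc => ?_
    exact (hw.integrableOn_compact_subset hk hkc).congr
      (ae_restrict_of_ae_restrict_of_subset hk he)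
  have hu' := (ae_restrict_iff' hΩ.measurableSet).1 hu
  have hg' := (ae_restrict_iff' hΩ.measurableSet).1 hg
  refine ⟨aux h.1 hu, aux h.2.1 hg, fun φ hφ hc hs v => ?_⟩
  have e1 : ∫ x, fderiv ℝ φ x v • u' x = ∫ x, fderiv ℝ φ x v • u x := by
    refine integral_congr_ae ?_
    filter_upwards [hu'] with x hx
    by_cases hxΩ : x ∈ Ω
    · rw [hx hxΩ]
    · have : fderiv ℝ φ x = 0 := image_eq_zero_of_notMem_tsupport
        (fun h => hxΩ (hs (tsupport_fderiv_subset ℝ h)))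
      simp [this]
  have e2 : ∫ x, φ x • g' x v = ∫ x, φ x • g x v := by
    refine integral_congr_ae ?_
    filter_upwards [hg'] with x hx
    by_cases hxΩ : x ∈ Ω
    · rw [hx hxΩ]
    · simp [image_eq_zero_of_notMem_tsupport (fun h => hxΩ (hs h))]
  rw [e1, e2, h.2.2 φ hφ hc hs v]

theorem MemSobolev.congr_ae {Ω : Set 𝔼} (hΩ : IsOpen Ω) {u u' : 𝔼 → X} {q : ℝ≥0∞}
    (h : MemSobolev Ω q u) (hu : u =ᵐ[volume.restrict Ω] u') : MemSobolev Ω q u' := by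
  obtain ⟨h1, g, hg, hgq⟩ := h
  exact ⟨h1.ae_eq hu, g, hg.congr_ae hΩ hu (Filter.EventuallyEq.refl _ _), hgq⟩

theorem sobolevENorm_congr_ae [FiniteDimensional ℝ X] {Ω : Set 𝔼} (hΩ : IsOpen Ω)
    {u u' : 𝔼 → X} {q : ℝ≥0∞} (h : MemSobolev Ω q u) (hu : u =ᵐ[volume.restrict Ω] u') :
    sobolevENorm Ω q u = sobolevENorm Ω q u' := by
  obtain ⟨h1, g, hg, hgq⟩ := h
  rw [sobolevENorm_eq hΩ hg,
    sobolevENorm_eq hΩ (hg.congr_ae hΩ hu (Filter.EventuallyEq.refl _ _)), eLpNorm_congr_ae hu]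

theorem MemSobolev.congr {Ω : Set 𝔼} (hΩ : IsOpen Ω) {u u' : 𝔼 → X} {q : ℝ≥0∞}
    (h : MemSobolev Ω q u) (hu : EqOn u u' Ω) : MemSobolev Ω q u' :=
  h.congr_ae hΩ (ae_restrict_of_forall_mem hΩ.measurableSet hu)

theorem sobolevENorm_congr [FiniteDimensional ℝ X] {Ω : Set 𝔼} (hΩ : IsOpen Ω)
    {u u' : 𝔼 → X} {q : ℝ≥0∞} (h : MemSobolev Ω q u) (hu : EqOn u u' Ω) :
    sobolevENorm Ω q u = sobolevENorm Ω q u' :=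
  sobolevENorm_congr_ae hΩ h (ae_restrict_of_forall_mem hΩ.measurableSet hu)

/-- On a set of finite measure, `W^{1,q}` is contained in `W^{1,q'}` for `q' ≤ q`. -/
theorem exists_sobolevENorm_le_of_exponent_le [FiniteDimensional ℝ X] {Ω : Set 𝔼} (hΩ : IsOpen Ω)
    (hfin : volume Ω ≠ ⊤) {q q' : ℝ≥0∞} (hq'1 : 1 ≤ q') (hq : q' ≤ q) :
    ∃ c : ℝ≥0∞, c ≠ ⊤ ∧ ∀ u : 𝔼 → X, MemSobolev Ω q u →
      MemSobolev Ω q' u ∧ sobolevENorm Ω q' u ≤ c * sobolevENorm Ω q u := by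
  have : IsFiniteMeasure (volume.restrict Ω) := ⟨by simpa using hfin.lt_top⟩
  refine ⟨(volume.restrict Ω) univ ^ (1 / q'.toReal - 1 / q.toReal), ?_, fun u hu => ?_⟩
  · refine ENNReal.rpow_ne_top_of_nonneg ?_ (measure_ne_top _ _)
    -- At `q = ⊤` the real value of the exponent is 0 and `1 / 0 = 0`, which is the correct Hölder
    -- exponent.
    rcases eq_or_ne q ⊤ with rfl | hqt
    · simp
    · rw [sub_nonneg]
      exact one_div_le_one_div_of_le
        (ENNReal.toReal_pos (zero_lt_one.trans_le hq'1).ne' (ne_top_of_le_ne_top hqt hq))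
        (ENNReal.toReal_mono hqt hq)
  · obtain ⟨h1, g, hg, hgq⟩ := hu
    refine ⟨⟨h1.mono_exponent hq, g, hg, hgq.mono_exponent hq⟩, ?_⟩
    rw [sobolevENorm_eq hΩ hg, sobolevENorm_eq hΩ hg, mul_add, mul_comm, mul_comm _ (eLpNorm g _ _)]
    exact add_le_add (eLpNorm_le_eLpNorm_mul_rpow_measure_univ hq h1.1)
      (eLpNorm_le_eLpNorm_mul_rpow_measure_univ hq hgq.1)

end Calculus

/-! ### Composition with a diffeomorphism. -/

section Composition

variable {n : ℕ} {X : Type*} [NormedAddCommGroup X] [NormedSpace ℝ X]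

local notation "𝔼" => EuclideanSpace ℝ (Fin n)

/-- The area formula for an injective map whose Jacobian is at least 1/L. This one comparison of
measures transfers L^q-norms, measurability and null sets through `τ`. -/
theorem map_restrict_le_smul_of_abs_det {U Ω : Set 𝔼} (hU : IsOpen U)
    {τ : 𝔼 → 𝔼} {τ' : 𝔼 → 𝔼 →L[ℝ] 𝔼} (hτ : ∀ x ∈ U, HasFDerivAt τ (τ' x) x)
    (hinj : InjOn τ U) (hmaps : MapsTo τ U Ω) {L : ℝ≥0}
    (hdet : ∀ x ∈ U, 1 ≤ L * |(τ' x).det|) :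
    (volume.restrict U).map τ ≤ (L : ℝ≥0∞) • volume.restrict Ω := by
  have hc : ContinuousOn τ U := fun x hx => (hτ x hx).continuousAt.continuousWithinAt
  refine Measure.le_iff.2 fun s hs => ?_
  have hm : MeasurableSet (U ∩ τ ⁻¹' s) := by
    classical
    have := hc.measurable_piecewise (continuousOn_const (c := (0 : 𝔼))) hU.measurableSet
    have h2 := hU.measurableSet.inter (this hs)
    convert h2 using 1
    ext x
    simp only [mem_inter_iff, mem_preimage]
    refine and_congr_right fun hx => ?_
    simp [piecewise, hx]
  rw [Measure.map_apply_of_aemeasurable (hc.aemeasurable hU.measurableSet) hs,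
    Measure.smul_apply, Measure.restrict_apply hs, Measure.restrict_apply' hU.measurableSet,
    inter_comm, smul_eq_mul]
  calc volume (U ∩ τ ⁻¹' s) = ∫⁻ _ in U ∩ τ ⁻¹' s, 1 := by simp
    _ ≤ ∫⁻ x in U ∩ τ ⁻¹' s, L * ENNReal.ofReal |(τ' x).det| := by
        refine setLIntegral_mono' hm fun x hx => ?_
        rw [← ENNReal.ofReal_coe_nnreal, ← ENNReal.ofReal_mul L.coe_nonneg, ← ENNReal.ofReal_one]
        exact ENNReal.ofReal_le_ofReal (hdet x hx.1)
    _ = L * volume (τ '' (U ∩ τ ⁻¹' s)) := by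
        rw [lintegral_const_mul' _ _ ENNReal.coe_ne_top,
          lintegral_abs_det_fderiv_eq_addHaar_image volume hm
            (fun x hx => (hτ x hx.1).hasFDerivWithinAt) (hinj.mono inter_subset_left)]
    _ ≤ L * volume (s ∩ Ω) := by
        gcongr
        rintro _ ⟨x, hx, rfl⟩
        exact ⟨hx.2, hmaps hx.1⟩

/-- Sobolev functions are stable under composition with a bi-Lipschitz diffeomorphism. -/
theorem exists_sobolevENorm_comp_le [FiniteDimensional ℝ X] {U Ω : Set 𝔼} (hU : IsOpen U)
    (hΩ : IsOpen Ω) (hfin : volume Ω ≠ ⊤)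
    {τ : 𝔼 → 𝔼} {τ' : 𝔼 → 𝔼 →L[ℝ] 𝔼} (hτ : ∀ x ∈ U, HasFDerivAt τ (τ' x) x)
    (hτ' : ContinuousOn τ' U) (hinj : InjOn τ U) (hmaps : MapsTo τ U Ω) {L : ℝ≥0}
    (hdet : ∀ x ∈ U, 1 ≤ L * |(τ' x).det|) (hL : ∀ x ∈ U, ‖τ' x‖ ≤ L) {q : ℝ≥0∞} (hq : 1 ≤ q) :
    ∃ c : ℝ≥0∞, c ≠ ⊤ ∧ ∀ w : 𝔼 → X, MemSobolev Ω q w →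
      MemSobolev U q (w ∘ τ) ∧ sobolevENorm U q (w ∘ τ) ≤ c * sobolevENorm Ω q w := by
  have : CompleteSpace X := FiniteDimensional.complete ℝ X
  have : IsFiniteMeasure (volume.restrict Ω) := ⟨by simpa using hfin.lt_top⟩
  have hmap := map_restrict_le_smul_of_abs_det hU hτ hinj hmaps hdet
  have hc : ContinuousOn τ U := fun x hx => (hτ x hx).continuousAt.continuousWithinAt
  have hcm : AEMeasurable τ (volume.restrict U) := hc.aemeasurable hU.measurableSet
  -- For `q = ⊤` the exponent is 0, so `d = 1`.
  set d : ℝ≥0∞ := (L : ℝ≥0∞) ^ (1 / q).toReal with hd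
  have hdt : d ≠ ⊤ := ENNReal.rpow_ne_top_of_nonneg ENNReal.toReal_nonneg ENNReal.coe_ne_top
  have hcomp : ∀ {Y : Type _} [NormedAddCommGroup Y] (w : 𝔼 → Y) (s : ℝ≥0∞),
      MemLp w s (volume.restrict Ω) → MemLp (w ∘ τ) s (volume.restrict U) := fun w s hw =>
    (hw.of_measure_le_smul ENNReal.coe_ne_top hmap).comp_of_map hcm
  have hcompn : ∀ {Y : Type _} [NormedAddCommGroup Y] (w : 𝔼 → Y),
      MemLp w q (volume.restrict Ω) →
        eLpNorm (w ∘ τ) q (volume.restrict U) ≤ d * eLpNorm w q (volume.restrict Ω) := by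
    intro Y _ w hw
    rw [← eLpNorm_map_measure (hw.of_measure_le_smul ENNReal.coe_ne_top hmap).1 hcm]
    refine (eLpNorm_le_of_measure_le_smul hmap).trans (le_of_eq ?_)
    simp [hd]
  have hcompl : ∀ (k : 𝔼 → ℝ≥0∞) (S : Set 𝔼), S ⊆ U → IsCompact S →
      AEMeasurable k (volume.restrict Ω) → ∫⁻ x in S, k (τ x) ≤ L * ∫⁻ y in τ '' S, k y := by
    intro k S hSU hS hk
    have hSm : MeasurableSet (τ '' S) := (hS.image_of_continuousOn (hc.mono hSU)).measurableSet
    have hk' : AEMeasurable ((τ '' S).indicator k) ((volume.restrict U).map τ) :=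
      (hk.indicator hSm).mono_ac (Measure.absolutelyContinuous_of_le_smul hmap)
    calc ∫⁻ x in S, k (τ x) = ∫⁻ x in S, (τ '' S).indicator k (τ x) := by
          refine setLIntegral_congr_fun hS.measurableSet fun x hx => ?_
          simp only [indicator_of_mem (mem_image_of_mem τ hx)]
      _ ≤ ∫⁻ x in U, (τ '' S).indicator k (τ x) := lintegral_mono_set hSU
      _ = ∫⁻ y, (τ '' S).indicator k y ∂((volume.restrict U).map τ) :=
          (lintegral_map' hk' hcm).symm
      _ ≤ ∫⁻ y, (τ '' S).indicator k y ∂((L : ℝ≥0∞) • volume.restrict Ω) :=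
          lintegral_mono' hmap le_rfl
      _ = L * ∫⁻ y in Ω, (τ '' S).indicator k y := by rw [lintegral_smul_measure, smul_eq_mul]
      _ ≤ L * ∫⁻ y, (τ '' S).indicator k y := by gcongr; exact Measure.restrict_le_self
      _ = L * ∫⁻ y in τ '' S, k y := by rw [lintegral_indicator hSm]
  have hτm : AEStronglyMeasurable τ' (volume.restrict U) :=
    hτ'.aestronglyMeasurable hU.measurableSet
  refine ⟨d + L * d, by finiteness, fun w hw => ?_⟩
  obtain ⟨hwq, g, hg, hgq⟩ := hw
  -- The chain-rule candidate. It is exact when `w` is smooth, and smooth functions approximate `w`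
  -- in W^{1,1} on the compact image of `S`.
  set f' : 𝔼 → 𝔼 →L[ℝ] X := fun x => (g (τ x)).comp (τ' x) with hf'
  have hf'm : AEStronglyMeasurable f' (volume.restrict U) :=
    (compL ℝ 𝔼 𝔼 X).aestronglyMeasurable_comp₂ (hcomp g q hgq).1 hτm
  have hf'b : ∀ᵐ x ∂(volume.restrict U), ‖f' x‖ ≤ L * ‖(g ∘ τ) x‖ := by
    refine ae_restrict_of_forall_mem hU.measurableSet fun x hx => ?_
    refine (opNorm_comp_le _ _).trans ?_
    rw [mul_comm]
    exact mul_le_mul_of_nonneg_right (hL x hx) (norm_nonneg _)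
  have hf'q : MemLp f' q (volume.restrict U) := (hcomp g q hgq).of_le_mul hf'm hf'b
  have hweak : HasWeakFDeriv U (w ∘ τ) f' := by
    refine hasWeakFDeriv_of_forall_approx (locallyIntegrableOn_of_memLp hq (hcomp w q hwq))
      (locallyIntegrableOn_of_memLp hq hf'q) fun S hS hSU ε hε hεt => ?_
    have hSc : IsCompact (τ '' S) := hS.image_of_continuousOn (hc.mono hSU)
    -- Composition costs a factor `L` for the function and `L * L` for the derivative; the summand 1
    -- keeps the denominator nonzero.
    set e : ℝ≥0∞ := ε / (L * L + L + 1) with he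
    have hden : (L * L + L + 1 : ℝ≥0∞) ≠ 0 := by simp
    have he0 : e ≠ 0 := (ENNReal.div_pos hε (by finiteness)).ne'
    have hee : (L * L + L + 1 : ℝ≥0∞) * e = ε := ENNReal.mul_div_cancel hden (by finiteness)
    obtain ⟨φ, hφ, h1, h2⟩ := hg.exists_contDiff_lintegral_sub_le hΩ hSc
      (image_subset_iff.2 fun x hx => hmaps (hSU hx)) he0
    have hφ' : Continuous (fderiv ℝ φ) := hφ.continuous_fderiv (by simp)
    refine ⟨U, φ ∘ τ, fun x => (fderiv ℝ φ (τ x)).comp (τ' x), hSU,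
      hasWeakFDeriv_of_hasFDerivAt hU (fun x hx =>
        ((hφ.differentiable (by simp)).differentiableAt.hasFDerivAt).comp x (hτ x hx))
        ((hφ'.comp_continuousOn hc).clm_comp hτ'), ?_, ?_⟩
    · refine (hcompl (fun y => ‖φ y - w y‖ₑ) S hSU hS
        (hφ.continuous.aestronglyMeasurable.sub hwq.1).enorm).trans ?_
      rw [← hee]
      gcongr
      exact le_trans le_add_self le_self_add
    · calc ∫⁻ x in S, ‖(fderiv ℝ φ (τ x)).comp (τ' x) - f' x‖ₑ
          ≤ ∫⁻ x in S, L * ‖fderiv ℝ φ (τ x) - g (τ x)‖ₑ := by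
            refine setLIntegral_mono' hS.measurableSet fun x hx => ?_
            rw [hf', ← sub_comp, ← ofReal_norm, ← ofReal_norm, ← ENNReal.ofReal_coe_nnreal,
              ← ENNReal.ofReal_mul L.coe_nonneg]
            refine ENNReal.ofReal_le_ofReal ((opNorm_comp_le _ _).trans ?_)
            rw [mul_comm]
            exact mul_le_mul_of_nonneg_right (hL x (hSU hx)) (norm_nonneg _)
        _ = L * ∫⁻ x in S, ‖fderiv ℝ φ (τ x) - g (τ x)‖ₑ :=
            lintegral_const_mul' _ _ ENNReal.coe_ne_top
        _ ≤ L * (L * e) := by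
            gcongr
            exact (hcompl (fun y => ‖fderiv ℝ φ y - g y‖ₑ) S hSU hS
              (hφ'.aestronglyMeasurable.sub hgq.1).enorm).trans (by gcongr)
        _ ≤ ε := by
            rw [← hee, ← mul_assoc]
            gcongr
            exact le_self_add.trans le_self_add
  refine ⟨⟨hcomp w q hwq, f', hweak, hf'q⟩, ?_⟩
  rw [sobolevENorm_eq hU hweak, sobolevENorm_eq hΩ hg]
  have hn2 : eLpNorm f' q (volume.restrict U) ≤ L * (d * eLpNorm g q (volume.restrict Ω)) := by
    have := eLpNorm_le_nnreal_smul_eLpNorm_of_ae_le_mul (f := f') (g := g ∘ τ) (c := L)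
      (by filter_upwards [hf'b] with x hx using by exact_mod_cast hx) q
    refine this.trans ?_
    rw [ENNReal.smul_def, smul_eq_mul]
    gcongr
    exact hcompn g hgq
  calc _ ≤ d * eLpNorm w q (volume.restrict Ω) + L * (d * eLpNorm g q (volume.restrict Ω)) :=
        add_le_add (hcompn w hwq) hn2
    _ ≤ (d + L * d) * eLpNorm w q (volume.restrict Ω) +
        (d + L * d) * eLpNorm g q (volume.restrict Ω) := by
        rw [← mul_assoc]
        gcongr
        · exact le_self_add
        · exact le_add_self
    _ = _ := (mul_add _ _ _).symm

end Composition

/-! ### Gluing over finitely many open sets. -/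

section Gluing

variable {n : ℕ} {X : Type*} [NormedAddCommGroup X] [NormedSpace ℝ X]

local notation "𝔼" => EuclideanSpace ℝ (Fin n)

theorem eLpNorm_iUnion_le_sum {Y : Type*} [NormedAddCommGroup Y] {ι : Type*} [Fintype ι]
    {U : ι → Set 𝔼} (hU : ∀ i, IsOpen (U i)) {q : ℝ≥0∞} (hq : 1 ≤ q) {f : 𝔼 → Y}
    (hf : ∀ i, AEStronglyMeasurable f (volume.restrict (U i))) :
    eLpNorm f q (volume.restrict (⋃ i, U i)) ≤ ∑ i, eLpNorm f q (volume.restrict (U i)) := by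
  have hm : ∀ i, AEStronglyMeasurable ((U i).indicator fun x => ‖f x‖) volume := fun i =>
    (aestronglyMeasurable_indicator_iff (hU i).measurableSet).2 (hf i).norm
  calc eLpNorm f q (volume.restrict (⋃ i, U i))
      = eLpNorm ((⋃ i, U i).indicator f) q volume :=
        (eLpNorm_indicator_eq_eLpNorm_restrict (isOpen_iUnion hU).measurableSet).symm
    _ ≤ eLpNorm (∑ i, (U i).indicator fun x => ‖f x‖) q volume := by
        refine eLpNorm_mono_real fun x => ?_
        rw [Finset.sum_apply]
        by_cases hx : x ∈ ⋃ i, U i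
        · rw [indicator_of_mem hx]
          obtain ⟨i, hi⟩ := mem_iUnion.1 hx
          refine le_trans (le_of_eq ?_) (Finset.single_le_sum
            (f := fun i => (U i).indicator (fun x => ‖f x‖) x)
            (fun j _ => indicator_nonneg (fun _ _ => norm_nonneg _) _) (Finset.mem_univ i))
          simp [hi]
        · rw [indicator_of_notMem hx, norm_zero]
          exact Finset.sum_nonneg fun j _ => indicator_nonneg (fun _ _ => norm_nonneg _) _
    _ ≤ ∑ i, eLpNorm ((U i).indicator fun x => ‖f x‖) q volume :=
        eLpNorm_sum_le (fun i _ => hm i) hq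
    _ = ∑ i, eLpNorm f q (volume.restrict (U i)) := by
        refine Finset.sum_congr rfl fun i _ => ?_
        rw [eLpNorm_indicator_eq_eLpNorm_restrict (hU i).measurableSet, eLpNorm_norm]

/-- A partition of unity on the support of the test function splits it into test functions supported
in the single `U i`. -/
theorem hasWeakFDeriv_iUnion {ι : Type*} [Fintype ι] {U : ι → Set 𝔼} (hU : ∀ i, IsOpen (U i))
    {w : 𝔼 → X} {g : 𝔼 → 𝔼 →L[ℝ] X} (h : ∀ i, HasWeakFDeriv (U i) w g) :
    HasWeakFDeriv (⋃ i, U i) w g := by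
  have hloc : ∀ {Y : Type _} [NormedAddCommGroup Y] {f : 𝔼 → Y},
      (∀ i, LocallyIntegrableOn f (U i) volume) →
        LocallyIntegrableOn f (⋃ i, U i) volume := by
    intro Y _ f hf x hx
    obtain ⟨i, hi⟩ := mem_iUnion.1 hx
    have := hf i x hi
    rw [(hU i).nhdsWithin_eq hi] at this
    rwa [(isOpen_iUnion hU).nhdsWithin_eq hx]
  refine ⟨hloc fun i => (h i).1, hloc fun i => (h i).2.1, fun φ hφ hc hs v => ?_⟩
  obtain ⟨ρ, hρ⟩ := SmoothPartitionOfUnity.exists_isSubordinate 𝓘(ℝ, 𝔼)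
    (isClosed_tsupport φ) U hU hs
  have hρs : ∀ i, ContDiff ℝ ∞ (ρ i) := fun i => (ρ i).contMDiff.contDiff
  have hsum : ∀ x, ∑ i, ρ i x * φ x = φ x := by
    intro x
    rw [← Finset.sum_mul]
    by_cases hx : x ∈ tsupport φ
    · rw [← finsum_eq_sum_of_fintype, ρ.sum_eq_one hx, one_mul]
    · rw [image_eq_zero_of_notMem_tsupport hx, mul_zero]
  set φi : ι → 𝔼 → ℝ := fun i x => ρ i x * φ x with hφi
  have hφis : ∀ i, ContDiff ℝ ∞ (φi i) := fun i => (hρs i).mul hφ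
  have hφic : ∀ i, HasCompactSupport (φi i) := fun i => hc.mul_left
  have hφit : ∀ i, tsupport (φi i) ⊆ U i := fun i =>
    (tsupport_mul_subset_left).trans (hρ i)
  have hsum' : φ = fun x => ∑ i, φi i x := funext fun x => (hsum x).symm
  have hfd : ∀ x, fderiv ℝ φ x v = ∑ i, fderiv ℝ (φi i) x v := by
    intro x
    conv_lhs => rw [hsum']
    rw [fderiv_fun_sum fun i _ => ((hφis i).differentiable (by simp)).differentiableAt]
    simp
  have e1 : ∫ x, fderiv ℝ φ x v • w x = ∑ i, ∫ x, fderiv ℝ (φi i) x v • w x := by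
    simp_rw [hfd, Finset.sum_smul]
    exact integral_finsetSum _ fun i _ =>
      integrable_fderiv_smul (h i).1 (hφis i) (hφic i) (hφit i) v
  have e2 : ∫ x, φ x • g x v = ∑ i, ∫ x, φi i x • g x v := by
    conv_lhs => rw [hsum']
    simp_rw [Finset.sum_smul]
    exact integral_finsetSum _ fun i _ => integrable_smul_of_tsupport_subset
      (locallyIntegrableOn_apply (h i).2.1 v) (hφis i).continuous (hφic i) (hφit i)
  rw [e1, e2, ← Finset.sum_neg_distrib]
  exact Finset.sum_congr rfl fun i _ => (h i).2.2 _ (hφis i) (hφic i) (hφit i) v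

/-- Sobolev functions on finitely many open sets glue, with control of the norm. -/
theorem memSobolev_iUnion [FiniteDimensional ℝ X] {ι : Type*} [Fintype ι] {U : ι → Set 𝔼}
    (hU : ∀ i, IsOpen (U i)) {q : ℝ≥0∞} (hq : 1 ≤ q) {w : 𝔼 → X}
    (h : ∀ i, MemSobolev (U i) q w) :
    MemSobolev (⋃ i, U i) q w ∧
      sobolevENorm (⋃ i, U i) q w ≤ ∑ i, sobolevENorm (U i) q w := by
  classical
  choose hw gi hgi hgiq using h
  -- The index chosen at each point is irrelevant up to null sets: by uniqueness of weak derivatives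
  -- the `gi` agree almost everywhere on overlaps, and there are finitely many pairs.
  let g : 𝔼 → 𝔼 →L[ℝ] X := fun x => if hx : ∃ i, x ∈ U i then gi hx.choose x else 0
  have hpair : ∀ i j, ∀ᵐ x ∂(volume.restrict (U i)), x ∈ U j → gi j x = gi i x := by
    intro i j
    have hij := ((hgi j).mono inter_subset_right).ae_eq ((hU i).inter (hU j))
      ((hgi i).mono (inter_subset_left (s := U i) (t := U j)))
    rw [Filter.EventuallyEq, ae_restrict_iff' ((hU i).inter (hU j)).measurableSet] at hij
    rw [ae_restrict_iff' (hU i).measurableSet]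
    filter_upwards [hij] with x hx h1 h2 using hx ⟨h1, h2⟩
  have hg : ∀ i, gi i =ᵐ[volume.restrict (U i)] g := by
    intro i
    filter_upwards [ae_all_iff.2 (hpair i), ae_restrict_mem (hU i).measurableSet] with x hx hxi
    have hex : ∃ i, x ∈ U i := ⟨i, hxi⟩
    simp only [g, dif_pos hex]
    exact (hx _ hex.choose_spec).symm
  have hgd : ∀ i, HasWeakFDeriv (U i) w g := fun i =>
    (hgi i).congr_ae (hU i) (Filter.EventuallyEq.refl _ _) (hg i)
  have hgq : ∀ i, MemLp g q (volume.restrict (U i)) := fun i => (hgiq i).ae_eq (hg i)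
  have hd := hasWeakFDeriv_iUnion hU hgd
  have n1 := eLpNorm_iUnion_le_sum hU hq fun i => (hw i).1
  have n2 := eLpNorm_iUnion_le_sum hU hq fun i => (hgq i).1
  refine ⟨⟨⟨AEStronglyMeasurable.iUnion fun i => (hw i).1, n1.trans_lt ?_⟩, g, hd,
    ⟨AEStronglyMeasurable.iUnion fun i => (hgq i).1, n2.trans_lt ?_⟩⟩, ?_⟩
  · exact ENNReal.sum_lt_top.2 fun i _ => (hw i).2
  · exact ENNReal.sum_lt_top.2 fun i _ => (hgq i).2
  · rw [sobolevENorm_eq (isOpen_iUnion hU) hd]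
    simp_rw [fun i => sobolevENorm_eq (p := q) (hU i) (hgd i)]
    rw [Finset.sum_add_distrib]
    exact add_le_add n1 n2

end Gluing

/-! ### Lipschitz functions are of class W^{1,∞}. -/

section Lipschitz

variable {n : ℕ} {X : Type*} [NormedAddCommGroup X] [NormedSpace ℝ X] [FiniteDimensional ℝ X]

local notation "𝔼" => EuclideanSpace ℝ (Fin n)

theorem stronglyMeasurable_fderiv_of_finiteDimensional (f : 𝔼 → X) :
    StronglyMeasurable (fderiv ℝ f) := by
  have : CompleteSpace X := FiniteDimensional.complete ℝ X
  have : ProperSpace (𝔼 →L[ℝ] X) := FiniteDimensional.proper ℝ _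
  exact (measurable_fderiv ℝ f).stronglyMeasurable

/-- Rademacher's theorem: the classical derivative exists almost everywhere and is bounded. After
composition with a continuous functional, the identity is integration by parts for line derivatives
of real Lipschitz functions. -/
theorem LipschitzWith.hasWeakFDeriv {K : ℝ≥0} {f : 𝔼 → X} (hf : LipschitzWith K f)
    (U : Set 𝔼) : HasWeakFDeriv U f (fderiv ℝ f) := by
  have : CompleteSpace X := FiniteDimensional.complete ℝ X
  have hm : AEStronglyMeasurable (fderiv ℝ f) (volume : Measure 𝔼) :=
    (stronglyMeasurable_fderiv_of_finiteDimensional f).aestronglyMeasurable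
  have hb : ∀ x, ‖fderiv ℝ f x‖ ≤ K := fun x => norm_fderiv_le_of_lipschitz ℝ hf
  have l1 : LocallyIntegrableOn f U volume :=
    hf.continuous.locallyIntegrable.locallyIntegrableOn _
  have l2' : LocallyIntegrable (fderiv ℝ f) (volume : Measure 𝔼) :=
    (memLp_top_of_bound hm K (Filter.Eventually.of_forall hb)).locallyIntegrable le_top
  have l2 : LocallyIntegrableOn (fderiv ℝ f) U volume := l2'.locallyIntegrableOn _
  refine ⟨l1, l2, fun φ hφ hc hs v => ?_⟩
  have i1 := integrable_fderiv_smul l1 hφ hc hs v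
  have i2 := integrable_smul_of_tsupport_subset (locallyIntegrableOn_apply l2 v) hφ.continuous hc hs
  refine (SeparatingDual.eq_iff_forall_dual_eq (R := ℝ)).2 fun ℓ => ?_
  rw [map_neg, ← ℓ.integral_comp_comm i1, ← ℓ.integral_comp_comm i2]
  obtain ⟨D, hD⟩ := ContDiff.lipschitzWith_of_hasCompactSupport hc hφ (by simp)
  have hℓ : LipschitzWith (‖ℓ‖₊ * K) (ℓ ∘ f) := ℓ.lipschitz.comp hf
  have key := hℓ.integral_lineDeriv_mul_eq (μ := (volume : Measure 𝔼)) hD hc v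
  have e1 : ∀ᵐ x ∂(volume : Measure 𝔼),
      lineDeriv ℝ (ℓ ∘ f) x v * φ x = ℓ (φ x • fderiv ℝ f x v) := by
    filter_upwards [hf.ae_differentiableAt (μ := volume)] with x hx
    have hd : HasFDerivAt (ℓ ∘ f) (ℓ.comp (fderiv ℝ f x)) x :=
      ℓ.hasFDerivAt.comp x hx.hasFDerivAt
    rw [hd.differentiableAt.lineDeriv_eq_fderiv, hd.fderiv, map_smul, smul_eq_mul, mul_comm]
    rfl
  have e2 : ∀ x, lineDeriv ℝ φ x (-v) * (ℓ ∘ f) x = -(ℓ (fderiv ℝ φ x v • f x)) := by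
    intro x
    rw [((hφ.differentiable (by simp)).differentiableAt).lineDeriv_eq_fderiv, map_neg, map_smul,
      smul_eq_mul, neg_mul]
    rfl
  rw [integral_congr_ae e1] at key
  simp_rw [e2] at key
  rw [integral_neg] at key
  rw [key, neg_neg]

/-- A Lipschitz map on a bounded open set is of class `W^{1,∞}`. -/
theorem LipschitzOnWith.memSobolev_top {K : ℝ≥0} {f : 𝔼 → X} {U : Set 𝔼} (hU : IsOpen U)
    (hb : Bornology.IsBounded U) (hf : LipschitzOnWith K f U) : MemSobolev U ⊤ f := by
  -- Rademacher's theorem is applied to a globally Lipschitz extension, which exists because the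
  -- target has finite dimension.
  obtain ⟨f₁, hf₁, heq⟩ := hf.extend_finite_dimension
  refine MemSobolev.congr hU (u := f₁) ?_ heq.symm
  refine ⟨?_, fderiv ℝ f₁, LipschitzWith.hasWeakFDeriv hf₁ U, ?_⟩
  · obtain ⟨R, hR⟩ := (isBounded_iff_forall_norm_le.1 (hf₁.isBounded_image hb))
    refine memLp_top_of_bound hf₁.continuous.aestronglyMeasurable R ?_
    exact ae_restrict_of_forall_mem hU.measurableSet fun x hx => hR _ (mem_image_of_mem _ hx)
  · exact memLp_top_of_bound (stronglyMeasurable_fderiv_of_finiteDimensional f₁).aestronglyMeasurable _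
      (Filter.Eventually.of_forall fun x => norm_fderiv_le_of_lipschitz ℝ hf₁)

end Lipschitz

/-! ### The potential of a function along segments. -/

section Potential

variable {n : ℕ} {X : Type*} [NormedAddCommGroup X] [NormedSpace ℝ X]

local notation "𝔼" => EuclideanSpace ℝ (Fin n)

/-- The integral of `h` over the segments that join `x` to the points of `B`. -/
def segmentPotential (B : Set 𝔼) (h : 𝔼 → ℝ≥0∞) (x : 𝔼) : ℝ≥0∞ :=
  ∫⁻ t in Ioc (0 : ℝ) 1, ∫⁻ y in B, h (x + t • (y - x))

theorem measurable_segmentPotential (B : Set 𝔼) {h : 𝔼 → ℝ≥0∞} (hh : Measurable h) :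
    Measurable (segmentPotential B h) := by
  have h1 : Measurable fun q : (𝔼 × ℝ) × 𝔼 => h (q.1.1 + q.1.2 • (q.2 - q.1.1)) :=
    hh.comp (by fun_prop)
  exact (h1.lintegral_prod_right' (ν := volume.restrict B)).lintegral_prod_right'
    (ν := volume.restrict (Ioc (0 : ℝ) 1))

theorem enorm_le_add_lintegral_fderiv [CompleteSpace X] {φ : 𝔼 → X} (hφ : ContDiff ℝ ∞ φ)
    (x y : 𝔼) :
    ‖φ x‖ₑ ≤ ‖φ y‖ₑ + ‖y - x‖ₑ * ∫⁻ t in Ioc (0 : ℝ) 1, ‖fderiv ℝ φ (x + t • (y - x))‖ₑ := by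
  have hd : ∀ t : ℝ, HasDerivAt (fun t : ℝ => φ (x + t • (y - x)))
      (fderiv ℝ φ (x + t • (y - x)) (y - x)) t := by
    intro t
    have h1 : HasDerivAt (fun t : ℝ => x + t • (y - x)) (y - x) t := by
      simpa using ((hasDerivAt_id t).smul_const (y - x)).const_add x
    exact ((hφ.differentiable (by simp)).differentiableAt.hasFDerivAt).comp_hasDerivAt t h1
  have hcont : Continuous fun t : ℝ => fderiv ℝ φ (x + t • (y - x)) (y - x) :=
    ((hφ.continuous_fderiv (by simp)).comp (by fun_prop)).clm_apply continuous_const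
  have key := intervalIntegral.integral_eq_sub_of_hasDerivAt (a := 0) (b := 1)
    (fun t _ => hd t) (hcont.intervalIntegrable 0 1)
  rw [intervalIntegral.integral_of_le zero_le_one] at key
  simp only [one_smul, zero_smul, add_zero, add_sub_cancel] at key
  have e : φ x = φ y - ∫ t in Ioc (0 : ℝ) 1, fderiv ℝ φ (x + t • (y - x)) (y - x) := by
    rw [key]; abel
  calc ‖φ x‖ₑ ≤ ‖φ y‖ₑ + ‖∫ t in Ioc (0 : ℝ) 1, fderiv ℝ φ (x + t • (y - x)) (y - x)‖ₑ := by
        rw [e]; exact enorm_sub_le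
    _ ≤ ‖φ y‖ₑ + ∫⁻ t in Ioc (0 : ℝ) 1, ‖y - x‖ₑ * ‖fderiv ℝ φ (x + t • (y - x))‖ₑ := by
        gcongr
        refine (enorm_integral_le_lintegral_enorm _).trans (lintegral_mono fun t => ?_)
        rw [mul_comm]
        exact le_opENorm _ _
    _ = _ := by rw [lintegral_const_mul' _ _ enorm_ne_top]

theorem lintegral_comp_add_smul_le {k : 𝔼 → ℝ≥0∞} (hk : Measurable k) {A C : Set 𝔼}
    (hA : MeasurableSet A) (hC : MeasurableSet C) (a : 𝔼) {s : ℝ} (hs : 0 < s)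
    (hAC : ∀ y ∈ A, a + s • y ∈ C) :
    ∫⁻ y in A, k (a + s • y) ≤ (ENNReal.ofReal s)⁻¹ ^ n * ∫⁻ y in C, k y := by
  have hk' : Measurable (C.indicator k) := hk.indicator hC
  calc ∫⁻ y in A, k (a + s • y) = ∫⁻ y in A, C.indicator k (a + s • y) := by
        refine setLIntegral_congr_fun hA fun y hy => ?_
        simp only [indicator_of_mem (hAC y hy)]
    _ ≤ ∫⁻ y, C.indicator k (a + s • y) := setLIntegral_le_lintegral _ _
    _ = ∫⁻ y, C.indicator k (a + y) ∂(Measure.map (s • ·) (volume : Measure 𝔼)) :=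
        (lintegral_map (hk'.comp (measurable_const_add a)) (measurable_const_smul s)).symm
    _ = (ENNReal.ofReal s)⁻¹ ^ n * ∫⁻ y, C.indicator k (a + y) := by
        rw [Measure.map_addHaar_smul _ hs.ne', lintegral_smul_measure, smul_eq_mul,
          finrank_euclideanSpace_fin, abs_of_pos (by positivity),
          ENNReal.ofReal_inv_of_pos (by positivity), ENNReal.ofReal_pow hs.le, ENNReal.inv_pow]
    _ = (ENNReal.ofReal s)⁻¹ ^ n * ∫⁻ y in C, k y := by
        rw [lintegral_add_left_eq_self, lintegral_indicator hC]

theorem lintegral_comp_segment_le {k : 𝔼 → ℝ≥0∞} (hk : Measurable k) {B C : Set 𝔼}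
    (hB : MeasurableSet B) (hC : MeasurableSet C) (hconv : Convex ℝ C) (hBC : B ⊆ C)
    {x : 𝔼} (hx : x ∈ C) {t : ℝ} (ht : t ∈ Ioc (0 : ℝ) 1) :
    ∫⁻ y in B, k (x + t • (y - x)) ≤ (ENNReal.ofReal t)⁻¹ ^ n * ∫⁻ y in C, k y := by
  have e : ∀ y, x + t • (y - x) = (1 - t) • x + t • y := fun y => by module
  simp_rw [e]
  exact lintegral_comp_add_smul_le hk hB hC _ ht.1 fun y hy =>
    hconv hx (hBC hy) (by linarith [ht.2]) ht.1.le (by ring)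

/-- For fixed `y` the substitution in `x` scales by `1 - t`, and for fixed `x` the one in `y` scales
by `t`. Integrating first in the variable whose scale is at least 1/2 bounds the Jacobian by `2 ^
n`, whence a bound uniform in `t`. -/
theorem lintegral_lintegral_comp_segment_le {k : 𝔼 → ℝ≥0∞} (hk : Measurable k) {B C : Set 𝔼}
    (hB : MeasurableSet B) (hC : MeasurableSet C) (hconv : Convex ℝ C) (hBC : B ⊆ C)
    {t : ℝ} (ht : t ∈ Ioc (0 : ℝ) 1) :
    ∫⁻ x in C, ∫⁻ y in B, k (x + t • (y - x)) ≤ 2 ^ n * volume C * ∫⁻ y in C, k y := by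
  have hpow : ∀ s : ℝ, 1 / 2 ≤ s → (ENNReal.ofReal s)⁻¹ ^ n ≤ 2 ^ n := by
    intro s hs
    refine pow_le_pow_left' ?_ n
    rw [ENNReal.inv_le_iff_inv_le]
    refine le_trans (le_of_eq ?_) (ENNReal.ofReal_le_ofReal hs)
    rw [one_div, ENNReal.ofReal_inv_of_pos two_pos]
    simp
  rcases le_total t (1 / 2) with h | h
  · have hm : Measurable fun q : 𝔼 × 𝔼 => k (q.1 + t • (q.2 - q.1)) := hk.comp (by fun_prop)
    rw [lintegral_lintegral_swap hm.aemeasurable]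
    have e : ∀ x y : 𝔼, x + t • (y - x) = t • y + (1 - t) • x := fun x y => by module
    calc ∫⁻ y in B, ∫⁻ x in C, k (x + t • (y - x))
        ≤ ∫⁻ y in B, 2 ^ n * ∫⁻ z in C, k z := by
          refine setLIntegral_mono' hB fun y hy => ?_
          simp_rw [e]
          refine (lintegral_comp_add_smul_le hk hC hC (t • y) (s := 1 - t) (by linarith)
            fun x hx => ?_).trans
              (mul_le_mul_left (hpow _ (by linarith)) _)
          exact hconv (hBC hy) hx ht.1.le (by linarith) (by ring)
      _ = 2 ^ n * (∫⁻ z in C, k z) * volume B := by rw [setLIntegral_const]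
      _ ≤ 2 ^ n * volume C * ∫⁻ z in C, k z := by
          rw [mul_assoc, mul_assoc, mul_comm _ (volume B)]
          gcongr
  · calc ∫⁻ x in C, ∫⁻ y in B, k (x + t • (y - x))
        ≤ ∫⁻ x in C, 2 ^ n * ∫⁻ z in C, k z := by
          refine setLIntegral_mono' hC fun x hx => ?_
          exact (lintegral_comp_segment_le hk hB hC hconv hBC hx ht).trans
            (mul_le_mul_left (hpow _ h) _)
      _ = 2 ^ n * volume C * ∫⁻ z in C, k z := by rw [setLIntegral_const]; ring

theorem lintegral_segmentPotential_le {k : 𝔼 → ℝ≥0∞} (hk : Measurable k) {B C : Set 𝔼}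
    (hB : MeasurableSet B) (hC : MeasurableSet C) (hconv : Convex ℝ C) (hBC : B ⊆ C) :
    ∫⁻ x in C, segmentPotential B k x ≤ 2 ^ n * volume C * ∫⁻ y in C, k y := by
  have h1 : Measurable fun q : (𝔼 × ℝ) × 𝔼 => k (q.1.1 + q.1.2 • (q.2 - q.1.1)) :=
    hk.comp (by fun_prop)
  have h2 := h1.lintegral_prod_right' (ν := volume.restrict B)
  unfold segmentPotential
  rw [lintegral_lintegral_swap h2.aemeasurable]
  calc ∫⁻ t in Ioc (0 : ℝ) 1, ∫⁻ x in C, ∫⁻ y in B, k (x + t • (y - x))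
      ≤ ∫⁻ t in Ioc (0 : ℝ) 1, 2 ^ n * volume C * ∫⁻ y in C, k y :=
        setLIntegral_mono' measurableSet_Ioc fun t ht =>
          lintegral_lintegral_comp_segment_le hk hB hC hconv hBC ht
    _ = _ := by rw [setLIntegral_const]; simp

/-- The fundamental theorem of calculus on the segment from `x` to `y`, integrated over `y ∈ B`.
Multiplying by the volume of `B` instead of averaging avoids a division. -/
theorem volume_mul_enorm_le_of_contDiff [CompleteSpace X] {φ : 𝔼 → X} (hφ : ContDiff ℝ ∞ φ)
    {B : Set 𝔼} (hB : MeasurableSet B) {x : 𝔼} {d : ℝ≥0∞} (hd : ∀ y ∈ B, ‖y - x‖ₑ ≤ d) :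
    volume B * ‖φ x‖ₑ ≤
      (∫⁻ y in B, ‖φ y‖ₑ) + d * segmentPotential B (fun z => ‖fderiv ℝ φ z‖ₑ) x := by
  have hφ' : Continuous fun z => ‖fderiv ℝ φ z‖ₑ := (hφ.continuous_fderiv (by simp)).enorm
  have hm : Measurable fun q : ℝ × 𝔼 => ‖fderiv ℝ φ (x + q.1 • (q.2 - x))‖ₑ :=
    (hφ'.comp (by fun_prop)).measurable
  calc volume B * ‖φ x‖ₑ = ∫⁻ _ in B, ‖φ x‖ₑ := by rw [setLIntegral_const, mul_comm]
    _ ≤ ∫⁻ y in B, (‖φ y‖ₑ + d * ∫⁻ t in Ioc (0 : ℝ) 1, ‖fderiv ℝ φ (x + t • (y - x))‖ₑ) := by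
        refine setLIntegral_mono' hB fun y hy => ?_
        exact (enorm_le_add_lintegral_fderiv hφ x y).trans (by gcongr; exact hd y hy)
    _ = (∫⁻ y in B, ‖φ y‖ₑ) +
        d * ∫⁻ y in B, ∫⁻ t in Ioc (0 : ℝ) 1, ‖fderiv ℝ φ (x + t • (y - x))‖ₑ := by
        rw [lintegral_add_left hφ.continuous.enorm.measurable, lintegral_const_mul]
        exact hm.lintegral_prod_left' (μ := volume.restrict (Ioc (0 : ℝ) 1))
    _ = _ := by rw [segmentPotential,
        ← lintegral_lintegral_swap (f := fun t y => ‖fderiv ℝ φ (x + t • (y - x))‖ₑ)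
          hm.aemeasurable]

end Potential

/-! ### The pointwise bound for Sobolev functions on convex domains. -/

section PointwiseBound

variable {n : ℕ} {X : Type*} [NormedAddCommGroup X] [NormedSpace ℝ X]

local notation "𝔼" => EuclideanSpace ℝ (Fin n)

theorem enorm_le_enorm_sub_add_enorm {Y : Type*} [NormedAddCommGroup Y] (a b : Y) :
    ‖a‖ₑ ≤ ‖a - b‖ₑ + ‖b‖ₑ := by
  simpa using enorm_add_le (a - b) b

/-- The points whose `δ`-ball is contained in `C`. -/
def erosion (C : Set 𝔼) (δ : ℝ) : Set 𝔼 := {x | ball x δ ⊆ C}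

theorem isClosed_erosion (C : Set 𝔼) (δ : ℝ) : IsClosed (erosion C δ) := by
  have : erosion C δ = (thickening δ Cᶜ)ᶜ := by
    ext x
    simp only [erosion, mem_ofPred_eq, mem_compl_iff, mem_thickening_iff, not_exists, not_and,
      not_lt]
    refine ⟨fun h z hz => ?_, fun h z hz => ?_⟩
    · by_contra! hlt
      exact hz (h (by rwa [mem_ball, dist_comm]))
    · by_contra hzC
      exact absurd (h z hzC) (by rw [mem_ball, dist_comm] at hz; exact not_le.2 hz)
  rw [this]
  exact isOpen_thickening.isClosed_compl

theorem erosion_subset {C : Set 𝔼} {δ : ℝ} (hδ : 0 < δ) : erosion C δ ⊆ C :=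
  fun _ hx => hx (mem_ball_self hδ)

theorem isCompact_erosion {C : Set 𝔼} (hb : Bornology.IsBounded C) {δ : ℝ} (hδ : 0 < δ) :
    IsCompact (erosion C δ) :=
  isCompact_of_isClosed_isBounded (isClosed_erosion C δ) (hb.subset (erosion_subset hδ))

/-- The erosion is the intersection of the translates of `C` by vectors shorter than `δ`. It
supplies compact convex subsets exhausting `C`: compactness permits smooth approximation, convexity
the estimates along segments. -/
theorem convex_erosion {C : Set 𝔼} (hC : Convex ℝ C) (δ : ℝ) : Convex ℝ (erosion C δ) := by
  intro x hx y hy a b ha hb hab z hz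
  have hz' : ‖z - (a • x + b • y)‖ < δ := by rwa [mem_ball, dist_eq_norm] at hz
  set e := z - (a • x + b • y) with he
  have h1 : x + e ∈ C := hx (by simpa [mem_ball, dist_eq_norm] using hz')
  have h2 : y + e ∈ C := hy (by simpa [mem_ball, dist_eq_norm] using hz')
  have h3 := hC h1 h2 ha hb hab
  have h4 : a • (x + e) + b • (y + e) = z := by
    have : a • (x + e) + b • (y + e) = (a • x + b • y) + (a + b) • e := by module
    rw [this, hab, one_smul, he]; abel
  rwa [h4] at h3

theorem ball_subset_erosion {C : Set 𝔼} {x : 𝔼} {ρ δ : ℝ} (h : ball x (ρ + δ) ⊆ C) :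
    ball x ρ ⊆ erosion C δ := fun y hy z hz => h (by
  rw [mem_ball] at *
  calc dist z x ≤ dist z y + dist y x := dist_triangle _ _ _
    _ < ρ + δ := by linarith)

/-- A Sobolev function on a bounded convex domain is controlled pointwise by its mean over a ball
and by the potential of its derivative. -/
theorem HasWeakFDeriv.ae_volume_mul_enorm_le [CompleteSpace X] {C : Set 𝔼} (hC : IsOpen C)
    (hconv : Convex ℝ C) (hb : Bornology.IsBounded C) {c₀ : 𝔼} {ρ : ℝ} (hρ : 0 < ρ)
    (hball : ball c₀ (2 * ρ) ⊆ C) {d : ℝ≥0∞} (hdt : d ≠ ⊤)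
    (hd : ∀ x ∈ C, ∀ y ∈ C, ‖y - x‖ₑ ≤ d) {w : 𝔼 → X} {g : 𝔼 → 𝔼 →L[ℝ] X}
    (h : HasWeakFDeriv C w g) {k : 𝔼 → ℝ≥0∞} (hk : Measurable k)
    (hgk : ∀ᵐ x ∂(volume.restrict C), ‖g x‖ₑ ≤ k x) :
    ∀ᵐ x ∂(volume.restrict C), volume (ball c₀ ρ) * ‖w x‖ₑ ≤
      (∫⁻ y in ball c₀ ρ, ‖w y‖ₑ) + d * segmentPotential (ball c₀ ρ) k x := by
  set B := ball c₀ ρ with hBdef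
  have hBm : MeasurableSet B := measurableSet_ball
  set R : 𝔼 → ℝ≥0∞ := fun x => (∫⁻ y in B, ‖w y‖ₑ) + d * segmentPotential B k x with hR
  have hRm : Measurable R := ((measurable_segmentPotential B hk).const_mul d).const_add _
  -- The restriction `δ ≤ ρ`, with the doubled radius in `hball`, keeps the ball `B` inside the
  -- erosion.
  have key : ∀ δ : ℝ, 0 < δ → δ ≤ ρ →
      ∀ᵐ x ∂(volume.restrict (erosion C δ)), volume B * ‖w x‖ₑ ≤ R x := by
    intro δ hδ hδρ
    set S := erosion C δ with hS
    have hSc : IsCompact S := isCompact_erosion hb hδ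
    have hSC : S ⊆ C := erosion_subset hδ
    have hBS : B ⊆ S :=
      ball_subset_erosion ((ball_subset_ball (by linarith)).trans hball)
    have hSv : volume S ≠ ⊤ := hSc.measure_ne_top
    have hBv : volume B ≠ ⊤ := measure_ball_lt_top.ne
    have hwm : AEStronglyMeasurable w (volume.restrict S) :=
      (h.1.integrableOn_compact_subset hSC hSc).1
    set c : ℝ≥0∞ := volume B + volume S + d * (2 ^ n * volume S) with hc
    have hct : c ≠ ⊤ := by finiteness
    -- Subtraction here is truncated, so this integrates the excess of the left side over the right.
    -- Smooth approximation makes the excess arbitrarily small, without a choice of subsequence: the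
    -- potential maps L¹ to L¹, hence also tolerates the L¹-small positive part `e` of `‖fderiv ℝ φ‖
    -- - k`.
    have hest : ∀ ε : ℝ≥0∞, ε ≠ 0 → ∫⁻ x in S, (volume B * ‖w x‖ₑ - R x) ≤ c * ε := by
      intro ε hε
      obtain ⟨φ, hφ, h1, h2⟩ := h.exists_contDiff_lintegral_sub_le hC hSc hSC hε
      have hφ' : Continuous (fderiv ℝ φ) := hφ.continuous_fderiv (by simp)
      set e : 𝔼 → ℝ≥0∞ := fun z => ‖fderiv ℝ φ z‖ₑ - k z with he
      have hem : Measurable e := hφ'.enorm.measurable.sub hk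
      have hei : ∫⁻ z in S, e z ≤ ε := by
        refine le_trans (lintegral_mono_ae ?_) h2
        filter_upwards [ae_restrict_of_ae_restrict_of_subset hSC hgk] with z hz
        rw [he, tsub_le_iff_right]
        exact (enorm_le_enorm_sub_add_enorm _ (g z)).trans (by gcongr)
      have hφw : ∫⁻ y in B, ‖φ y‖ₑ ≤ (∫⁻ y in B, ‖w y‖ₑ) + ε := by
        calc ∫⁻ y in B, ‖φ y‖ₑ ≤ ∫⁻ y in B, (‖w y‖ₑ + ‖φ y - w y‖ₑ) := by
              refine lintegral_mono fun y => ?_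
              calc ‖φ y‖ₑ = ‖w y + (φ y - w y)‖ₑ := by rw [add_sub_cancel]
                _ ≤ _ := enorm_add_le _ _
          _ = (∫⁻ y in B, ‖w y‖ₑ) + ∫⁻ y in B, ‖φ y - w y‖ₑ :=
              lintegral_add_left' (hwm.mono_set hBS).enorm _
          _ ≤ _ := by gcongr; exact (lintegral_mono_set hBS).trans h1
      have hpot : ∀ x, segmentPotential B (fun z => ‖fderiv ℝ φ z‖ₑ) x ≤
          segmentPotential B k x + segmentPotential B e x := by
        intro x
        have m1 : Measurable fun q : ℝ × 𝔼 => k (x + q.1 • (q.2 - x)) :=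
          hk.comp (by fun_prop)
        calc segmentPotential B (fun z => ‖fderiv ℝ φ z‖ₑ) x
            ≤ ∫⁻ t in Ioc (0 : ℝ) 1, ∫⁻ y in B,
                (k (x + t • (y - x)) + e (x + t • (y - x))) :=
              lintegral_mono fun t => lintegral_mono fun y => le_add_tsub
          _ = _ := by
              rw [segmentPotential, segmentPotential,
                ← lintegral_add_left (m1.lintegral_prod_right' (ν := volume.restrict B))]
              refine lintegral_congr fun t => ?_
              exact lintegral_add_left (m1.comp measurable_prodMk_left) _
      calc ∫⁻ x in S, (volume B * ‖w x‖ₑ - R x)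
          ≤ ∫⁻ x in S, ((volume B * ‖φ x - w x‖ₑ + ε) + d * segmentPotential B e x) := by
            refine setLIntegral_mono' hSc.measurableSet fun x hx => ?_
            rw [tsub_le_iff_left]
            have b1 := volume_mul_enorm_le_of_contDiff hφ hBm (x := x) (d := d)
              (fun y hy => hd x (hSC hx) y (hSC (hBS hy)))
            calc volume B * ‖w x‖ₑ ≤ volume B * (‖φ x‖ₑ + ‖φ x - w x‖ₑ) := by
                  gcongr
                  calc ‖w x‖ₑ = ‖φ x - (φ x - w x)‖ₑ := by rw [sub_sub_cancel]
                    _ ≤ _ := enorm_sub_le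
              _ = volume B * ‖φ x‖ₑ + volume B * ‖φ x - w x‖ₑ := mul_add _ _ _
              _ ≤ (((∫⁻ y in B, ‖w y‖ₑ) + ε) +
                    d * (segmentPotential B k x + segmentPotential B e x)) +
                    volume B * ‖φ x - w x‖ₑ := by
                  gcongr
                  exact b1.trans (add_le_add hφw (mul_le_mul_right (hpot x) _))
              _ = _ := by rw [hR]; ring
        _ = (volume B * ∫⁻ x in S, ‖φ x - w x‖ₑ) + ε * volume S +
              d * ∫⁻ x in S, segmentPotential B e x := by
            rw [lintegral_add_right _ ((measurable_segmentPotential B hem).const_mul d),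
              lintegral_add_right _ measurable_const, setLIntegral_const,
              lintegral_const_mul' _ _ hBv, lintegral_const_mul' _ _ hdt]
        _ ≤ volume B * ε + ε * volume S + d * (2 ^ n * volume S * ε) := by
            gcongr
            exact (lintegral_segmentPotential_le hem hBm hSc.measurableSet
              (convex_erosion hconv δ) hBS).trans (by gcongr)
        _ = c * ε := by rw [hc]; ring
    have hzero : ∫⁻ x in S, (volume B * ‖w x‖ₑ - R x) = 0 := by
      refine le_antisymm (ENNReal.le_of_forall_pos_le_add fun ε hε _ => ?_) bot_le
      rw [zero_add]
      have hc1 : c + 1 ≠ 0 := by simp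
      refine (hest (ε / (c + 1))
        (ENNReal.div_pos (by exact_mod_cast hε.ne') (by finiteness)).ne').trans ?_
      calc c * (ε / (c + 1)) ≤ (c + 1) * (ε / (c + 1)) := by gcongr; exact le_self_add
        _ = ε := ENNReal.mul_div_cancel hc1 (by finiteness)
    have hm : AEMeasurable (fun x => volume B * ‖w x‖ₑ - R x) (volume.restrict S) :=
      (hwm.enorm.const_mul _).sub hRm.aemeasurable
    filter_upwards [(lintegral_eq_zero_iff' hm).1 hzero] with x hx
    exact tsub_eq_zero_iff_le.1 hx
  have hunion : C = ⋃ m : ℕ, erosion C (ρ / (m + 1)) := by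
    refine Subset.antisymm (fun x hx => ?_)
      (iUnion_subset fun m => erosion_subset (by positivity))
    obtain ⟨η, hη, hηC⟩ := Metric.isOpen_iff.1 hC x hx
    obtain ⟨m, hm⟩ := exists_nat_gt (ρ / η)
    refine mem_iUnion.2 ⟨m, (ball_subset_ball ?_).trans hηC⟩
    rw [div_le_iff₀ (by positivity)]
    rw [div_lt_iff₀ hη] at hm
    nlinarith
  rw [hunion, ae_restrict_iUnion_iff]
  intro m
  exact key _ (by positivity) (div_le_self hρ.le (by linarith [Nat.cast_nonneg (α := ℝ) m]))

end PointwiseBound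

/-! ### Weighted estimates of the potential. -/

section Estimates

variable {n : ℕ} {X : Type*} [NormedAddCommGroup X] [NormedSpace ℝ X]

local notation "𝔼" => EuclideanSpace ℝ (Fin n)

/-- The integral of the weight `t ^ (-θ)` over the unit interval. -/
def weightIntegral (θ : ℝ) : ℝ≥0∞ := ∫⁻ t in Ioc (0 : ℝ) 1, ENNReal.ofReal t ^ (-θ)

/-- Applied with `θ = n / p`, this is where the condition n < p enters for finite `p`. -/
theorem weightIntegral_ne_top {θ : ℝ} (hθ : θ < 1) : weightIntegral θ ≠ ⊤ := by
  have h := (intervalIntegral.intervalIntegrable_rpow' (a := 0) (b := 1) (r := -θ)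
    (by linarith)).1
  have h2 : ∫⁻ t in Ioc (0 : ℝ) 1, ENNReal.ofReal (t ^ (-θ)) < ⊤ := h.lintegral_lt_top
  have e : weightIntegral θ = ∫⁻ t in Ioc (0 : ℝ) 1, ENNReal.ofReal (t ^ (-θ)) :=
    setLIntegral_congr_fun measurableSet_Ioc fun t ht => ENNReal.ofReal_rpow_of_pos ht.1
  rw [e]
  exact h2.ne

theorem measurable_ofReal_rpow (a : ℝ) : Measurable fun t : ℝ => ENNReal.ofReal t ^ a :=
  ENNReal.measurable_ofReal.pow_const a

/-- Hölder's inequality on the product of the unit interval and `B`, with exponents `1 - 1/r` and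
`1/r`. A power of `t` is inserted and removed, so that a weight with positive exponent `θ * (r - 1)`
is available to absorb the singularity at `t = 0`. -/
theorem segmentPotential_rpow_le {B : Set 𝔼} (hB : MeasurableSet B) {h : 𝔼 → ℝ≥0∞}
    (hh : Measurable h) (x : 𝔼) (θ : ℝ) {r : ℝ} (hr : 1 ≤ r) :
    segmentPotential B h x ^ r ≤ (weightIntegral θ * volume B) ^ (r - 1) *
      ∫⁻ t in Ioc (0 : ℝ) 1,
        ENNReal.ofReal t ^ (θ * (r - 1)) * ∫⁻ y in B, h (x + t • (y - x)) ^ r := by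
  have hr0 : 0 < r := by linarith
  set μ := ((volume : Measure ℝ).restrict (Ioc 0 1)).prod ((volume : Measure 𝔼).restrict B) with hμ
  have hm : Measurable fun q : ℝ × 𝔼 => h (x + q.1 • (q.2 - x)) := hh.comp (by fun_prop)
  have m1 : Measurable fun q : ℝ × 𝔼 => ENNReal.ofReal q.1 ^ (-θ) :=
    (measurable_ofReal_rpow _).comp measurable_fst
  have m2 : Measurable fun q : ℝ × 𝔼 =>
      ENNReal.ofReal q.1 ^ (θ * (r - 1)) * h (x + q.1 • (q.2 - x)) ^ r :=
    ((measurable_ofReal_rpow _).comp measurable_fst).mul (hm.pow_const r)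
  have e1 : segmentPotential B h x = ∫⁻ q, h (x + q.1 • (q.2 - x)) ∂μ :=
    (lintegral_prod _ hm.aemeasurable).symm
  have e2 : ∫⁻ q, ENNReal.ofReal q.1 ^ (-θ) ∂μ = weightIntegral θ * volume B := by
    rw [lintegral_prod _ m1.aemeasurable]
    simp only [lintegral_const, Measure.restrict_apply MeasurableSet.univ, univ_inter]
    rw [lintegral_mul_const _ (measurable_ofReal_rpow _)]
    rfl
  have e3 : ∫⁻ q, ENNReal.ofReal q.1 ^ (θ * (r - 1)) * h (x + q.1 • (q.2 - x)) ^ r ∂μ =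
      ∫⁻ t in Ioc (0 : ℝ) 1,
        ENNReal.ofReal t ^ (θ * (r - 1)) * ∫⁻ y in B, h (x + t • (y - x)) ^ r := by
    rw [lintegral_prod _ m2.aemeasurable]
    refine lintegral_congr fun t => ?_
    have hmt : Measurable fun y => h (x + t • (y - x)) ^ r := (hh.comp (by fun_prop)).pow_const r
    dsimp only
    rw [lintegral_const_mul _ hmt]
  have hpt : ∀ q : ℝ × 𝔼, q ∈ Ioc (0 : ℝ) 1 ×ˢ B → h (x + q.1 • (q.2 - x)) =
      (ENNReal.ofReal q.1 ^ (-θ)) ^ (1 - 1 / r) *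
        (ENNReal.ofReal q.1 ^ (θ * (r - 1)) * h (x + q.1 • (q.2 - x)) ^ r) ^ (1 / r) := by
    intro q hq
    have h0 : ENNReal.ofReal q.1 ≠ 0 := (ENNReal.ofReal_pos.2 hq.1.1).ne'
    rw [ENNReal.mul_rpow_of_nonneg _ _ (by positivity), ← ENNReal.rpow_mul, ← ENNReal.rpow_mul,
      ← ENNReal.rpow_mul, ← mul_assoc, ← ENNReal.rpow_add _ _ h0 ENNReal.ofReal_ne_top,
      mul_one_div_cancel hr0.ne', ENNReal.rpow_one]
    have : -θ * (1 - 1 / r) + θ * (r - 1) * (1 / r) = 0 := by field_simp; ring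
    rw [this, ENNReal.rpow_zero, one_mul]
  have holder := ENNReal.lintegral_mul_norm_pow_le (μ := μ) m1.aemeasurable m2.aemeasurable
    (p := 1 - 1 / r) (q := 1 / r)
    (by rw [sub_nonneg, div_le_one hr0]; exact hr) (by positivity) (by ring)
  rw [e2, e3] at holder
  have e4 : segmentPotential B h x = ∫⁻ q, (ENNReal.ofReal q.1 ^ (-θ)) ^ (1 - 1 / r) *
      (ENNReal.ofReal q.1 ^ (θ * (r - 1)) * h (x + q.1 • (q.2 - x)) ^ r) ^ (1 / r) ∂μ := by
    rw [e1, hμ, Measure.prod_restrict]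
    exact setLIntegral_congr_fun (measurableSet_Ioc.prod hB) hpt
  rw [← e4] at holder
  calc segmentPotential B h x ^ r ≤ _ := ENNReal.rpow_le_rpow holder hr0.le
    _ = _ := by
      rw [ENNReal.mul_rpow_of_nonneg _ _ hr0.le, ← ENNReal.rpow_mul, ← ENNReal.rpow_mul,
        one_div_mul_cancel hr0.ne', ENNReal.rpow_one]
      congr 2
      field_simp

/-- The reason for the choice `θ = n / p`: the Hölder weight and the scaling factor `t ^ (-n r / p)`
combine to `t ^ (-n / p)`, whatever `r` is. -/
theorem ofReal_rpow_mul_inv_pow_rpow {p r t : ℝ} (ht : 0 < t) :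
    ENNReal.ofReal t ^ (n / p * (r - 1)) * ((ENNReal.ofReal t)⁻¹ ^ n) ^ (r / p) =
      ENNReal.ofReal t ^ (-(n / p)) := by
  have h0 : ENNReal.ofReal t ≠ 0 := (ENNReal.ofReal_pos.2 ht).ne'
  rw [← ENNReal.rpow_natCast, ← ENNReal.rpow_neg_one, ← ENNReal.rpow_mul, ← ENNReal.rpow_mul,
    ← ENNReal.rpow_add _ _ h0 ENNReal.ofReal_ne_top]
  congr 1
  ring

/-- Morrey's estimate: the case `r = p`, with the bound `t ^ (-n)` of the inner integral taken at
every point of `C`. -/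
theorem segmentPotential_rpow_le_of_lt {B C : Set 𝔼} (hB : MeasurableSet B)
    (hC : MeasurableSet C) (hconv : Convex ℝ C) (hBC : B ⊆ C) {h : 𝔼 → ℝ≥0∞}
    (hh : Measurable h) {x : 𝔼} (hx : x ∈ C) {p : ℝ} (hp : 1 ≤ p) :
    segmentPotential B h x ^ p ≤ (weightIntegral (n / p) * volume B) ^ (p - 1) *
      (weightIntegral (n / p) * ∫⁻ y in C, h y ^ p) := by
  have hp0 : 0 < p := by linarith
  refine (segmentPotential_rpow_le hB hh x (n / p) hp).trans ?_
  gcongr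
  calc ∫⁻ t in Ioc (0 : ℝ) 1,
        ENNReal.ofReal t ^ (n / p * (p - 1)) * ∫⁻ y in B, h (x + t • (y - x)) ^ p
      ≤ ∫⁻ t in Ioc (0 : ℝ) 1, ENNReal.ofReal t ^ (-(n / p)) * ∫⁻ y in C, h y ^ p := by
        refine setLIntegral_mono' measurableSet_Ioc fun t ht => ?_
        have h1 := lintegral_comp_segment_le (hh.pow_const p) hB hC hconv hBC hx ht
        rw [← ofReal_rpow_mul_inv_pow_rpow (p := p) (r := p) ht.1, div_self hp0.ne',
          ENNReal.rpow_one, mul_assoc]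
        gcongr
    _ = _ := by rw [lintegral_mul_const _ (measurable_ofReal_rpow _)]; rfl

/-- Interpolation. With `G` the inner integral, the factor `G ^ (r/p)` is estimated by its supremum,
at the price of `t ^ (-n r / p)`, and the remaining `G ^ (1 - r/p)` is paired with `f ^ r` by
Hölder's inequality, using the L¹-bound of `G` that is uniform in `t`. -/
theorem lintegral_rpow_mul_comp_segment_le {B C : Set 𝔼} (hB : MeasurableSet B)
    (hC : MeasurableSet C) (hconv : Convex ℝ C) (hBC : B ⊆ C) {k f : 𝔼 → ℝ≥0∞}
    (hk : Measurable k) (hf : Measurable f) {p r : ℝ} (hr : 0 ≤ r) (hrp : r ≤ p) (hp : 0 < p)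
    {t : ℝ} (ht : t ∈ Ioc (0 : ℝ) 1) :
    ∫⁻ x in C, f x ^ r * ∫⁻ y in B, k (x + t • (y - x)) ≤
      ((ENNReal.ofReal t)⁻¹ ^ n) ^ (r / p) * ((2 ^ n * volume C) ^ (1 - r / p) *
        (∫⁻ x in C, f x ^ p) ^ (r / p) * ∫⁻ y in C, k y) := by
  set κ := ∫⁻ y in C, k y
  set G : 𝔼 → ℝ≥0∞ := fun x => ∫⁻ y in B, k (x + t • (y - x)) with hG
  have hm : Measurable fun q : 𝔼 × 𝔼 => k (q.1 + t • (q.2 - q.1)) := hk.comp (by fun_prop)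
  have hGm : Measurable G := hm.lintegral_prod_right' (ν := volume.restrict B)
  have ha : 0 ≤ r / p := by positivity
  have hb : 0 ≤ 1 - r / p := by rw [sub_nonneg, div_le_one hp]; exact hrp
  have hsplit : ∀ z : ℝ≥0∞, z ^ (r / p) * z ^ (1 - r / p) = z := fun z => by
    rw [← ENNReal.rpow_add_of_nonneg _ _ ha hb, add_sub_cancel, ENNReal.rpow_one]
  set M := (ENNReal.ofReal t)⁻¹ ^ n * κ with hM
  calc ∫⁻ x in C, f x ^ r * G x
      ≤ ∫⁻ x in C, M ^ (r / p) * ((f x ^ p) ^ (r / p) * G x ^ (1 - r / p)) := by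
        refine setLIntegral_mono' hC fun x hx => ?_
        have h1 : G x ≤ M := lintegral_comp_segment_le hk hB hC hconv hBC hx ht
        have h2 : (f x ^ p) ^ (r / p) = f x ^ r := by
          rw [← ENNReal.rpow_mul, mul_div_cancel₀ _ hp.ne']
        rw [h2]
        calc f x ^ r * G x = f x ^ r * (G x ^ (r / p) * G x ^ (1 - r / p)) := by rw [hsplit]
          _ ≤ f x ^ r * (M ^ (r / p) * G x ^ (1 - r / p)) := by gcongr
          _ = _ := by ring
    _ = M ^ (r / p) * ∫⁻ x in C, (f x ^ p) ^ (r / p) * G x ^ (1 - r / p) :=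
        lintegral_const_mul _ (((hf.pow_const p).pow_const _).mul (hGm.pow_const _))
    _ ≤ M ^ (r / p) * ((∫⁻ x in C, f x ^ p) ^ (r / p) * (∫⁻ x in C, G x) ^ (1 - r / p)) := by
        gcongr
        exact ENNReal.lintegral_mul_norm_pow_le (hf.pow_const p).aemeasurable hGm.aemeasurable
          ha hb (by ring)
    _ ≤ M ^ (r / p) * ((∫⁻ x in C, f x ^ p) ^ (r / p) *
          (2 ^ n * volume C * κ) ^ (1 - r / p)) := by
        gcongr
        exact lintegral_lintegral_comp_segment_le hk hB hC hconv hBC ht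
    _ = ((ENNReal.ofReal t)⁻¹ ^ n) ^ (r / p) * ((2 ^ n * volume C) ^ (1 - r / p) *
        (∫⁻ x in C, f x ^ p) ^ (r / p) * (κ ^ (r / p) * κ ^ (1 - r / p))) := by
        rw [hM, ENNReal.mul_rpow_of_nonneg _ _ ha, ENNReal.mul_rpow_of_nonneg _ _ hb]
        ring
    _ = _ := by rw [hsplit]

/-- Tonelli moves the integral over `t` outside; for each `t` the interpolated bound applies with `k
= h ^ r`, leaving the integral of `t ^ (-n / p)`. -/
theorem lintegral_rpow_mul_segmentPotential_rpow_le {B C : Set 𝔼} (hB : MeasurableSet B)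
    (hC : MeasurableSet C) (hconv : Convex ℝ C) (hBC : B ⊆ C) {h f : 𝔼 → ℝ≥0∞}
    (hh : Measurable h) (hf : Measurable f) {p r : ℝ} (hr : 1 ≤ r) (hrp : r ≤ p) :
    ∫⁻ x in C, f x ^ r * segmentPotential B h x ^ r ≤
      (weightIntegral (n / p) * volume B) ^ (r - 1) * (weightIntegral (n / p) *
        ((2 ^ n * volume C) ^ (1 - r / p) *
          (∫⁻ x in C, f x ^ p) ^ (r / p) * ∫⁻ y in C, h y ^ r)) := by
  set N := (weightIntegral (n / p) * volume B) ^ (r - 1)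
  set Q := (2 ^ n * volume C) ^ (1 - r / p) *
          (∫⁻ x in C, f x ^ p) ^ (r / p) * ∫⁻ y in C, h y ^ r
  have h1 : Measurable fun q : (𝔼 × ℝ) × 𝔼 => h (q.1.1 + q.1.2 • (q.2 - q.1.1)) ^ r :=
    (hh.comp (by fun_prop)).pow_const r
  have h2 : Measurable fun q : 𝔼 × ℝ => ∫⁻ y in B, h (q.1 + q.2 • (y - q.1)) ^ r :=
    h1.lintegral_prod_right' (ν := volume.restrict B)
  have h3 : Measurable fun q : 𝔼 × ℝ => ENNReal.ofReal q.2 ^ (n / p * (r - 1)) *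
      ∫⁻ y in B, h (q.1 + q.2 • (y - q.1)) ^ r :=
    ((measurable_ofReal_rpow _).comp measurable_snd).mul h2
  have h4 : Measurable fun q : 𝔼 × ℝ => f q.1 ^ r * (ENNReal.ofReal q.2 ^ (n / p * (r - 1)) *
      ∫⁻ y in B, h (q.1 + q.2 • (y - q.1)) ^ r) :=
    ((hf.comp measurable_fst).pow_const r).mul h3
  have h5 : Measurable fun x : 𝔼 => ∫⁻ t in Ioc (0 : ℝ) 1, f x ^ r *
      (ENNReal.ofReal t ^ (n / p * (r - 1)) * ∫⁻ y in B, h (x + t • (y - x)) ^ r) :=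
    h4.lintegral_prod_right' (ν := volume.restrict (Ioc (0 : ℝ) 1))
  calc ∫⁻ x in C, f x ^ r * segmentPotential B h x ^ r
      ≤ ∫⁻ x in C, N * ∫⁻ t in Ioc (0 : ℝ) 1, f x ^ r *
          (ENNReal.ofReal t ^ (n / p * (r - 1)) * ∫⁻ y in B, h (x + t • (y - x)) ^ r) := by
        refine lintegral_mono fun x => ?_
        have h3x : Measurable fun t : ℝ => ENNReal.ofReal t ^ (n / p * (r - 1)) *
            ∫⁻ y in B, h (x + t • (y - x)) ^ r := h3.comp measurable_prodMk_left
        rw [lintegral_const_mul _ h3x]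
        calc f x ^ r * segmentPotential B h x ^ r ≤ f x ^ r * (N * _) :=
              mul_le_mul_right (segmentPotential_rpow_le hB hh x (n / p) hr) _
          _ = _ := by ring
    _ = N * ∫⁻ t in Ioc (0 : ℝ) 1, ∫⁻ x in C, f x ^ r *
          (ENNReal.ofReal t ^ (n / p * (r - 1)) * ∫⁻ y in B, h (x + t • (y - x)) ^ r) := by
        rw [lintegral_const_mul _ h5, lintegral_lintegral_swap h4.aemeasurable]
    _ ≤ N * ∫⁻ t in Ioc (0 : ℝ) 1, ENNReal.ofReal t ^ (-(n / p)) * Q := by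
        gcongr N * ?_
        refine setLIntegral_mono' measurableSet_Ioc fun t ht => ?_
        rw [← ofReal_rpow_mul_inv_pow_rpow (p := p) (r := r) ht.1, mul_assoc]
        simp_rw [mul_left_comm (f _ ^ r)]
        have h2t : Measurable fun x : 𝔼 => f x ^ r * ∫⁻ y in B, h (x + t • (y - x)) ^ r :=
          (hf.pow_const r).mul (h2.comp measurable_prodMk_right)
        rw [lintegral_const_mul _ h2t]
        gcongr
        exact lintegral_rpow_mul_comp_segment_le hB hC hconv hBC (hh.pow_const r) hf
          (by linarith) hrp (by linarith) ht
    _ = _ := by rw [lintegral_mul_const _ (measurable_ofReal_rpow _)]; rfl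

end Estimates

/-! ### Morrey's embedding and multiplication by L^p functions. -/

section Embedding

variable {n : ℕ} {X : Type*} [NormedAddCommGroup X] [NormedSpace ℝ X]

local notation "𝔼" => EuclideanSpace ℝ (Fin n)

theorem exists_ball_and_diam {C : Set 𝔼} (hC : IsOpen C) (hb : Bornology.IsBounded C)
    (hne : C.Nonempty) : ∃ (c₀ : 𝔼) (ρ : ℝ) (d : ℝ≥0∞), 0 < ρ ∧ ball c₀ (2 * ρ) ⊆ C ∧ d ≠ ⊤ ∧
      ∀ x ∈ C, ∀ y ∈ C, ‖y - x‖ₑ ≤ d := by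
  obtain ⟨c₀, hc₀⟩ := hne
  obtain ⟨η, hη, hηC⟩ := Metric.isOpen_iff.1 hC c₀ hc₀
  refine ⟨c₀, η / 2, ediam C, by positivity, by rwa [mul_div_cancel₀ _ two_ne_zero],
    hb.ediam_ne_top, fun x hx y hy => ?_⟩
  rw [← edist_eq_enorm_sub]
  exact edist_le_ediam_of_mem hy hx

theorem lintegral_const_mul_rpow_rpow {μ : Measure 𝔼} {f : 𝔼 → ℝ≥0∞} (hf : AEMeasurable f μ)
    (c : ℝ≥0∞) {r : ℝ} (hr : 0 < r) :
    (∫⁻ x, (c * f x) ^ r ∂μ) ^ (1 / r) = c * (∫⁻ x, f x ^ r ∂μ) ^ (1 / r) := by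
  simp_rw [ENNReal.mul_rpow_of_nonneg _ _ hr.le]
  rw [lintegral_const_mul'' _ (hf.pow_const r), ENNReal.mul_rpow_of_nonneg _ _ (by positivity),
    ← ENNReal.rpow_mul, mul_one_div_cancel hr.ne', ENNReal.rpow_one]

theorem lintegral_rpow_le_mul_measure {μ : Measure 𝔼} {f : 𝔼 → ℝ≥0∞} (hf : AEMeasurable f μ)
    {r p : ℝ} (hr : 0 < r) (hrp : r ≤ p) :
    (∫⁻ x, f x ^ r ∂μ) ^ (1 / r) ≤
      (∫⁻ x, f x ^ p ∂μ) ^ (1 / p) * μ univ ^ (1 / r - 1 / p) := by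
  simpa [eLpNorm'] using
    eLpNorm'_le_eLpNorm'_mul_rpow_measure_univ hr hrp hf.aestronglyMeasurable

/-- Multiply the pointwise bound of `w` by `f` and take L^r-norms. The mean contributes a constant
times the norm of `f`, and the potential is covered by the weighted estimate. No relation between
`r` and the dimension is needed. -/
theorem exists_lintegral_mul_enorm_le [CompleteSpace X] {C : Set 𝔼} (hC : IsOpen C)
    (hconv : Convex ℝ C) (hb : Bornology.IsBounded C) (hne : C.Nonempty) {p r : ℝ}
    (hp : n < p) (hr : 1 ≤ r) (hrp : r ≤ p) :
    ∃ c : ℝ≥0∞, c ≠ ⊤ ∧ ∀ (w : 𝔼 → X) (g : 𝔼 → 𝔼 →L[ℝ] X), HasWeakFDeriv C w g →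
      AEStronglyMeasurable w (volume.restrict C) → AEStronglyMeasurable g (volume.restrict C) →
      ∀ f : 𝔼 → ℝ≥0∞, AEMeasurable f (volume.restrict C) →
        (∫⁻ x in C, (f x * ‖w x‖ₑ) ^ r) ^ (1 / r) ≤ c * (∫⁻ x in C, f x ^ p) ^ (1 / p) *
          ((∫⁻ x in C, ‖w x‖ₑ ^ r) ^ (1 / r) + (∫⁻ x in C, ‖g x‖ₑ ^ r) ^ (1 / r)) := by
  obtain ⟨c₀, ρ, d, hρ, hball, hdt, hd⟩ := exists_ball_and_diam hC hb hne
  set B := ball c₀ ρ with hBdef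
  have hBm : MeasurableSet B := measurableSet_ball
  have hBC : B ⊆ C := (ball_subset_ball (by linarith)).trans hball
  have hr0 : 0 < r := by linarith
  have hp0 : 0 < p := by linarith
  have hCv : volume C ≠ ⊤ := hb.measure_lt_top.ne
  have hBv : volume B ≠ ⊤ := measure_ball_lt_top.ne
  have hBp : volume B ≠ 0 := (measure_ball_pos _ _ hρ).ne'
  have hW : weightIntegral (n / p) ≠ ⊤ := weightIntegral_ne_top ((div_lt_one hp0).2 hp)
  set N := (weightIntegral (n / p) * volume B) ^ (r - 1) * (weightIntegral (n / p) *
        (2 ^ n * volume C) ^ (1 - r / p)) with hN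
  have hNt : N ≠ ⊤ := by
    have h1 : 0 ≤ r - 1 := by linarith
    have h2 : 0 ≤ 1 - r / p := by rw [sub_nonneg, div_le_one hp0]; exact hrp
    have h3 : (weightIntegral (n / p) * volume B) ^ (r - 1) ≠ ⊤ :=
      ENNReal.rpow_ne_top_of_nonneg h1 (by finiteness)
    have h4 : (2 ^ n * volume C) ^ (1 - r / p) ≠ ⊤ :=
      ENNReal.rpow_ne_top_of_nonneg h2 (by finiteness)
    finiteness
  -- The first factor passes from L¹ to L^r for the mean of `w`, the second from L^r to L^p for `f`.
  set c₁ := volume C ^ (1 / 1 - 1 / r) * volume C ^ (1 / r - 1 / p) with hc₁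
  have hc₁t : c₁ ≠ ⊤ := by
    refine ENNReal.mul_ne_top (ENNReal.rpow_ne_top_of_nonneg ?_ hCv)
      (ENNReal.rpow_ne_top_of_nonneg ?_ hCv)
    · rw [sub_nonneg]; exact one_div_le_one_div_of_le one_pos hr
    · rw [sub_nonneg]; exact one_div_le_one_div_of_le hr0 hrp
  set c₂ := d * N ^ (1 / r) with hc₂
  have hc₂t : c₂ ≠ ⊤ :=
    ENNReal.mul_ne_top hdt (ENNReal.rpow_ne_top_of_nonneg (by positivity) hNt)
  refine ⟨(volume B)⁻¹ * (c₁ + c₂), by finiteness, fun w g h hwm hgm f hf => ?_⟩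
  -- A Borel representative of `‖g‖ₑ`: the potential evaluates it along segments, where only genuine
  -- measurability is convenient.
  set k := hgm.enorm.mk _ with hk
  have hkm : Measurable k := hgm.enorm.measurable_mk
  have hgk : (fun x => ‖g x‖ₑ) =ᵐ[volume.restrict C] k := hgm.enorm.ae_eq_mk
  set f₁ := hf.mk _ with hf₁
  have hf₁m : Measurable f₁ := hf.measurable_mk
  have hff₁ : f =ᵐ[volume.restrict C] f₁ := hf.ae_eq_mk
  have hpt := h.ae_volume_mul_enorm_le hC hconv hb hρ hball hdt hd hkm (hgk.mono fun x hx => hx.le)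
  set b := ∫⁻ y in B, ‖w y‖ₑ with hbdef
  set wr := (∫⁻ x in C, ‖w x‖ₑ ^ r) ^ (1 / r) with hwr
  set gr := (∫⁻ x in C, ‖g x‖ₑ ^ r) ^ (1 / r) with hgr
  set fp := (∫⁻ x in C, f x ^ p) ^ (1 / p) with hfp
  have hTm := measurable_segmentPotential B hkm
  have hb1 : b ≤ wr * volume C ^ (1 / 1 - 1 / r) := by
    have := lintegral_rpow_le_mul_measure (hwm.enorm) one_pos hr
    refine (lintegral_mono_set hBC).trans ?_
    simpa [hwr] using this
  have hf1 : (∫⁻ x in C, f x ^ r) ^ (1 / r) ≤ fp * volume C ^ (1 / r - 1 / p) := by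
    have := lintegral_rpow_le_mul_measure hf hr0 hrp
    simpa [hfp] using this
  have hT : (∫⁻ x in C, (f x * segmentPotential B k x) ^ r) ^ (1 / r) ≤
      N ^ (1 / r) * fp * gr := by
    have e1 : ∫⁻ x in C, (f x * segmentPotential B k x) ^ r =
        ∫⁻ x in C, f₁ x ^ r * segmentPotential B k x ^ r := by
      refine lintegral_congr_ae ?_
      filter_upwards [hff₁] with x hx
      rw [hx, ENNReal.mul_rpow_of_nonneg _ _ hr0.le]
    have e2 : ∫⁻ x in C, f₁ x ^ p = ∫⁻ x in C, f x ^ p :=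
      lintegral_congr_ae (hff₁.mono fun x hx => by simp only [hx])
    have e3 : ∫⁻ x in C, k x ^ r = ∫⁻ x in C, ‖g x‖ₑ ^ r :=
      lintegral_congr_ae (hgk.mono fun x hx => by simp only [← hx])
    have := lintegral_rpow_mul_segmentPotential_rpow_le hBm hC.measurableSet hconv hBC hkm hf₁m
      hr hrp
    rw [← e1, e2, e3] at this
    calc _ ≤ (N * (∫⁻ x in C, f x ^ p) ^ (r / p) * ∫⁻ x in C, ‖g x‖ₑ ^ r) ^ (1 / r) := by
          refine ENNReal.rpow_le_rpow (this.trans (le_of_eq ?_)) (by positivity)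
          rw [hN]; ring
      _ = _ := by
          rw [ENNReal.mul_rpow_of_nonneg _ _ (by positivity),
            ENNReal.mul_rpow_of_nonneg _ _ (by positivity), ← ENNReal.rpow_mul]
          congr 3
          field_simp
  have main : volume B * (∫⁻ x in C, (f x * ‖w x‖ₑ) ^ r) ^ (1 / r) ≤
      (c₁ + c₂) * fp * (wr + gr) := by
    calc volume B * (∫⁻ x in C, (f x * ‖w x‖ₑ) ^ r) ^ (1 / r)
        = (∫⁻ x in C, (volume B * (f x * ‖w x‖ₑ)) ^ r) ^ (1 / r) :=
          (lintegral_const_mul_rpow_rpow (hf.mul hwm.enorm) _ hr0).symm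
      _ ≤ (∫⁻ x in C, ((fun x => b * f x) + fun x => d * (f x * segmentPotential B k x)) x ^ r)
            ^ (1 / r) := by
          refine ENNReal.rpow_le_rpow (lintegral_mono_ae ?_) (by positivity)
          filter_upwards [hpt] with x hx
          refine ENNReal.rpow_le_rpow ?_ hr0.le
          calc volume B * (f x * ‖w x‖ₑ) = f x * (volume B * ‖w x‖ₑ) := by ring
            _ ≤ f x * (b + d * segmentPotential B k x) := by gcongr
            _ = _ := by simp only [Pi.add_apply]; ring
      _ ≤ (∫⁻ x in C, (b * f x) ^ r) ^ (1 / r) +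
            (∫⁻ x in C, (d * (f x * segmentPotential B k x)) ^ r) ^ (1 / r) :=
          ENNReal.lintegral_Lp_add_le (hf.const_mul b)
            ((hf.mul hTm.aemeasurable).const_mul d) hr
      _ = b * (∫⁻ x in C, f x ^ r) ^ (1 / r) +
            d * (∫⁻ x in C, (f x * segmentPotential B k x) ^ r) ^ (1 / r) := by
          rw [lintegral_const_mul_rpow_rpow hf b hr0,
            lintegral_const_mul_rpow_rpow (f := fun x => f x * segmentPotential B k x)
              (hf.mul hTm.aemeasurable) d hr0]
      _ ≤ (wr * volume C ^ (1 / 1 - 1 / r)) * (fp * volume C ^ (1 / r - 1 / p)) +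
            d * (N ^ (1 / r) * fp * gr) := by gcongr
      _ = c₁ * fp * wr + c₂ * fp * gr := by rw [hc₁, hc₂]; ring
      _ ≤ (c₁ + c₂) * fp * wr + (c₁ + c₂) * fp * gr := by
          gcongr
          · exact le_self_add
          · exact le_add_self
      _ = _ := (mul_add _ _ _).symm
  calc (∫⁻ x in C, (f x * ‖w x‖ₑ) ^ r) ^ (1 / r)
      = (volume B)⁻¹ * (volume B * (∫⁻ x in C, (f x * ‖w x‖ₑ) ^ r) ^ (1 / r)) := by
        rw [← mul_assoc, ENNReal.inv_mul_cancel hBp hBv, one_mul]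
    _ ≤ (volume B)⁻¹ * ((c₁ + c₂) * fp * (wr + gr)) := by gcongr
    _ = _ := by ring

/-- On a bounded convex domain, multiplication by a function in `L^p` maps `W^{1,r}` to `L^r`
when `p` exceeds the dimension and `r ≤ p`. -/
theorem exists_eLpNorm_mul_le [CompleteSpace X] {Y : Type*} [NormedAddCommGroup Y] {C : Set 𝔼}
    (hC : IsOpen C) (hconv : Convex ℝ C) (hb : Bornology.IsBounded C) (hne : C.Nonempty)
    {p r : ℝ≥0∞} (hp : n < p) (hr : 1 ≤ r) (hrp : r ≤ p) :
    ∃ c : ℝ≥0∞, c ≠ ⊤ ∧ ∀ (w : 𝔼 → X) (g : 𝔼 → 𝔼 →L[ℝ] X), HasWeakFDeriv C w g →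
      AEStronglyMeasurable w (volume.restrict C) → AEStronglyMeasurable g (volume.restrict C) →
      ∀ f : 𝔼 → Y, AEStronglyMeasurable f (volume.restrict C) →
        eLpNorm (fun x => ‖f x‖ * ‖w x‖) r (volume.restrict C) ≤
          c * eLpNorm f p (volume.restrict C) *
            (eLpNorm w r (volume.restrict C) + eLpNorm g r (volume.restrict C)) := by
  rcases eq_or_ne p ⊤ with rfl | hpt
  · refine ⟨1, by simp, fun w g h hwm hgm f hf => ?_⟩
    have := eLpNorm_le_eLpNorm_top_mul_eLpNorm r (fun x => ‖f x‖) hwm.norm (fun a b => a * b) 1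
      (Filter.Eventually.of_forall fun x => by simp)
    refine this.trans ?_
    rw [eLpNorm_norm, eLpNorm_norm, ENNReal.coe_one]
    gcongr
    exact le_self_add
  · have hrt : r ≠ ⊤ := ne_top_of_le_ne_top hpt hrp
    have hr0 : r ≠ 0 := (zero_lt_one.trans_le hr).ne'
    have hp0 : p ≠ 0 := (zero_lt_one.trans_le (hr.trans hrp)).ne'
    have hp' : (n : ℝ) < p.toReal := by
      have := (ENNReal.toReal_lt_toReal (by simp) hpt).2 hp
      simpa using this
    have hr' : 1 ≤ r.toReal := by
      have := ENNReal.toReal_mono hrt hr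
      simpa using this
    obtain ⟨c, hc, H⟩ := exists_lintegral_mul_enorm_le (X := X) hC hconv hb hne hp' hr'
      (ENNReal.toReal_mono hpt hrp)
    refine ⟨c, hc, fun w g h hwm hgm f hf => ?_⟩
    simp_rw [eLpNorm_eq_lintegral_rpow_enorm_toReal hr0 hrt,
      eLpNorm_eq_lintegral_rpow_enorm_toReal hp0 hpt, enorm_mul, enorm_norm]
    exact H w g h hwm hgm _ hf.enorm

/-- The embedding of `W^{1,p}` into `L^∞` for a bounded convex domain of dimension less
than `p`. -/
theorem exists_eLpNorm_top_le [CompleteSpace X] {C : Set 𝔼} (hC : IsOpen C)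
    (hconv : Convex ℝ C) (hb : Bornology.IsBounded C) (hne : C.Nonempty)
    {p : ℝ≥0∞} (hp : n < p) (hp1 : 1 ≤ p) :
    ∃ c : ℝ≥0∞, c ≠ ⊤ ∧ ∀ (w : 𝔼 → X) (g : 𝔼 → 𝔼 →L[ℝ] X), HasWeakFDeriv C w g →
      AEStronglyMeasurable w (volume.restrict C) → AEStronglyMeasurable g (volume.restrict C) →
        eLpNorm w ⊤ (volume.restrict C) ≤
          c * (eLpNorm w p (volume.restrict C) + eLpNorm g p (volume.restrict C)) := by
  rcases eq_or_ne p ⊤ with rfl | hpt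
  · exact ⟨1, by simp, fun w g h hwm hgm => by rw [one_mul]; exact le_self_add⟩
  have hp0 : p ≠ 0 := (zero_lt_one.trans_le hp1).ne'
  set q := p.toReal with hq
  have hp' : (n : ℝ) < q := by
    have := (ENNReal.toReal_lt_toReal (by simp) hpt).2 hp
    simpa using this
  have hq1 : 1 ≤ q := by
    have := ENNReal.toReal_mono hpt hp1
    simpa using this
  have hq0 : 0 < q := by linarith
  obtain ⟨c₀, ρ, d, hρ, hball, hdt, hd⟩ := exists_ball_and_diam hC hb hne
  set B := ball c₀ ρ with hBdef
  have hBm : MeasurableSet B := measurableSet_ball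
  have hBC : B ⊆ C := (ball_subset_ball (by linarith)).trans hball
  have hCv : volume C ≠ ⊤ := hb.measure_lt_top.ne
  have hBv : volume B ≠ ⊤ := measure_ball_lt_top.ne
  have hBp : volume B ≠ 0 := (measure_ball_pos _ _ hρ).ne'
  have hW : weightIntegral (n / q) ≠ ⊤ := weightIntegral_ne_top ((div_lt_one hq0).2 hp')
  set N := (weightIntegral (n / q) * volume B) ^ (q - 1) * weightIntegral (n / q) with hN
  have hNt : N ≠ ⊤ := ENNReal.mul_ne_top
    (ENNReal.rpow_ne_top_of_nonneg (by linarith) (by finiteness)) hW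
  set c₁ := volume C ^ (1 / 1 - 1 / q) with hc₁
  have hc₁t : c₁ ≠ ⊤ := ENNReal.rpow_ne_top_of_nonneg
    (by rw [sub_nonneg]; exact one_div_le_one_div_of_le one_pos hq1) hCv
  set c₂ := d * N ^ (1 / q) with hc₂
  have hc₂t : c₂ ≠ ⊤ :=
    ENNReal.mul_ne_top hdt (ENNReal.rpow_ne_top_of_nonneg (by positivity) hNt)
  refine ⟨(volume B)⁻¹ * (c₁ + c₂), by finiteness, fun w g h hwm hgm => ?_⟩
  set k := hgm.enorm.mk _ with hk
  have hkm : Measurable k := hgm.enorm.measurable_mk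
  have hgk : (fun x => ‖g x‖ₑ) =ᵐ[volume.restrict C] k := hgm.enorm.ae_eq_mk
  have hpt' := h.ae_volume_mul_enorm_le hC hconv hb hρ hball hdt hd hkm (hgk.mono fun x hx => hx.le)
  rw [eLpNorm_eq_lintegral_rpow_enorm_toReal hp0 hpt,
    eLpNorm_eq_lintegral_rpow_enorm_toReal hp0 hpt, eLpNorm_exponent_top, ← hq]
  set wr := (∫⁻ x in C, ‖w x‖ₑ ^ q) ^ (1 / q) with hwr
  set gr := (∫⁻ x in C, ‖g x‖ₑ ^ q) ^ (1 / q) with hgr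
  have hb1 : ∫⁻ y in B, ‖w y‖ₑ ≤ c₁ * wr := by
    have := lintegral_rpow_le_mul_measure (hwm.enorm) one_pos hq1
    refine (lintegral_mono_set hBC).trans ?_
    rw [mul_comm]
    simpa [hwr, hc₁] using this
  have hT : ∀ x ∈ C, segmentPotential B k x ≤ N ^ (1 / q) * gr := by
    intro x hx
    have e3 : ∫⁻ x in C, k x ^ q = ∫⁻ x in C, ‖g x‖ₑ ^ q :=
      lintegral_congr_ae (hgk.mono fun x hx => by simp only [← hx])
    have := segmentPotential_rpow_le_of_lt hBm hC.measurableSet hconv hBC hkm hx hq1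
    rw [e3, ← mul_assoc] at this
    have h2 := ENNReal.rpow_le_rpow this (z := 1 / q) (by positivity)
    rwa [ENNReal.mul_rpow_of_nonneg _ _ (by positivity), ← ENNReal.rpow_mul,
      mul_one_div_cancel hq0.ne', ENNReal.rpow_one] at h2
  refine essSup_le_of_ae_le _ ?_
  filter_upwards [hpt', ae_restrict_mem hC.measurableSet] with x hx hxC
  calc ‖w x‖ₑ = (volume B)⁻¹ * (volume B * ‖w x‖ₑ) := by
        rw [← mul_assoc, ENNReal.inv_mul_cancel hBp hBv, one_mul]
    _ ≤ (volume B)⁻¹ * (c₁ * wr + d * (N ^ (1 / q) * gr)) := by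
        gcongr
        exact hx.trans (add_le_add hb1 (by gcongr; exact hT x hxC))
    _ = (volume B)⁻¹ * (c₁ * wr + c₂ * gr) := by rw [hc₂]; ring
    _ ≤ (volume B)⁻¹ * ((c₁ + c₂) * wr + (c₁ + c₂) * gr) := by
        gcongr
        · exact le_self_add
        · exact le_add_self
    _ = _ := by ring

end Embedding

/-! ### The Leibniz rule with one smooth factor. -/

section Product

variable {n : ℕ} {G : Type*} [NormedAddCommGroup G] [NormedSpace ℝ G] [FiniteDimensional ℝ G]
  {F : Type*} [NormedAddCommGroup F] [NormedSpace ℝ F] [FiniteDimensional ℝ F]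
  {F' : Type*} [NormedAddCommGroup F'] [NormedSpace ℝ F'] [FiniteDimensional ℝ F']

local notation "𝔼" => EuclideanSpace ℝ (Fin n)

theorem locallyIntegrableOn_bilin {Y₁ Y₂ Y₃ : Type*} [NormedAddCommGroup Y₁] [NormedSpace ℝ Y₁]
    [NormedAddCommGroup Y₂] [NormedSpace ℝ Y₂] [NormedAddCommGroup Y₃] [NormedSpace ℝ Y₃]
    (b : Y₁ →L[ℝ] Y₂ →L[ℝ] Y₃) {Ω : Set 𝔼} (hΩ : IsOpen Ω) {u : 𝔼 → Y₁} {k : 𝔼 → Y₂}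
    (hu : LocallyIntegrableOn u Ω volume) (hk : Continuous k) :
    LocallyIntegrableOn (fun x => b (u x) (k x)) Ω volume := by
  refine (locallyIntegrableOn_iff hΩ.isLocallyClosed).2 fun K hK hKc => ?_
  have h1 : IntegrableOn u K volume := hu.integrableOn_compact_subset hK hKc
  obtain ⟨M, hM⟩ := hKc.exists_bound_of_continuousOn hk.continuousOn
  refine Integrable.mono' (h1.norm.const_mul (‖b‖ * M))
    (b.aestronglyMeasurable_comp₂ h1.1 hk.aestronglyMeasurable) ?_
  refine ae_restrict_of_forall_mem hKc.measurableSet fun x hx => ?_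
  calc ‖b (u x) (k x)‖ ≤ ‖b‖ * ‖u x‖ * ‖k x‖ := b.le_opNorm₂ _ _
    _ ≤ ‖b‖ * ‖u x‖ * M := by gcongr; exact hM x hx
    _ = ‖b‖ * M * ‖u x‖ := by ring

/-- The smooth factor is absorbed into the test function. Expanding `φ` in a basis turns `ζ` into
the scalar test functions `ζ * co i (φ ·)`, against which the weak derivative of `a` is tested;
summing over the basis gives the rule. -/
theorem HasWeakFDeriv.bilin_of_contDiff (B : G →L[ℝ] F →L[ℝ] F') {Ω : Set 𝔼} (hΩ : IsOpen Ω)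
    {a : 𝔼 → G} {a' : 𝔼 → 𝔼 →L[ℝ] G} (ha : HasWeakFDeriv Ω a a')
    {φ : 𝔼 → F} (hφ : ContDiff ℝ ∞ φ) :
    HasWeakFDeriv Ω (fun x => B (a x) (φ x))
      (fun x => (B (a x)).comp (fderiv ℝ φ x) + (B.flip (φ x)).comp (a' x)) := by
  have : CompleteSpace G := FiniteDimensional.complete ℝ G
  have : CompleteSpace F := FiniteDimensional.complete ℝ F
  have : CompleteSpace F' := FiniteDimensional.complete ℝ F'
  have hφ' : Continuous (fderiv ℝ φ) := hφ.continuous_fderiv (by simp)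
  have l1 : LocallyIntegrableOn (fun x => B (a x) (φ x)) Ω volume :=
    locallyIntegrableOn_bilin B hΩ ha.1 hφ.continuous
  have l2 : LocallyIntegrableOn (fun x => (B (a x)).comp (fderiv ℝ φ x)) Ω volume :=
    locallyIntegrableOn_bilin ((compL ℝ 𝔼 F F').comp B) hΩ ha.1 hφ'
  have l3 : LocallyIntegrableOn (fun x => (B.flip (φ x)).comp (a' x)) Ω volume :=
    locallyIntegrableOn_bilin (compL ℝ 𝔼 G F').flip hΩ ha.2.1 (B.flip.continuous.comp hφ.continuous)
  refine ⟨l1, aux_locallyIntegrableOn_add l2 l3, fun ζ hζ hc hs v => ?_⟩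
  let b := Module.finBasis ℝ F
  let co : Fin (Module.finrank ℝ F) → F →L[ℝ] ℝ := fun i => (b.coord i).toContinuousLinearMap
  have hco : ∀ y, ∑ i, co i y • b i = y := fun y => b.sum_repr y
  let ψ : Fin (Module.finrank ℝ F) → 𝔼 → ℝ := fun i x => ζ x * co i (φ x)
  have hψs : ∀ i, ContDiff ℝ ∞ (ψ i) := fun i => hζ.mul ((co i).contDiff.comp hφ)
  have hψc : ∀ i, HasCompactSupport (ψ i) := fun i => hc.mul_right
  have hψt : ∀ i, tsupport (ψ i) ⊆ Ω := fun i => tsupport_mul_subset_left.trans hs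
  have hψd : ∀ i x, fderiv ℝ (ψ i) x v =
      ζ x * co i (fderiv ℝ φ x v) + co i (φ x) * fderiv ℝ ζ x v := by
    intro i x
    have h1 : HasFDerivAt (fun x => co i (φ x)) ((co i).comp (fderiv ℝ φ x)) x :=
      (co i).hasFDerivAt.comp x (hφ.differentiable (by simp)).differentiableAt.hasFDerivAt
    have h2 := (hζ.differentiable (by simp)).differentiableAt (x := x) |>.hasFDerivAt.mul h1
    rw [show ψ i = ζ * fun x => co i (φ x) from rfl, h2.fderiv]
    simp
  have j1 : ∀ i, Integrable (fun x => fderiv ℝ (ψ i) x v • B (a x) (b i)) volume := fun i =>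
    integrable_fderiv_smul (locallyIntegrableOn_bilin B hΩ ha.1 (continuous_const (y := b i)))
      (hψs i) (hψc i) (hψt i) v
  have j2 : ∀ i, Integrable (fun x => ψ i x • B (a' x v) (b i)) volume := fun i =>
    integrable_smul_of_tsupport_subset (locallyIntegrableOn_bilin B hΩ
      (locallyIntegrableOn_apply ha.2.1 v) (continuous_const (y := b i)))
      (hψs i).continuous (hψc i) (hψt i)
  have hi : ∀ i, ∫ x, fderiv ℝ (ψ i) x v • B (a x) (b i) = -∫ x, ψ i x • B (a' x v) (b i) := by
    intro i
    have i1 := integrable_fderiv_smul ha.1 (hψs i) (hψc i) (hψt i) v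
    have i2 := integrable_smul_of_tsupport_subset (locallyIntegrableOn_apply ha.2.1 v)
      (hψs i).continuous (hψc i) (hψt i)
    have h := congrArg (B.flip (b i)) (ha.2.2 (ψ i) (hψs i) (hψc i) (hψt i) v)
    rw [map_neg, ← (B.flip (b i)).integral_comp_comm i1,
      ← (B.flip (b i)).integral_comp_comm i2] at h
    simpa only [map_smul, flip_apply] using h
  have hsum := Finset.sum_congr (rfl : Finset.univ = Finset.univ) fun i _ => hi i
  rw [Finset.sum_neg_distrib, ← integral_finsetSum _ fun i _ => j1 i,
    ← integral_finsetSum _ fun i _ => j2 i] at hsum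
  have p1 : ∀ x, ∑ i, fderiv ℝ (ψ i) x v • B (a x) (b i) =
      ζ x • B (a x) (fderiv ℝ φ x v) + fderiv ℝ ζ x v • B (a x) (φ x) := by
    intro x
    rw [← (B (a x)).map_smul, ← (B (a x)).map_smul, ← (B (a x)).map_add]
    conv_rhs => rw [← hco (fderiv ℝ φ x v), ← hco (φ x)]
    simp only [hψd, ← (B (a x)).map_smul, ← map_sum]
    congr 1
    rw [Finset.smul_sum, Finset.smul_sum, ← Finset.sum_add_distrib]
    refine Finset.sum_congr rfl fun i _ => ?_
    rw [smul_smul, smul_smul, ← add_smul, mul_comm (fderiv ℝ ζ x v)]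
  have p2 : ∀ x, ∑ i, ψ i x • B (a' x v) (b i) = ζ x • B (a' x v) (φ x) := by
    intro x
    conv_rhs => rw [← hco (φ x)]
    simp only [map_sum, map_smul, Finset.smul_sum, smul_smul, ψ]
  simp_rw [p1, p2] at hsum
  have k1 := integrable_fderiv_smul l1 hζ hc hs v
  have k2 := integrable_smul_of_tsupport_subset (locallyIntegrableOn_apply l2 v)
    hζ.continuous hc hs
  have k3 := integrable_smul_of_tsupport_subset (locallyIntegrableOn_apply l3 v)
    hζ.continuous hc hs
  simp only [coe_comp, Function.comp_apply, flip_apply] at k2 k3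
  rw [integral_add k2 k1] at hsum
  simp only [add_apply, coe_comp, Function.comp_apply, flip_apply, smul_add]
  rw [integral_add k2 k3, eq_neg_iff_add_eq_zero]
  rw [eq_neg_iff_add_eq_zero] at hsum
  rw [← hsum]; abel

end Product

/-! ### Products of two Sobolev functions. -/

section Product

variable {n : ℕ} {G : Type*} [NormedAddCommGroup G] [NormedSpace ℝ G] [FiniteDimensional ℝ G]
  {F : Type*} [NormedAddCommGroup F] [NormedSpace ℝ F] [FiniteDimensional ℝ F]
  {F' : Type*} [NormedAddCommGroup F'] [NormedSpace ℝ F'] [FiniteDimensional ℝ F']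

local notation "𝔼" => EuclideanSpace ℝ (Fin n)

/-- The pointwise estimate behind Hölder's inequality with exponent `∞`. -/
theorem eLpNorm_le_top_mul {Y₁ Y₂ Y₃ : Type*} [NormedAddCommGroup Y₁] [NormedAddCommGroup Y₂]
    [NormedAddCommGroup Y₃] {μ : Measure 𝔼} {u : 𝔼 → Y₁} {k : 𝔼 → Y₂} {f : 𝔼 → Y₃} {c : ℝ≥0}
    {q : ℝ≥0∞} (hk : AEStronglyMeasurable k μ) (hf : ∀ x, ‖f x‖ ≤ c * ‖u x‖ * ‖k x‖) :
    eLpNorm f q μ ≤ c * eLpNorm u ⊤ μ * eLpNorm k q μ := by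
  have h1 : eLpNorm f q μ ≤ eLpNorm (fun x => (c : ℝ) * (‖u x‖ * ‖k x‖)) q μ :=
    eLpNorm_mono_real fun x => by rw [← mul_assoc]; exact hf x
  have h2 := eLpNorm_le_eLpNorm_top_mul_eLpNorm q (fun x => ‖u x‖) hk.norm
    (fun a b => (c : ℝ) * (a * b)) c (Filter.Eventually.of_forall fun x => by
      simp [mul_assoc])
  rw [eLpNorm_norm, eLpNorm_norm] at h2
  exact h1.trans h2

theorem eLpNorm_le_nnreal_mul {Y₁ Y₂ : Type*} [NormedAddCommGroup Y₁] [NormedAddCommGroup Y₂]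
    {μ : Measure 𝔼} {u : 𝔼 → Y₁} {f : 𝔼 → Y₂} {c : ℝ≥0}
    {q : ℝ≥0∞} (hf : ∀ x, ‖f x‖ ≤ c * ‖u x‖) : eLpNorm f q μ ≤ c * eLpNorm u q μ := by
  have := eLpNorm_le_nnreal_smul_eLpNorm_of_ae_le_mul (f := f) (g := u) (c := c) (μ := μ)
      (Filter.Eventually.of_forall fun x => by exact_mod_cast hf x) q
  rwa [ENNReal.smul_def, smul_eq_mul] at this

theorem norm_bilin_comp_le {E F F' G : Type*} [NormedAddCommGroup E] [NormedSpace ℝ E]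
    [NormedAddCommGroup F] [NormedSpace ℝ F] [NormedAddCommGroup F'] [NormedSpace ℝ F']
    [NormedAddCommGroup G] [NormedSpace ℝ G] (B : G →L[ℝ] F →L[ℝ] F') (y : G)
    (T : E →L[ℝ] F) : ‖(B y).comp T‖ ≤ ‖B‖₊ * ‖y‖ * ‖T‖ :=
  (opNorm_comp_le _ _).trans (mul_le_mul_of_nonneg_right (B.le_opNorm y) (norm_nonneg _))

theorem norm_flip_comp_le {E F F' G : Type*} [NormedAddCommGroup E] [NormedSpace ℝ E]
    [NormedAddCommGroup F] [NormedSpace ℝ F] [NormedAddCommGroup F'] [NormedSpace ℝ F']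
    [NormedAddCommGroup G] [NormedSpace ℝ G] (B : G →L[ℝ] F →L[ℝ] F') (y : F)
    (T : E →L[ℝ] G) : ‖(B.flip y).comp T‖ ≤ ‖B‖₊ * ‖‖T‖ * ‖y‖‖ := by
  rw [norm_mul, norm_norm, norm_norm]
  refine (opNorm_comp_le _ _).trans ?_
  calc ‖B.flip y‖ * ‖T‖ ≤ ‖B.flip‖ * ‖y‖ * ‖T‖ := by gcongr; exact B.flip.le_opNorm y
    _ = ‖B‖ * (‖T‖ * ‖y‖) := by rw [opNorm_flip]; ring

theorem aestronglyMeasurable_bilin_comp {G F F' : Type*} [NormedAddCommGroup G] [NormedSpace ℝ G]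
    [NormedAddCommGroup F] [NormedSpace ℝ F] [NormedAddCommGroup F'] [NormedSpace ℝ F']
    (B : G →L[ℝ] F →L[ℝ] F') {μ : Measure 𝔼} {u : 𝔼 → G}
    {T : 𝔼 → 𝔼 →L[ℝ] F} (hu : AEStronglyMeasurable u μ) (hT : AEStronglyMeasurable T μ) :
    AEStronglyMeasurable (fun x => (B (u x)).comp (T x)) μ :=
  ((compL ℝ 𝔼 F F').comp B).aestronglyMeasurable_comp₂ hu hT

theorem aestronglyMeasurable_flip_comp {G F F' : Type*} [NormedAddCommGroup G] [NormedSpace ℝ G]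
    [NormedAddCommGroup F] [NormedSpace ℝ F] [NormedAddCommGroup F'] [NormedSpace ℝ F']
    (B : G →L[ℝ] F →L[ℝ] F') {μ : Measure 𝔼} {u : 𝔼 → F}
    {T : 𝔼 → 𝔼 →L[ℝ] G} (hu : AEStronglyMeasurable u μ) (hT : AEStronglyMeasurable T μ) :
    AEStronglyMeasurable (fun x => (B.flip (u x)).comp (T x)) μ :=
  aestronglyMeasurable_bilin_comp B.flip hu hT

/-- The weak Leibniz rule on a bounded convex domain. -/
theorem HasWeakFDeriv.bilin (B : G →L[ℝ] F →L[ℝ] F') {C : Set 𝔼} (hC : IsOpen C)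
    (hconv : Convex ℝ C) (hb : Bornology.IsBounded C) (hne : C.Nonempty) {p : ℝ≥0∞}
    (hp : n < p) (hp1 : 1 ≤ p) {a : 𝔼 → G} {a' : 𝔼 → 𝔼 →L[ℝ] G} (ha : HasWeakFDeriv C a a')
    (hat : MemLp a ⊤ (volume.restrict C)) (ha'p : MemLp a' p (volume.restrict C))
    {w : 𝔼 → F} {g : 𝔼 → 𝔼 →L[ℝ] F} (hw : HasWeakFDeriv C w g)
    (hw1 : MemLp w 1 (volume.restrict C)) (hg1 : MemLp g 1 (volume.restrict C)) :
    HasWeakFDeriv C (fun x => B (a x) (w x))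
      (fun x => (B (a x)).comp (g x) + (B.flip (w x)).comp (a' x)) := by
  have : CompleteSpace F := FiniteDimensional.complete ℝ F
  set A := eLpNorm a ⊤ (volume.restrict C) with hA
  have hAt : A ≠ ⊤ := hat.2.ne
  set P := eLpNorm a' p (volume.restrict C) with hP
  have hPt : P ≠ ⊤ := ha'p.2.ne
  set β : ℝ≥0∞ := (‖B‖₊ : ℝ≥0∞) with hβ
  have hβt : β ≠ ⊤ := ENNReal.coe_ne_top
  have l1 : LocallyIntegrableOn (fun x => B (a x) (w x)) C volume := by
    refine locallyIntegrableOn_of_memLp le_rfl ⟨B.aestronglyMeasurable_comp₂ hat.1 hw1.1, ?_⟩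
    refine (eLpNorm_le_top_mul (c := ‖B‖₊) hw1.1 fun x => B.le_opNorm₂ _ _).trans_lt ?_
    exact ENNReal.mul_lt_top (ENNReal.mul_lt_top ENNReal.coe_lt_top hat.2) hw1.2
  have l2 : LocallyIntegrableOn (fun x => (B (a x)).comp (g x)) C volume := by
    refine locallyIntegrableOn_of_memLp le_rfl ⟨aestronglyMeasurable_bilin_comp B hat.1 hg1.1, ?_⟩
    refine (eLpNorm_le_top_mul hg1.1 fun x => norm_bilin_comp_le B _ _).trans_lt ?_
    exact ENNReal.mul_lt_top (ENNReal.mul_lt_top ENNReal.coe_lt_top hat.2) hg1.2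
  have l3 : LocallyIntegrableOn (fun x => (B.flip (w x)).comp (a' x)) C volume := by
    obtain ⟨c, hc, H⟩ := exists_eLpNorm_mul_le (X := F) (Y := 𝔼 →L[ℝ] G) hC hconv hb hne hp
      le_rfl hp1
    refine locallyIntegrableOn_of_memLp le_rfl
      ⟨aestronglyMeasurable_flip_comp B hw1.1 ha'p.1, ?_⟩
    refine (eLpNorm_le_nnreal_mul fun x => norm_flip_comp_le B _ _).trans_lt ?_
    refine ENNReal.mul_lt_top ENNReal.coe_lt_top
      ((H w g hw hw1.1 hg1.1 a' ha'p.1).trans_lt ?_)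
    exact ENNReal.mul_lt_top (ENNReal.mul_lt_top hc.lt_top ha'p.2)
      (ENNReal.add_lt_top.2 ⟨hw1.2, hg1.2⟩)
  refine hasWeakFDeriv_of_forall_approx l1 (aux_locallyIntegrableOn_add l2 l3)
    fun S hS hSC ε hε hεt => ?_
  obtain ⟨c₀, hc₀⟩ := hne
  -- Adjoining a point of `C` to `S` ensures that the smaller convex domain `C'` is nonempty even
  -- when `S` is empty.
  obtain ⟨δ, hδ, hδC⟩ := (hS.union (isCompact_singleton (x := c₀))).exists_cthickening_subset_open
    hC (union_subset hSC (singleton_subset_iff.2 hc₀))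
  set K := erosion C (δ / 2) with hK
  have hKc : IsCompact K := isCompact_erosion hb (by positivity)
  have hKC : K ⊆ C := erosion_subset (by positivity)
  have hint : ∀ x ∈ S ∪ {c₀}, x ∈ interior K := by
    intro x hx
    refine mem_interior.2 ⟨ball x (δ / 2), ?_, isOpen_ball, mem_ball_self (by positivity)⟩
    refine ball_subset_erosion ?_
    rw [add_halves]
    exact ball_subset_closedBall.trans ((closedBall_subset_cthickening hx δ).trans hδC)
  set C' := interior K with hC'
  have hC'C : C' ⊆ C := interior_subset.trans hKC
  have hSC' : S ⊆ C' := fun x hx => hint x (Or.inl hx)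
  -- The product of `a'` with the error `φ - w` is not controlled by an L¹-bound of the error alone;
  -- the multiplication estimate on `C'` with exponent 1 uses the W^{1,1}-error. Its constant
  -- depends on `C'` only and is fixed before `φ` is chosen.
  obtain ⟨c, hc, H⟩ := exists_eLpNorm_mul_le (X := F) (Y := 𝔼 →L[ℝ] G) (C := C') isOpen_interior
    (convex_erosion hconv _).interior (hb.subset hC'C) ⟨c₀, hint c₀ (Or.inr rfl)⟩ hp le_rfl hp1
  set D : ℝ≥0∞ := β * A + β * (c * P * (1 + 1)) + 1 with hD
  have hD0 : D ≠ 0 := by simp [hD]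
  have hDt : D ≠ ⊤ := by finiteness
  set e := ε / D with he
  have he0 : e ≠ 0 := (ENNReal.div_pos hε hDt).ne'
  have hDe : D * e = ε := ENNReal.mul_div_cancel hD0 hDt
  obtain ⟨φ, hφ, h1, h2⟩ := hw.exists_contDiff_lintegral_sub_le hC hKc hKC he0
  have hφ' : Continuous (fderiv ℝ φ) := hφ.continuous_fderiv (by simp)
  have mw : AEStronglyMeasurable (φ - w) (volume.restrict C) :=
    hφ.continuous.aestronglyMeasurable.sub hw1.1
  have mg : AEStronglyMeasurable (fderiv ℝ φ - g) (volume.restrict C) :=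
    hφ'.aestronglyMeasurable.sub hg1.1
  have hmS : volume.restrict S ≤ volume.restrict C := Measure.restrict_mono hSC le_rfl
  have hmC' : volume.restrict C' ≤ volume.restrict C := Measure.restrict_mono hC'C le_rfl
  have hmSC' : volume.restrict S ≤ volume.restrict C' := Measure.restrict_mono hSC' le_rfl
  have hmK : volume.restrict C' ≤ volume.restrict K :=
    Measure.restrict_mono interior_subset le_rfl
  have nw : eLpNorm (φ - w) 1 (volume.restrict C') ≤ e := by
    rw [eLpNorm_one_eq_lintegral_enorm]
    exact (lintegral_mono' hmK le_rfl).trans h1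
  have ng : eLpNorm (fderiv ℝ φ - g) 1 (volume.restrict C') ≤ e := by
    rw [eLpNorm_one_eq_lintegral_enorm]
    exact (lintegral_mono' hmK le_rfl).trans h2
  have nA : eLpNorm a ⊤ (volume.restrict S) ≤ A := eLpNorm_mono_measure _ hmS
  refine ⟨C, _, _, hSC, ha.bilin_of_contDiff B hC hφ, ?_, ?_⟩
  · calc ∫⁻ x in S, ‖B (a x) (φ x) - B (a x) (w x)‖ₑ
        = eLpNorm (fun x => B (a x) ((φ - w) x)) 1 (volume.restrict S) := by
          rw [eLpNorm_one_eq_lintegral_enorm]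
          exact lintegral_congr fun x => by simp
      _ ≤ β * eLpNorm a ⊤ (volume.restrict S) * eLpNorm (φ - w) 1 (volume.restrict S) :=
          eLpNorm_le_top_mul (c := ‖B‖₊) (mw.mono_measure hmS) fun x => B.le_opNorm₂ _ _
      _ ≤ β * A * e := by
          gcongr
          exact (eLpNorm_mono_measure _ hmSC').trans nw
      _ ≤ D * e := by
          gcongr
          exact le_self_add.trans le_self_add
      _ = ε := hDe
  · have m1 : AEStronglyMeasurable (fun x => (B (a x)).comp ((fderiv ℝ φ - g) x))
        (volume.restrict S) :=
      aestronglyMeasurable_bilin_comp B (hat.1.mono_measure hmS) (mg.mono_measure hmS)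
    calc ∫⁻ x in S, ‖(B (a x)).comp (fderiv ℝ φ x) + (B.flip (φ x)).comp (a' x) -
          ((B (a x)).comp (g x) + (B.flip (w x)).comp (a' x))‖ₑ
        ≤ ∫⁻ x in S, (‖(B (a x)).comp ((fderiv ℝ φ - g) x)‖ₑ +
            ‖(B.flip ((φ - w) x)).comp (a' x)‖ₑ) := by
          refine lintegral_mono fun x => ?_
          have : (B (a x)).comp (fderiv ℝ φ x) + (B.flip (φ x)).comp (a' x) -
              ((B (a x)).comp (g x) + (B.flip (w x)).comp (a' x)) =
              (B (a x)).comp ((fderiv ℝ φ - g) x) + (B.flip ((φ - w) x)).comp (a' x) := by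
            ext v
            simp
            abel
          rw [this]
          exact enorm_add_le (E := 𝔼 →L[ℝ] F') _ _
      _ = eLpNorm (fun x => (B (a x)).comp ((fderiv ℝ φ - g) x)) 1 (volume.restrict S) +
          eLpNorm (fun x => (B.flip ((φ - w) x)).comp (a' x)) 1 (volume.restrict S) := by
          rw [lintegral_add_left' m1.enorm, eLpNorm_one_eq_lintegral_enorm,
            eLpNorm_one_eq_lintegral_enorm]
      _ ≤ β * eLpNorm a ⊤ (volume.restrict S) * eLpNorm (fderiv ℝ φ - g) 1 (volume.restrict S) +
          β * eLpNorm (fun x => ‖a' x‖ * ‖(φ - w) x‖) 1 (volume.restrict C') := by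
          refine add_le_add (eLpNorm_le_top_mul (mg.mono_measure hmS)
            fun x => norm_bilin_comp_le B _ _) ?_
          exact (eLpNorm_mono_measure _ hmSC').trans
            (eLpNorm_le_nnreal_mul fun x => norm_flip_comp_le B _ _)
      _ ≤ β * A * e + β * (c * P * (e + e)) := by
          gcongr
          · exact (eLpNorm_mono_measure _ hmSC').trans ng
          · have hwd : HasWeakFDeriv C' (φ - w) (fderiv ℝ φ - g) :=
              (hasWeakFDeriv_of_hasFDerivAt isOpen_interior (fun x _ =>
                (hφ.differentiable (by simp)).differentiableAt.hasFDerivAt)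
                hφ'.continuousOn).sub (hw.mono hC'C)
            refine (H _ _ hwd (mw.mono_measure hmC') (mg.mono_measure hmC') a'
              (ha'p.1.mono_measure hmC')).trans ?_
            gcongr
            exact eLpNorm_mono_measure _ hmC'
      _ = (β * A + β * (c * P * (1 + 1))) * e := by ring
      _ ≤ D * e := by gcongr; exact le_self_add
      _ = ε := hDe

/-- Multiplication `W^{1,p} × W^{1,r} → W^{1,r}` on a bounded convex domain of dimension less than
`p`, for `r ≤ p`. -/
theorem exists_sobolevENorm_bilin_le (B : G →L[ℝ] F →L[ℝ] F') {C : Set 𝔼} (hC : IsOpen C)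
    (hconv : Convex ℝ C) (hb : Bornology.IsBounded C) (hne : C.Nonempty) {p r : ℝ≥0∞}
    (hp : n < p) (hr : 1 ≤ r) (hrp : r ≤ p) :
    ∃ c : ℝ≥0∞, c ≠ ⊤ ∧ ∀ (a : 𝔼 → G) (w : 𝔼 → F), MemSobolev C p a → MemSobolev C r w →
      MemSobolev C r (fun x => B (a x) (w x)) ∧
        sobolevENorm C r (fun x => B (a x) (w x)) ≤
          c * sobolevENorm C p a * sobolevENorm C r w := by
  have : CompleteSpace F := FiniteDimensional.complete ℝ F
  have : CompleteSpace G := FiniteDimensional.complete ℝ G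
  have hp1 : 1 ≤ p := hr.trans hrp
  have : IsFiniteMeasure (volume.restrict C) := ⟨by simpa using hb.measure_lt_top⟩
  obtain ⟨c₁, hc₁, H₁⟩ := exists_eLpNorm_mul_le (X := F) (Y := 𝔼 →L[ℝ] G) hC hconv hb hne hp
    hr hrp
  obtain ⟨c₂, hc₂, H₂⟩ := exists_eLpNorm_top_le (X := G) hC hconv hb hne hp hp1
  set β : ℝ≥0∞ := (‖B‖₊ : ℝ≥0∞) with hβ
  have hβt : β ≠ ⊤ := ENNReal.coe_ne_top
  refine ⟨β * (c₁ + c₂), by finiteness, fun a w ⟨hap, a', ha, ha'p⟩ ⟨hwr, g, hw, hgr⟩ => ?_⟩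
  -- The sup bound of `a` serves the function and the term with `g`; `H₁` serves the term with `a'`.
  have hA := H₂ a a' ha hap.1 ha'p.1
  have hat : MemLp a ⊤ (volume.restrict C) := ⟨hap.1, hA.trans_lt
    (ENNReal.mul_lt_top hc₂.lt_top (ENNReal.add_lt_top.2 ⟨hap.2, ha'p.2⟩))⟩
  have hd := ha.bilin B hC hconv hb hne hp hp1 hat ha'p hw (hwr.mono_exponent hr)
    (hgr.mono_exponent hr)
  set μ := volume.restrict C with hμ
  set Na := eLpNorm a p μ + eLpNorm a' p μ with hNa
  set Nw := eLpNorm w r μ + eLpNorm g r μ with hNw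
  have hNat : Na ≠ ⊤ := ENNReal.add_ne_top.2 ⟨hap.2.ne, ha'p.2.ne⟩
  have hNwt : Nw ≠ ⊤ := ENNReal.add_ne_top.2 ⟨hwr.2.ne, hgr.2.ne⟩
  have n1 : eLpNorm (fun x => B (a x) (w x)) r μ ≤ β * (c₂ * Na) * eLpNorm w r μ :=
    (eLpNorm_le_top_mul (c := ‖B‖₊) hwr.1 fun x => B.le_opNorm₂ _ _).trans (by gcongr)
  have n2 : eLpNorm (fun x => (B (a x)).comp (g x)) r μ ≤ β * (c₂ * Na) * eLpNorm g r μ :=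
    (eLpNorm_le_top_mul hgr.1 fun x => norm_bilin_comp_le B _ _).trans (by gcongr)
  have n3 : eLpNorm (fun x => (B.flip (w x)).comp (a' x)) r μ ≤ β * (c₁ * Na * Nw) := by
    refine (eLpNorm_le_nnreal_mul fun x => norm_flip_comp_le B _ _).trans ?_
    gcongr
    refine (H₁ w g hw hwr.1 hgr.1 a' ha'p.1).trans ?_
    gcongr
    exact le_add_self
  have m1 := aestronglyMeasurable_bilin_comp B hap.1 hgr.1
  have m2 := aestronglyMeasurable_flip_comp B hwr.1 ha'p.1
  have M1 : MemLp (fun x => B (a x) (w x)) r μ :=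
    ⟨B.aestronglyMeasurable_comp₂ hap.1 hwr.1, n1.trans_lt (ENNReal.mul_lt_top
      (ENNReal.mul_lt_top hβt.lt_top (ENNReal.mul_lt_top hc₂.lt_top hNat.lt_top)) hwr.2)⟩
  have M2 : MemLp (fun x => (B (a x)).comp (g x)) r μ := ⟨m1, n2.trans_lt (ENNReal.mul_lt_top
      (ENNReal.mul_lt_top hβt.lt_top (ENNReal.mul_lt_top hc₂.lt_top hNat.lt_top)) hgr.2)⟩
  have M3 : MemLp (fun x => (B.flip (w x)).comp (a' x)) r μ :=
    ⟨m2, n3.trans_lt (by finiteness)⟩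
  refine ⟨⟨M1, _, hd, aux_memLp_add M2 M3⟩, ?_⟩
  rw [sobolevENorm_eq hC hd, sobolevENorm_eq hC ha, sobolevENorm_eq hC hw]
  calc _ ≤ β * (c₂ * Na) * eLpNorm w r μ +
        (β * (c₂ * Na) * eLpNorm g r μ + β * (c₁ * Na * Nw)) :=
        add_le_add n1 ((aux_eLpNorm_add_le M2 M3 hr).trans (add_le_add n2 n3))
    _ = β * (c₁ + c₂) * Na * Nw := by rw [hNw]; ring

end Product

/-! ### Multiplication by a Lipschitz function. -/

section LipschitzFactor

variable {n : ℕ} {G : Type*} [NormedAddCommGroup G] [NormedSpace ℝ G] [FiniteDimensional ℝ G]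
  {F : Type*} [NormedAddCommGroup F] [NormedSpace ℝ F] [FiniteDimensional ℝ F]
  {F' : Type*} [NormedAddCommGroup F'] [NormedSpace ℝ F'] [FiniteDimensional ℝ F']

local notation "𝔼" => EuclideanSpace ℝ (Fin n)

/-- Multiplication by a fixed Lipschitz function is bounded on Sobolev spaces. -/
theorem exists_sobolevENorm_lipschitz_bilin_le (B : G →L[ℝ] F →L[ℝ] F') {C : Set 𝔼}
    (hC : IsOpen C) (hconv : Convex ℝ C) (hb : Bornology.IsBounded C) (hne : C.Nonempty)
    {K : ℝ≥0} {A : 𝔼 → G} (hA : LipschitzOnWith K A C) {q : ℝ≥0∞} (hq : 1 ≤ q) :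
    ∃ c : ℝ≥0∞, c ≠ ⊤ ∧ ∀ w : 𝔼 → F, MemSobolev C q w →
      MemSobolev C q (fun x => B (A x) (w x)) ∧
        sobolevENorm C q (fun x => B (A x) (w x)) ≤ c * sobolevENorm C q w := by
  -- A Lipschitz factor is of class W^{1,∞}, and `⊤` exceeds both the dimension and every `q`.
  obtain ⟨c, hc, h⟩ := exists_sobolevENorm_bilin_le B hC hconv hb hne
    (p := ⊤) (r := q) (ENNReal.natCast_lt_top n) hq le_top
  have hA' := LipschitzOnWith.memSobolev_top hC hb hA
  exact ⟨c * sobolevENorm C ⊤ A, ENNReal.mul_ne_top hc (hA'.sobolevENorm_ne_top hC),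
    fun w hw => h A w hA' hw⟩

end LipschitzFactor

/-! ### Half-balls in charts and changes of charts. -/

section Charts

variable {n : ℕ} {H : Type*} [TopologicalSpace H]
  (I : ModelWithCorners ℝ (EuclideanSpace ℝ (Fin n)) H)
  {M : Type*} [TopologicalSpace M] [ChartedSpace H M]

local notation "𝔼" => EuclideanSpace ℝ (Fin n)

/-- The interior points of the half-ball of radius `ρ` around `y` in the chart around `b`. -/
def chartBall (b y : M) (ρ : ℝ) : Set 𝔼 := interior (range I) ∩ ball (extChartAt I b y) ρ

variable (b y : M) (ρ : ℝ)

theorem isOpen_chartBall : IsOpen (chartBall I b y ρ) := isOpen_interior.inter isOpen_ball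

/-- Convexity of the range of the model makes the estimates on convex domains applicable at boundary
and corner points. -/
theorem convex_chartBall : Convex ℝ (chartBall I b y ρ) :=
  I.convex_range.interior.inter (convex_ball _ _)

theorem isBounded_chartBall : Bornology.IsBounded (chartBall I b y ρ) :=
  isBounded_ball.subset inter_subset_right

theorem volume_chartBall_ne_top : volume (chartBall I b y ρ) ≠ ⊤ :=
  (isBounded_chartBall I b y ρ).measure_lt_top.ne

variable {I b y ρ}

theorem extChartAt_mem_closure_interior_range :
    extChartAt I b y ∈ closure (interior (range I)) := by
  rw [I.convex_range.closure_interior_eq_closure_of_nonempty_interior I.nonempty_interior]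
  exact subset_closure ⟨_, rfl⟩

theorem nonempty_chartBall (hρ : 0 < ρ) : (chartBall I b y ρ).Nonempty := by
  rw [chartBall, inter_comm]
  exact mem_closure_iff.1 extChartAt_mem_closure_interior_range _ isOpen_ball
    (mem_ball_self hρ)

/-- Stating smallness as "for all small radii" lets finitely many local conditions be imposed on one
radius. -/
theorem eventually_chartBall {P : 𝔼 → Prop} (h : ∀ᶠ z in 𝓝[range I] (extChartAt I b y), P z) :
    ∀ᶠ ρ in 𝓝[>] (0 : ℝ), ∀ z ∈ chartBall I b y ρ, P z := by
  obtain ⟨ε, hε, hP⟩ := Metric.mem_nhdsWithin_iff.1 h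
  filter_upwards [Ioo_mem_nhdsGT hε] with ρ hρ z hz
  exact hP ⟨ball_subset_ball hρ.2.le hz.2, interior_subset hz.1⟩

theorem eventually_chartBall_symm {P : M → Prop} (hy : y ∈ (chartAt H b).source)
    (h : ∀ᶠ y' in 𝓝 y, P y') :
    ∀ᶠ ρ in 𝓝[>] (0 : ℝ), ∀ z ∈ chartBall I b y ρ, P ((extChartAt I b).symm z) := by
  refine eventually_chartBall (Filter.Eventually.filter_mono nhdsWithin_le_nhds ?_)
  have hy' : y ∈ (extChartAt I b).source := by rwa [extChartAt_source]
  have := continuousAt_extChartAt_symm' hy'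
  rw [ContinuousAt, (extChartAt I b).left_inv hy'] at this
  exact this.eventually h

theorem eventually_chartBall_subset_target (hy : y ∈ (chartAt H b).source) :
    ∀ᶠ ρ in 𝓝[>] (0 : ℝ), chartBall I b y ρ ⊆ (extChartAt I b).target :=
  eventually_chartBall (extChartAt_target_mem_nhdsWithin' (by rwa [extChartAt_source]))

variable [IsManifold I ∞ M] {a : M}

theorem tangentCoordChange_comp_self {z : M} (ha : z ∈ (extChartAt I a).source)
    (hb : z ∈ (extChartAt I b).source) :
    (tangentCoordChange I b a z).comp (tangentCoordChange I a b z) = .id ℝ 𝔼 := by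
  ext1 v
  rw [comp_apply, tangentCoordChange_comp ⟨⟨ha, hb⟩, ha⟩, tangentCoordChange_self ha]
  rfl

theorem tangentCoordChange_det_ne_zero {z : M} (ha : z ∈ (extChartAt I a).source)
    (hb : z ∈ (extChartAt I b).source) : (tangentCoordChange I b a z).det ≠ 0 := by
  intro h0
  have h1 : (tangentCoordChange I b a z).det * (tangentCoordChange I a b z).det = 1 := by
    rw [ContinuousLinearMap.det, ContinuousLinearMap.det, ← LinearMap.det_comp]
    have : ((tangentCoordChange I b a z : 𝔼 →L[ℝ] 𝔼) : 𝔼 →ₗ[ℝ] 𝔼) ∘ₗ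
      ((tangentCoordChange I a b z : 𝔼 →L[ℝ] 𝔼) : 𝔼 →ₗ[ℝ] 𝔼) = LinearMap.id := by
      rw [← ContinuousLinearMap.toLinearMap_comp, tangentCoordChange_comp_self ha hb]; rfl
    rw [this, LinearMap.det_id]
  rw [h0, zero_mul] at h1
  exact zero_ne_one h1

/-- The change of charts is a local diffeomorphism with bounds on its derivative. -/
theorem exists_tangentCoordChange_bound (ha : y ∈ (chartAt H a).source)
    (hb : y ∈ (chartAt H b).source) :
    ∃ L : ℝ≥0, ∀ᶠ z in 𝓝 y, z ∈ (extChartAt I a).source ∧ z ∈ (extChartAt I b).source ∧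
      1 ≤ L * |(tangentCoordChange I b a z).det| ∧ ‖tangentCoordChange I b a z‖ ≤ L := by
  rw [← extChartAt_source I] at ha hb
  have hna := (isOpen_extChartAt_source (I := I) a).mem_nhds ha
  have hnb := (isOpen_extChartAt_source (I := I) b).mem_nhds hb
  have hc : ContinuousAt (tangentCoordChange I b a) y :=
    (continuousOn_tangentCoordChange b a).continuousAt (Filter.inter_mem hnb hna)
  set D := tangentCoordChange I b a y
  have hD : 0 < |D.det| := abs_pos.2 (tangentCoordChange_det_ne_zero ha hb)
  have h1 : ∀ᶠ z in 𝓝 y, ‖tangentCoordChange I b a z‖ < ‖D‖ + 1 :=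
    hc.norm.eventually_lt continuousAt_const (lt_add_one _)
  have h2 : ∀ᶠ z in 𝓝 y, |D.det| / 2 < |(tangentCoordChange I b a z).det| :=
    continuousAt_const.eventually_lt
      (ContinuousLinearMap.continuous_det.continuousAt.comp hc).abs (half_lt_self hD)
  -- The first two summands dominate the derivative near `y`, the last one the inverse of its
  -- determinant.
  refine ⟨(‖D‖ + 1 + 2 / |D.det|).toNNReal, ?_⟩
  filter_upwards [hna, hnb, h1, h2] with z hza hzb h1 h2
  have hpos : 0 < 2 / |D.det| := by positivity
  rw [Real.coe_toNNReal _ (by positivity)]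
  refine ⟨hza, hzb, ?_, by linarith⟩
  calc (1 : ℝ) = 2 / |D.det| * (|D.det| / 2) := by field_simp
    _ ≤ _ := by
      refine mul_le_mul (by linarith [norm_nonneg D]) h2.le (by positivity) (by positivity)

variable {U : Set (EuclideanSpace ℝ (Fin n))}

theorem hasFDerivAt_transition (hU : IsOpen U) (hUt : U ⊆ (extChartAt I b).target) {z : 𝔼}
    (hz : z ∈ U) (ha : (extChartAt I b).symm z ∈ (extChartAt I a).source) :
    HasFDerivAt (extChartAt I a ∘ (extChartAt I b).symm)
      (tangentCoordChange I b a ((extChartAt I b).symm z)) z := by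
  have h := hasFDerivWithinAt_tangentCoordChange (I := I) (x := b) (y := a)
    ⟨(extChartAt I b).map_target (hUt hz), ha⟩
  rw [(extChartAt I b).right_inv (hUt hz)] at h
  exact h.hasFDerivAt (Filter.mem_of_superset (hU.mem_nhds hz)
    (hUt.trans (extChartAt_target_subset_range b)))

/-- Changes of charts map open sets (of interior points) to open sets. -/
theorem isOpen_image_transition (hU : IsOpen U) (hUt : U ⊆ (extChartAt I b).target)
    (hUa : MapsTo (extChartAt I b).symm U (extChartAt I a).source) :
    IsOpen ((extChartAt I a ∘ (extChartAt I b).symm) '' U) := by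
  rw [isOpen_iff_mem_nhds]
  rintro _ ⟨z, hz, rfl⟩
  have hza := hUa hz
  have hzb := (extChartAt I b).map_target (hUt hz)
  have hd := hasFDerivAt_transition hU hUt hz hza
  have hmem : z ∈ ((extChartAt I b).symm ≫ extChartAt I a).source := by
    rw [PartialEquiv.trans_source]
    exact ⟨hUt hz, hza⟩
  have hcd : ContDiffAt ℝ ∞ (extChartAt I a ∘ (extChartAt I b).symm) z :=
    (contDiffWithinAt_ext_coord_change a b hmem).contDiffAt
      (Filter.mem_of_superset (hU.mem_nhds hz) (hUt.trans (extChartAt_target_subset_range b)))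
  have hs := hcd.hasStrictFDerivAt' hd (by simp)
  let e : 𝔼 ≃L[ℝ] 𝔼 := ContinuousLinearEquiv.equivOfInverse
    (tangentCoordChange I b a ((extChartAt I b).symm z))
    (tangentCoordChange I a b ((extChartAt I b).symm z))
    (fun v => by simpa using DFunLike.congr_fun (tangentCoordChange_comp_self hzb hza) v)
    (fun v => by simpa using DFunLike.congr_fun (tangentCoordChange_comp_self hza hzb) v)
  -- The inverse function theorem applies, with the derivative of the reverse change of charts as
  -- inverse.
  have hs' : HasStrictFDerivAt (extChartAt I a ∘ (extChartAt I b).symm) (e : 𝔼 →L[ℝ] 𝔼) z := hs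
  rw [← hs'.map_nhds_eq_of_equiv]
  exact Filter.image_mem_map (hU.mem_nhds hz)

/-- Pullback of Sobolev functions under a change of charts. -/
theorem eventually_exists_sobolevENorm_transition_le {X : Type*} [NormedAddCommGroup X]
    [NormedSpace ℝ X] [FiniteDimensional ℝ X] (ha : y ∈ (chartAt H a).source)
    (hb : y ∈ (chartAt H b).source) {Ω : Set 𝔼} (hΩ : IsOpen Ω) (hfin : volume Ω ≠ ⊤)
    (hΩy : ∀ᶠ w in 𝓝 (extChartAt I a y), w ∈ interior (range I) → w ∈ Ω) :
    ∀ᶠ ρ in 𝓝[>] (0 : ℝ), ∀ q : ℝ≥0∞, 1 ≤ q → ∃ c : ℝ≥0∞, c ≠ ⊤ ∧ ∀ w : 𝔼 → X,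
      MemSobolev Ω q w →
        MemSobolev (chartBall I b y ρ) q (w ∘ (extChartAt I a ∘ (extChartAt I b).symm)) ∧
        sobolevENorm (chartBall I b y ρ) q (w ∘ (extChartAt I a ∘ (extChartAt I b).symm)) ≤
          c * sobolevENorm Ω q w := by
  obtain ⟨L, hL⟩ := exists_tangentCoordChange_bound (I := I) ha hb
  have hcont : ContinuousAt (extChartAt I a) y :=
    continuousAt_extChartAt' (by rwa [extChartAt_source])
  filter_upwards [eventually_chartBall_subset_target (I := I) hb,
    eventually_chartBall_symm (I := I) hb hL,
    eventually_chartBall_symm (I := I) hb (hcont.eventually hΩy)] with ρ hUt hL hW q hq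
  have hU := isOpen_chartBall I b y ρ
  -- Interior points stay interior under a change of charts: the image of the half-ball is open and
  -- contained in the range of the model.
  have himg : ∀ z ∈ chartBall I b y ρ,
      (extChartAt I a ∘ (extChartAt I b).symm) z ∈ interior (range I) := by
    intro z hz
    refine interior_maximal ?_ (isOpen_image_transition hU hUt fun z hz => (hL z hz).1)
      (mem_image_of_mem _ hz)
    rintro _ ⟨z, -, rfl⟩
    exact ⟨_, rfl⟩
  refine exists_sobolevENorm_comp_le hU hΩ hfin
    (fun z hz => hasFDerivAt_transition hU hUt hz (hL z hz).1) ?_ ?_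
    (fun z hz => hW z hz (himg z hz)) (fun z hz => (hL z hz).2.2.1)
    (fun z hz => (hL z hz).2.2.2) hq
  · exact (continuousOn_tangentCoordChange b a).comp
      ((continuousOn_extChartAt_symm b).mono hUt) fun z hz => ⟨(hL z hz).2.1, (hL z hz).1⟩
  · intro z hz z' hz' h
    have h1 := (extChartAt I a).injOn (hL z hz).1 (hL z' hz').1 h
    exact (extChartAt I b).symm.injOn (hUt hz) (hUt hz') h1

end Charts

/-! ### Products formed by a Lipschitz family of bilinear maps. -/

section Trilinear

variable {n : ℕ} {G : Type*} [NormedAddCommGroup G] [NormedSpace ℝ G] [FiniteDimensional ℝ G]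
  {F₁ : Type*} [NormedAddCommGroup F₁] [NormedSpace ℝ F₁] [FiniteDimensional ℝ F₁]
  {F₂ : Type*} [NormedAddCommGroup F₂] [NormedSpace ℝ F₂] [FiniteDimensional ℝ F₂]
  {F₃ : Type*} [NormedAddCommGroup F₃] [NormedSpace ℝ F₃] [FiniteDimensional ℝ F₃]
  {F' : Type*} [NormedAddCommGroup F'] [NormedSpace ℝ F'] [FiniteDimensional ℝ F']

local notation "𝔼" => EuclideanSpace ℝ (Fin n)

/-- The product of two Sobolev functions and a Lipschitz function, on a convex bounded set. -/
theorem exists_sobolevENorm_trilin_le (B : G →L[ℝ] F₁ →L[ℝ] F') (B' : F' →L[ℝ] F₂ →L[ℝ] F₃)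
    {C : Set 𝔼} (hC : IsOpen C) (hconv : Convex ℝ C) (hb : Bornology.IsBounded C)
    (hne : C.Nonempty) {K : ℝ≥0} {A : 𝔼 → G} (hA : LipschitzOnWith K A C) {p r : ℝ≥0∞}
    (hnp : n < p) (hp : 1 ≤ p) (hr : 1 ≤ r) :
    ∃ c : ℝ≥0∞, c ≠ ⊤ ∧ ∀ (u : 𝔼 → F₁) (v : 𝔼 → F₂), MemSobolev C p u → MemSobolev C r v →
      MemSobolev C (min p r) (fun x => B' (B (A x) (u x)) (v x)) ∧
        sobolevENorm C (min p r) (fun x => B' (B (A x) (u x)) (v x)) ≤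
          c * (sobolevENorm C p u * sobolevENorm C r v) := by
  have hs : 1 ≤ min p r := le_min hp hr
  -- The Lipschitz factor is joined to `u`, which keeps the exponent `p`. The exponent of `v` is
  -- lowered to `min p r`, so that it is at most `p` in the last product.
  obtain ⟨c₁, hc₁, h₁⟩ := exists_sobolevENorm_lipschitz_bilin_le B hC hconv hb hne hA hp
  obtain ⟨c₂, hc₂, h₂⟩ := exists_sobolevENorm_le_of_exponent_le (n := n) (X := F₂) hC
    hb.measure_lt_top.ne hs (min_le_right p r)
  obtain ⟨c₃, hc₃, h₃⟩ := exists_sobolevENorm_bilin_le B' hC hconv hb hne hnp hs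
    (min_le_left p r)
  refine ⟨c₃ * c₁ * c₂, ENNReal.mul_ne_top (ENNReal.mul_ne_top hc₃ hc₁) hc₂,
    fun u v hu hv => ?_⟩
  obtain ⟨hu', hu''⟩ := h₁ u hu
  obtain ⟨hv', hv''⟩ := h₂ v hv
  obtain ⟨hw, hw'⟩ := h₃ _ v hu' hv'
  refine ⟨hw, hw'.trans ?_⟩
  calc _ ≤ c₃ * (c₁ * sobolevENorm C p u) * (c₂ * sobolevENorm C r v) := by gcongr
    _ = _ := by ring

/-- The product of two Sobolev functions formed by a Lipschitz family of bilinear maps. -/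
theorem exists_sobolevENorm_lipschitz_family_le {C : Set 𝔼} (hC : IsOpen C) (hconv : Convex ℝ C)
    (hb : Bornology.IsBounded C) (hne : C.Nonempty) {K : ℝ≥0} {m : 𝔼 → F₁ →L[ℝ] F₂ →L[ℝ] F₃}
    (hm : LipschitzOnWith K m C) {p r : ℝ≥0∞} (hnp : n < p) (hp : 1 ≤ p) (hr : 1 ≤ r) :
    ∃ c : ℝ≥0∞, c ≠ ⊤ ∧ ∀ (u : 𝔼 → F₁) (v : 𝔼 → F₂), MemSobolev C p u → MemSobolev C r v →
      MemSobolev C (min p r) (fun x => m x (u x) (v x)) ∧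
        sobolevENorm C (min p r) (fun x => m x (u x) (v x)) ≤
          c * (sobolevENorm C p u * sobolevENorm C r v) := by
  let B : (F₁ →L[ℝ] F₂ →L[ℝ] F₃) →L[ℝ] F₁ →L[ℝ] F₂ →L[ℝ] F₃ := ContinuousLinearMap.id ℝ _
  let B' : (F₂ →L[ℝ] F₃) →L[ℝ] F₂ →L[ℝ] F₃ := ContinuousLinearMap.id ℝ _
  let _ : NormedAddCommGroup (F₁ →L[ℝ] F₂ →L[ℝ] F₃) := ContinuousLinearMap.toNormedAddCommGroup
  let _ : NormedSpace ℝ (F₁ →L[ℝ] F₂ →L[ℝ] F₃) := ContinuousLinearMap.toNormedSpace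
  have h := exists_sobolevENorm_trilin_le B B' hC hconv hb hne hm hnp hp hr
  exact h

end Trilinear

/-! ### From joint Lipschitz continuity to the operator norm. -/

section Operator

variable {F₁ : Type*} [NormedAddCommGroup F₁] [NormedSpace ℝ F₁]
  {F₂ : Type*} [NormedAddCommGroup F₂] [NormedSpace ℝ F₂]
  {F₃ : Type*} [NormedAddCommGroup F₃] [NormedSpace ℝ F₃]

theorem opNorm_le_of_forall_norm_le (T : F₁ →L[ℝ] F₂ →L[ℝ] F₃) {η D : ℝ} (hη : 0 < η)
    (hD : 0 ≤ D) (h : ∀ a b, ‖a‖ ≤ η → ‖b‖ ≤ η → ‖T a b‖ ≤ D) : ‖T‖ ≤ D / η ^ 2 := by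
  refine ContinuousLinearMap.opNorm_le_bound₂ T (by positivity) fun x y => ?_
  rcases eq_or_ne x 0 with rfl | hx
  · simp
  rcases eq_or_ne y 0 with rfl | hy
  · simp
  have hx' : 0 < ‖x‖ := norm_pos_iff.2 hx
  have hy' : 0 < ‖y‖ := norm_pos_iff.2 hy
  have h1 := h ((η / ‖x‖) • x) ((η / ‖y‖) • y)
    (by rw [norm_smul, norm_div, norm_norm, Real.norm_of_nonneg hη.le, div_mul_cancel₀ _ hx'.ne'])
    (by rw [norm_smul, norm_div, norm_norm, Real.norm_of_nonneg hη.le, div_mul_cancel₀ _ hy'.ne'])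
  rw [map_smul, map_smul, smul_apply, norm_smul, norm_smul, norm_div, norm_div, norm_norm,
    norm_norm, Real.norm_of_nonneg hη.le] at h1
  have h2 : ‖T x y‖ = (η / ‖y‖ * (η / ‖x‖ * ‖T x y‖)) * (‖x‖ * ‖y‖ / η ^ 2) := by
    field_simp
  rw [h2]
  calc _ ≤ D * (‖x‖ * ‖y‖ / η ^ 2) := by gcongr
    _ = _ := by ring

/-- A family of bilinear maps which is Lipschitz near `(z₀, 0, 0)` as a function of all its
arguments is Lipschitz near `z₀` for the operator norm. -/
theorem exists_lipschitzOnWith_of_bilin {E : Type*} [PseudoMetricSpace E] {S : Set E} {z₀ : E}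
    {f : E × (F₁ × F₂) → F₃} {m : E → F₁ →L[ℝ] F₂ →L[ℝ] F₃}
    (hf : ∃ K : ℝ≥0, ∃ t ∈ 𝓝[S ×ˢ univ] ((z₀, 0) : E × (F₁ × F₂)), LipschitzOnWith K f t)
    (hm : ∀ z ∈ S, ∀ a b, f (z, (a, b)) = m z a b) :
    ∃ K : ℝ≥0, ∃ t ∈ 𝓝[S] z₀, LipschitzOnWith K m t := by
  obtain ⟨K, t, ht, hK⟩ := hf
  obtain ⟨ε, hε, hsub⟩ := Metric.mem_nhdsWithin_iff.1 ht
  have hε2 : 0 < ε / 2 := half_pos hε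
  -- On arguments of norm at most `ε / 2` the difference `m z - m z'` is bounded by `K * dist z z'`;
  -- rescaling both arguments divides by `(ε / 2) ^ 2`.
  refine ⟨K / (ε / 2).toNNReal ^ 2, ball z₀ ε ∩ S, ?_, ?_⟩
  · exact Metric.mem_nhdsWithin_iff.2 ⟨ε, hε, Subset.rfl⟩
  refine LipschitzOnWith.of_dist_le_mul fun z hz z' hz' => ?_
  rw [dist_eq_norm (m z)]
  have hmem : ∀ w ∈ ball z₀ ε ∩ S, ∀ (a : F₁) (b : F₂), ‖a‖ ≤ ε / 2 → ‖b‖ ≤ ε / 2 →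
      (w, (a, b)) ∈ t := by
    intro w hw a b ha hb
    refine hsub ⟨?_, hw.2, trivial⟩
    rw [mem_ball, Prod.dist_eq, Prod.dist_eq]
    refine max_lt hw.1 (max_lt ?_ ?_)
    · simpa using ha.trans_lt (half_lt_self hε)
    · simpa using hb.trans_lt (half_lt_self hε)
  refine (opNorm_le_of_forall_norm_le (m z - m z') hε2
    (mul_nonneg K.2 (dist_nonneg (x := z) (y := z'))) fun a b ha hb => ?_).trans (le_of_eq ?_)
  · rw [_root_.sub_apply, _root_.sub_apply, ← hm z hz.2, ← hm z' hz'.2,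
      ← dist_eq_norm]
    refine (hK.dist_le_mul _ (hmem z hz a b ha hb) _ (hmem z' hz' a b ha hb)).trans (le_of_eq ?_)
    simp [Prod.dist_eq]
  · push_cast
    rw [Real.coe_toNNReal _ hε2.le]
    exact mul_div_right_comm ..

end Operator

/-! ### Comparison of coordinate expressions in two patches. -/

section CoordinateChange

variable {n : ℕ} {H : Type*} [TopologicalSpace H]
  {I : ModelWithCorners ℝ (EuclideanSpace ℝ (Fin n)) H}
  {M : Type*} [TopologicalSpace M] [ChartedSpace H M]
  {F : Type*} [NormedAddCommGroup F] [NormedSpace ℝ F]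
  {V : M → Type*} [∀ x, AddCommGroup (V x)] [∀ x, Module ℝ (V x)] [∀ x, TopologicalSpace (V x)]
  [TopologicalSpace (TotalSpace F V)] [FiberBundle F V] [VectorBundle ℝ F V]
  {a b y : M}

local notation "𝔼" => EuclideanSpace ℝ (Fin n)

theorem localRep_eq_coordChangeL (σ : Π x, V x) {z : 𝔼}
    (hzc : (extChartAt I b).symm z ∈ (extChartAt I a).source)
    (hza : (extChartAt I b).symm z ∈ (trivializationAt F V a).baseSet)
    (hzb : (extChartAt I b).symm z ∈ (trivializationAt F V b).baseSet) :
    localRep I F V b σ z =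
      (trivializationAt F V a).coordChangeL ℝ (trivializationAt F V b) ((extChartAt I b).symm z)
        (localRep I F V a σ ((extChartAt I a ∘ (extChartAt I b).symm) z)) := by
  rw [localRep, localRep, Function.comp_apply, (extChartAt I a).left_inv hzc,
    Trivialization.coordChangeL_apply _ _ ⟨hza, hzb⟩, ← Trivialization.symmL_apply (R := ℝ) _ hza,
    Trivialization.symmL_continuousLinearMapAt _ hza,
    Trivialization.continuousLinearMapAt_apply_of_mem _ _ hzb]

theorem volume_coordInterior_ne_top {x₀ : M} {K : Set M} (hK : IsCompact K)
    (hs : K ⊆ (chartAt H x₀).source) : volume (coordInterior I x₀ K) ≠ ⊤ := by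
  have hc : IsCompact (extChartAt I x₀ '' K) :=
    hK.image_of_continuousOn ((continuousOn_extChartAt x₀).mono (by rwa [extChartAt_source]))
  exact ((measure_mono interior_subset).trans_lt hc.measure_lt_top).ne

/-- At a boundary point of `M` the image of `K` is a neighbourhood only within the range of the
model, hence the restriction to interior points of that range. -/
theorem eventually_mem_coordInterior {x₀ : M} {K : Set M} (hy : y ∈ (chartAt H x₀).source)
    (hyK : y ∈ interior K) :
    ∀ᶠ w in 𝓝 (extChartAt I x₀ y), w ∈ interior (range I) → w ∈ coordInterior I x₀ K := by
  have h : extChartAt I x₀ '' K ∈ 𝓝[range I] (extChartAt I x₀ y) := by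
    rw [← map_extChartAt_nhds' (by rwa [extChartAt_source])]
    exact Filter.image_mem_map (mem_interior_iff_mem_nhds.1 hyK)
  obtain ⟨ε, hε, hsub⟩ := Metric.mem_nhdsWithin_iff.1 h
  filter_upwards [ball_mem_nhds _ hε] with w hw hwI
  exact interior_maximal ((inter_subset_inter_right _ interior_subset).trans hsub)
    (isOpen_ball.inter isOpen_interior) ⟨hw, hwI⟩

variable [IsManifold I ∞ M] [ContMDiffVectorBundle ∞ F V I]

/-- The transition function of a smooth bundle is C¹ within the convex range of the model, hence
locally Lipschitz up to the boundary. -/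
theorem eventually_lipschitzOnWith_coordChangeL (hb : y ∈ (chartAt H b).source)
    (hya : y ∈ (trivializationAt F V a).baseSet) (hyb : y ∈ (trivializationAt F V b).baseSet) :
    ∃ K : ℝ≥0, ∀ᶠ ρ in 𝓝[>] (0 : ℝ), LipschitzOnWith K
      (fun z => ((trivializationAt F V a).coordChangeL ℝ (trivializationAt F V b)
        ((extChartAt I b).symm z) : F →L[ℝ] F)) (chartBall I b y ρ) := by
  have h := contMDiffAt_coordChangeL (IB := I) (n := ∞) hya hyb
  rw [contMDiffAt_iff_source_of_mem_source hb, contMDiffWithinAt_iff_contDiffWithinAt] at h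
  obtain ⟨K, t, ht, hK⟩ := (h.of_le (m := 1) (by simp)).exists_lipschitzOnWith I.convex_range
  refine ⟨K, ?_⟩
  filter_upwards [eventually_chartBall ht] with ρ hρ
  exact hK.mono hρ

variable [FiniteDimensional ℝ F]

/-- Sobolev bounds for the coordinate expression of a section in one patch imply bounds for its
expression in another patch, near each common point. -/
theorem eventually_exists_sobolevENorm_localRep_le (ha : y ∈ (chartAt H a).source)
    (hb : y ∈ (chartAt H b).source) (hya : y ∈ (trivializationAt F V a).baseSet)
    (hyb : y ∈ (trivializationAt F V b).baseSet) {Ω : Set 𝔼} (hΩ : IsOpen Ω)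
    (hfin : volume Ω ≠ ⊤)
    (hΩy : ∀ᶠ w in 𝓝 (extChartAt I a y), w ∈ interior (range I) → w ∈ Ω) :
    ∀ᶠ ρ in 𝓝[>] (0 : ℝ), ∀ q : ℝ≥0∞, 1 ≤ q → ∃ c : ℝ≥0∞, c ≠ ⊤ ∧ ∀ σ : Π x, V x,
      MemSobolev Ω q (localRep I F V a σ) →
        MemSobolev (chartBall I b y ρ) q (localRep I F V b σ) ∧
        sobolevENorm (chartBall I b y ρ) q (localRep I F V b σ) ≤
          c * sobolevENorm Ω q (localRep I F V a σ) := by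
  obtain ⟨K, hK⟩ := eventually_lipschitzOnWith_coordChangeL (I := I) (F := F) (V := V) hb hya hyb
  filter_upwards [hK, self_mem_nhdsWithin,
    eventually_exists_sobolevENorm_transition_le (X := F) (I := I) ha hb hΩ hfin hΩy,
    eventually_chartBall_symm (I := I) hb ((isOpen_extChartAt_source (I := I) a).mem_nhds
      (by rwa [extChartAt_source])),
    eventually_chartBall_symm (I := I) hb ((trivializationAt F V a).open_baseSet.mem_nhds hya),
    eventually_chartBall_symm (I := I) hb ((trivializationAt F V b).open_baseSet.mem_nhds hyb)]
    with ρ hK hρ hτ hc hta htb q hq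
  have hU := isOpen_chartBall I b y ρ
  obtain ⟨c₁, hc₁, h₁⟩ := hτ q hq
  obtain ⟨c₂, hc₂, h₂⟩ := exists_sobolevENorm_lipschitz_bilin_le
    (ContinuousLinearMap.id ℝ (F →L[ℝ] F)) hU (convex_chartBall I b y ρ)
    (isBounded_chartBall I b y ρ) (nonempty_chartBall hρ) hK hq
  refine ⟨c₂ * c₁, ENNReal.mul_ne_top hc₂ hc₁, fun σ hσ => ?_⟩
  obtain ⟨hw, hw'⟩ := h₁ _ hσ
  obtain ⟨hv, hv'⟩ := h₂ _ hw
  have heq : EqOn (fun x => (ContinuousLinearMap.id ℝ (F →L[ℝ] F)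
      ((trivializationAt F V a).coordChangeL ℝ (trivializationAt F V b)
        ((extChartAt I b).symm x) : F →L[ℝ] F))
      ((localRep I F V a σ ∘ (extChartAt I a ∘ (extChartAt I b).symm)) x))
      (localRep I F V b σ) (chartBall I b y ρ) := fun z hz =>
    (localRep_eq_coordChangeL σ (hc z hz) (hta z hz) (htb z hz)).symm
  refine ⟨hv.congr hU heq, ?_⟩
  rw [← sobolevENorm_congr hU hv heq]
  refine hv'.trans ?_
  rw [mul_assoc]
  gcongr

/-- A Sobolev norm bounds the coordinate expressions near each point. -/
theorem SobolevCover.eventually_exists_sobolevENorm_localRep_le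
    (𝒜 : SobolevCover (H := H) F V) (x : M) :
    ∀ᶠ ρ in 𝓝[>] (0 : ℝ), ∀ q : ℝ≥0∞, 1 ≤ q → ∃ c : ℝ≥0∞, c ≠ ⊤ ∧ ∀ σ : Π x, V x,
      IsSobolevSection I F V q σ →
        MemSobolev (chartBall I x x ρ) q (localRep I F V x σ) ∧
        sobolevENorm (chartBall I x x ρ) q (localRep I F V x σ) ≤
          c * ∑ i, sobolevENorm (coordInterior I (𝒜.center i) (𝒜.K i)) q
            (localRep I F V (𝒜.center i) σ) := by
  have hx : x ∈ ⋃ i, interior (𝒜.K i) := by rw [𝒜.cover]; trivial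
  obtain ⟨i, hi⟩ := mem_iUnion.1 hx
  have hxi := 𝒜.subset i (interior_subset hi)
  filter_upwards [SobolevBundle.eventually_exists_sobolevENorm_localRep_le (I := I) (F := F)
    (V := V) hxi.1 (mem_chart_source H x) hxi.2 (mem_baseSet_trivializationAt F V x)
    (isOpen_coordInterior I (𝒜.center i) (𝒜.K i))
    (volume_coordInterior_ne_top (𝒜.isCompact i) ((𝒜.subset i).trans inter_subset_left))
    (eventually_mem_coordInterior hxi.1 hi)] with ρ hρ q hq
  obtain ⟨c, hc, h⟩ := hρ q hq
  refine ⟨c, hc, fun σ hσ => ?_⟩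
  obtain ⟨h1, h2⟩ := h σ (hσ _ _ (𝒜.isCompact i) (𝒜.subset i))
  refine ⟨h1, h2.trans ?_⟩
  gcongr
  exact Finset.single_le_sum (f := fun i => sobolevENorm (coordInterior I (𝒜.center i) (𝒜.K i)) q
    (localRep I F V (𝒜.center i) σ)) (fun _ _ => zero_le) (Finset.mem_univ i)

end CoordinateChange

/-! ### The common coordinate domain of the three bundles. -/

section CommonDomain

variable {n : ℕ} {H : Type*} [TopologicalSpace H]
  {I : ModelWithCorners ℝ (EuclideanSpace ℝ (Fin n)) H}
  {M : Type*} [TopologicalSpace M] [ChartedSpace H M]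
  {F₁ : Type*} [NormedAddCommGroup F₁] {V₁ : M → Type*}
  [∀ x, TopologicalSpace (V₁ x)] [TopologicalSpace (TotalSpace F₁ V₁)] [FiberBundle F₁ V₁]
  {F₂ : Type*} [NormedAddCommGroup F₂] {V₂ : M → Type*}
  [∀ x, TopologicalSpace (V₂ x)] [TopologicalSpace (TotalSpace F₂ V₂)] [FiberBundle F₂ V₂]
  {F₃ : Type*} [NormedAddCommGroup F₃] {V₃ : M → Type*}
  [∀ x, TopologicalSpace (V₃ x)] [TopologicalSpace (TotalSpace F₃ V₃)] [FiberBundle F₃ V₃]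

theorem commonCoordDomain_mem_nhdsWithin (x : M) :
    commonCoordDomain I F₁ V₁ F₂ V₂ F₃ V₃ x ∈ 𝓝[range I] (extChartAt I x x) := by
  refine Filter.inter_mem (extChartAt_target_mem_nhdsWithin x) (mem_nhdsWithin_of_mem_nhds ?_)
  refine (continuousAt_extChartAt_symm x).preimage_mem_nhds ?_
  rw [extChartAt_to_inv]
  exact Filter.inter_mem (Filter.inter_mem
    ((trivializationAt F₁ V₁ x).open_baseSet.mem_nhds (mem_baseSet_trivializationAt F₁ V₁ x))
    ((trivializationAt F₂ V₂ x).open_baseSet.mem_nhds (mem_baseSet_trivializationAt F₂ V₂ x)))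
    ((trivializationAt F₃ V₃ x).open_baseSet.mem_nhds (mem_baseSet_trivializationAt F₃ V₃ x))

end CommonDomain

/-! ### The product estimate on the manifold. -/

section BundleProduct

variable {n : ℕ} {H : Type*} [TopologicalSpace H]
  {I : ModelWithCorners ℝ (EuclideanSpace ℝ (Fin n)) H}
  {M : Type*} [TopologicalSpace M] [ChartedSpace H M]
  {F₁ : Type*} [NormedAddCommGroup F₁] [NormedSpace ℝ F₁] [FiniteDimensional ℝ F₁]
  {V₁ : M → Type*} [∀ x, AddCommGroup (V₁ x)] [∀ x, Module ℝ (V₁ x)]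
  [∀ x, TopologicalSpace (V₁ x)] [TopologicalSpace (TotalSpace F₁ V₁)]
  [FiberBundle F₁ V₁] [VectorBundle ℝ F₁ V₁]
  {F₂ : Type*} [NormedAddCommGroup F₂] [NormedSpace ℝ F₂] [FiniteDimensional ℝ F₂]
  {V₂ : M → Type*} [∀ x, AddCommGroup (V₂ x)] [∀ x, Module ℝ (V₂ x)]
  [∀ x, TopologicalSpace (V₂ x)] [TopologicalSpace (TotalSpace F₂ V₂)]
  [FiberBundle F₂ V₂] [VectorBundle ℝ F₂ V₂]
  {F₃ : Type*} [NormedAddCommGroup F₃] [NormedSpace ℝ F₃]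
  {V₃ : M → Type*} [∀ x, AddCommGroup (V₃ x)] [∀ x, Module ℝ (V₃ x)]
  [∀ x, TopologicalSpace (V₃ x)] [TopologicalSpace (TotalSpace F₃ V₃)]
  [FiberBundle F₃ V₃] [VectorBundle ℝ F₃ V₃]
  {μ : Π x, V₁ x →ₗ[ℝ] V₂ x →ₗ[ℝ] V₃ x}

local notation "𝔼" => EuclideanSpace ℝ (Fin n)

variable (I F₁ F₂ F₃ μ) in
/-- The bilinear bundle map `μ` in the coordinates around `x`. -/
def coordBilin (x : M) (z : EuclideanSpace ℝ (Fin n)) : F₁ →L[ℝ] F₂ →L[ℝ] F₃ :=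
  (((μ ((extChartAt I x).symm z)).compl₁₂
    ((trivializationAt F₁ V₁ x).symmL ℝ ((extChartAt I x).symm z)).toLinearMap
    ((trivializationAt F₂ V₂ x).symmL ℝ ((extChartAt I x).symm z)).toLinearMap).compr₂
    ((trivializationAt F₃ V₃ x).continuousLinearMapAt ℝ
      ((extChartAt I x).symm z)).toLinearMap).toContinuousBilinearMap

theorem localRep_bundleMap {x : M} (σ₁ : Π x, V₁ x) (σ₂ : Π x, V₂ x) {z : 𝔼}
    (h₁ : (extChartAt I x).symm z ∈ (trivializationAt F₁ V₁ x).baseSet)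
    (h₂ : (extChartAt I x).symm z ∈ (trivializationAt F₂ V₂ x).baseSet) :
    coordBilin I F₁ F₂ F₃ μ x z (localRep I F₁ V₁ x σ₁ z) (localRep I F₂ V₂ x σ₂ z) =
      localRep I F₃ V₃ x (fun x => μ x (σ₁ x) (σ₂ x)) z := by
  change (trivializationAt F₃ V₃ x).continuousLinearMapAt ℝ ((extChartAt I x).symm z)
    (μ ((extChartAt I x).symm z)
      ((trivializationAt F₁ V₁ x).symmL ℝ ((extChartAt I x).symm z) (localRep I F₁ V₁ x σ₁ z))
      ((trivializationAt F₂ V₂ x).symmL ℝ ((extChartAt I x).symm z) (localRep I F₂ V₂ x σ₂ z))) = _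
  rw [localRep, localRep, Trivialization.symmL_continuousLinearMapAt _ h₁,
    Trivialization.symmL_continuousLinearMapAt _ h₂, localRep]

/-- The Lipschitz condition is used only at the zero vectors over `x`; bilinearity propagates it to
the whole fibres. -/
theorem IsLocallyLipschitzBundleMap.eventually_lipschitzOnWith
    (hμ : IsLocallyLipschitzBundleMap I F₁ V₁ F₂ V₂ F₃ V₃ μ) (x : M) :
    ∃ K : ℝ≥0, ∀ᶠ ρ in 𝓝[>] (0 : ℝ),
      LipschitzOnWith K (coordBilin I F₁ F₂ F₃ μ x) (chartBall I x x ρ) := by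
  have hS := commonCoordDomain_mem_nhdsWithin (I := I) (F₁ := F₁) (V₁ := V₁) (F₂ := F₂) (V₂ := V₂)
    (F₃ := F₃) (V₃ := V₃) x
  obtain ⟨K, t, ht, hK⟩ := exists_lipschitzOnWith_of_bilin (m := coordBilin I F₁ F₂ F₃ μ x)
    (hμ x (x := (extChartAt I x x, 0))
      ⟨mem_of_mem_nhdsWithin (s := range I) (a := extChartAt I x x) (mem_range_self _) hS,
        mem_univ _⟩) (fun z _ a b => rfl)
  refine ⟨K, ?_⟩
  filter_upwards [eventually_chartBall (nhdsWithin_le_of_mem hS ht)] with ρ hρ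
  exact hK.mono hρ

variable [FiniteDimensional ℝ F₃]

/-- The product estimate in the coordinates around a point. -/
theorem IsLocallyLipschitzBundleMap.eventually_exists_sobolevENorm_le
    (hμ : IsLocallyLipschitzBundleMap I F₁ V₁ F₂ V₂ F₃ V₃ μ) {p r : ℝ≥0∞} (hnp : n < p)
    (hp : 1 ≤ p) (hr : 1 ≤ r) (x : M) :
    ∀ᶠ ρ in 𝓝[>] (0 : ℝ), ∃ c : ℝ≥0∞, c ≠ ⊤ ∧ ∀ (σ₁ : Π x, V₁ x) (σ₂ : Π x, V₂ x),
      MemSobolev (chartBall I x x ρ) p (localRep I F₁ V₁ x σ₁) →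
      MemSobolev (chartBall I x x ρ) r (localRep I F₂ V₂ x σ₂) →
      MemSobolev (chartBall I x x ρ) (min p r)
        (localRep I F₃ V₃ x (fun x => μ x (σ₁ x) (σ₂ x))) ∧
      sobolevENorm (chartBall I x x ρ) (min p r)
          (localRep I F₃ V₃ x (fun x => μ x (σ₁ x) (σ₂ x))) ≤
        c * (sobolevENorm (chartBall I x x ρ) p (localRep I F₁ V₁ x σ₁) *
          sobolevENorm (chartBall I x x ρ) r (localRep I F₂ V₂ x σ₂)) := by
  obtain ⟨K, hK⟩ := hμ.eventually_lipschitzOnWith x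
  filter_upwards [hK, self_mem_nhdsWithin,
    eventually_chartBall_symm (I := I) (mem_chart_source H x)
      ((trivializationAt F₁ V₁ x).open_baseSet.mem_nhds (mem_baseSet_trivializationAt F₁ V₁ x)),
    eventually_chartBall_symm (I := I) (mem_chart_source H x)
      ((trivializationAt F₂ V₂ x).open_baseSet.mem_nhds (mem_baseSet_trivializationAt F₂ V₂ x))]
    with ρ hK hρ ht₁ ht₂
  have hU := isOpen_chartBall I x x ρ
  obtain ⟨c, hc, h⟩ := exists_sobolevENorm_lipschitz_family_le hU (convex_chartBall I x x ρ)
    (isBounded_chartBall I x x ρ) (nonempty_chartBall hρ) hK hnp hp hr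
  refine ⟨c, hc, fun σ₁ σ₂ h₁ h₂ => ?_⟩
  obtain ⟨hw, hw'⟩ := h _ _ h₁ h₂
  have heq : EqOn (fun z => coordBilin I F₁ F₂ F₃ μ x z (localRep I F₁ V₁ x σ₁ z)
        (localRep I F₂ V₂ x σ₂ z))
      (localRep I F₃ V₃ x (fun x => μ x (σ₁ x) (σ₂ x))) (chartBall I x x ρ) := fun z hz =>
    localRep_bundleMap σ₁ σ₂ (ht₁ z hz) (ht₂ z hz)
  refine ⟨hw.congr hU heq, ?_⟩
  rw [← sobolevENorm_congr hU hw heq]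
  exact hw'

variable [IsManifold I ∞ M] [ContMDiffVectorBundle ∞ F₁ V₁ I] [ContMDiffVectorBundle ∞ F₂ V₂ I]
  [ContMDiffVectorBundle ∞ F₃ V₃ I]

/-- The product estimate near a point, in the coordinates around another point. -/
theorem IsLocallyLipschitzBundleMap.exists_sobolevENorm_chartBall_le
    (hμ : IsLocallyLipschitzBundleMap I F₁ V₁ F₂ V₂ F₃ V₃ μ) {p r : ℝ≥0∞} (hnp : n < p)
    (hp : 1 ≤ p) (hr : 1 ≤ r) (𝒜₁ : SobolevCover (H := H) F₁ V₁)
    (𝒜₂ : SobolevCover (H := H) F₂ V₂) {b x : M} (hx : x ∈ (chartAt H b).source)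
    (hx' : x ∈ (trivializationAt F₃ V₃ b).baseSet) :
    ∃ ρ > 0, ∃ c : ℝ≥0∞, c ≠ ⊤ ∧ ∀ (σ₁ : Π x, V₁ x) (σ₂ : Π x, V₂ x),
      IsSobolevSection I F₁ V₁ p σ₁ → IsSobolevSection I F₂ V₂ r σ₂ →
      MemSobolev (chartBall I b x ρ) (min p r)
        (localRep I F₃ V₃ b (fun x => μ x (σ₁ x) (σ₂ x))) ∧
      sobolevENorm (chartBall I b x ρ) (min p r)
          (localRep I F₃ V₃ b (fun x => μ x (σ₁ x) (σ₂ x))) ≤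
        c * ((∑ i, sobolevENorm (coordInterior I (𝒜₁.center i) (𝒜₁.K i)) p
            (localRep I F₁ V₁ (𝒜₁.center i) σ₁)) *
          ∑ i, sobolevENorm (coordInterior I (𝒜₂.center i) (𝒜₂.K i)) r
            (localRep I F₂ V₂ (𝒜₂.center i) σ₂)) := by
  obtain ⟨ρ, h₁, h₂, h₃, hρ⟩ :=
    ((𝒜₁.eventually_exists_sobolevENorm_localRep_le (I := I) x).and
      ((𝒜₂.eventually_exists_sobolevENorm_localRep_le (I := I) x).and
        ((hμ.eventually_exists_sobolevENorm_le hnp hp hr x).and self_mem_nhdsWithin))).exists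
  change 0 < ρ at hρ
  obtain ⟨c₁, hc₁, h₁⟩ := h₁ p hp
  obtain ⟨c₂, hc₂, h₂⟩ := h₂ r hr
  obtain ⟨c₃, hc₃, h₃⟩ := h₃
  -- The half-ball of radius `ρ` in the chart around `x`, where the product is estimated, becomes
  -- the source domain for the passage to the patch around `b`; the radius `ρ'` is measured there.
  have hΩ : ∀ᶠ w in 𝓝 (extChartAt I x x), w ∈ interior (range I) → w ∈ chartBall I x x ρ := by
    filter_upwards [ball_mem_nhds _ hρ] with w hw hwI using ⟨hwI, hw⟩
  obtain ⟨ρ', h₄, hρ'⟩ := ((eventually_exists_sobolevENorm_localRep_le (I := I) (F := F₃) (V := V₃)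
    (mem_chart_source H x) hx (mem_baseSet_trivializationAt F₃ V₃ x) hx'
    (isOpen_chartBall I x x ρ) (volume_chartBall_ne_top I x x ρ) hΩ).and
      self_mem_nhdsWithin).exists
  obtain ⟨c₄, hc₄, h₄⟩ := h₄ (min p r) (le_min hp hr)
  refine ⟨ρ', hρ', c₄ * c₃ * c₁ * c₂, by finiteness, fun σ₁ σ₂ hσ₁ hσ₂ => ?_⟩
  obtain ⟨k₁, k₁'⟩ := h₁ σ₁ hσ₁
  obtain ⟨k₂, k₂'⟩ := h₂ σ₂ hσ₂
  obtain ⟨k₃, k₃'⟩ := h₃ σ₁ σ₂ k₁ k₂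
  obtain ⟨k₄, k₄'⟩ := h₄ _ k₃
  refine ⟨k₄, k₄'.trans ?_⟩
  refine (mul_le_mul_right (k₃'.trans (mul_le_mul_right (mul_le_mul' k₁' k₂') _)) _).trans
    (le_of_eq ?_)
  ring

/-- The product estimate over a compact subset of a coordinate patch. -/
theorem IsLocallyLipschitzBundleMap.exists_sobolevENorm_coordInterior_le
    (hμ : IsLocallyLipschitzBundleMap I F₁ V₁ F₂ V₂ F₃ V₃ μ) {p r : ℝ≥0∞} (hnp : n < p)
    (hp : 1 ≤ p) (hr : 1 ≤ r) (𝒜₁ : SobolevCover (H := H) F₁ V₁)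
    (𝒜₂ : SobolevCover (H := H) F₂ V₂) {b : M} {K : Set M} (hK : IsCompact K)
    (hKs : K ⊆ (chartAt H b).source ∩ (trivializationAt F₃ V₃ b).baseSet) :
    ∃ c : ℝ≥0∞, c ≠ ⊤ ∧ ∀ (σ₁ : Π x, V₁ x) (σ₂ : Π x, V₂ x),
      IsSobolevSection I F₁ V₁ p σ₁ → IsSobolevSection I F₂ V₂ r σ₂ →
      MemSobolev (coordInterior I b K) (min p r)
        (localRep I F₃ V₃ b (fun x => μ x (σ₁ x) (σ₂ x))) ∧
      sobolevENorm (coordInterior I b K) (min p r)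
          (localRep I F₃ V₃ b (fun x => μ x (σ₁ x) (σ₂ x))) ≤
        c * ((∑ i, sobolevENorm (coordInterior I (𝒜₁.center i) (𝒜₁.K i)) p
            (localRep I F₁ V₁ (𝒜₁.center i) σ₁)) *
          ∑ i, sobolevENorm (coordInterior I (𝒜₂.center i) (𝒜₂.K i)) r
            (localRep I F₂ V₂ (𝒜₂.center i) σ₂)) := by
  have hloc : ∀ x : K, _ := fun x =>
    hμ.exists_sobolevENorm_chartBall_le hnp hp hr 𝒜₁ 𝒜₂ (hKs x.2).1 (hKs x.2).2
  choose ρ hρ c hc h using hloc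
  have hK' : IsCompact (extChartAt I b '' K) := hK.image_of_continuousOn
    ((continuousOn_extChartAt b).mono (by
      rw [extChartAt_source]; exact hKs.trans inter_subset_left))
  -- The balls cover the image of `K` by compactness; the half-balls cover `coordInterior I b K`,
  -- since its points are interior to the range of the model.
  obtain ⟨t, ht⟩ := hK'.elim_finite_subcover (fun x : K => ball (extChartAt I b x) (ρ x))
    (fun x => isOpen_ball) (by
      rintro _ ⟨x, hx, rfl⟩
      exact mem_iUnion.2 ⟨⟨x, hx⟩, mem_ball_self (hρ _)⟩)
  have hsub : coordInterior I b K ⊆ ⋃ x : t, chartBall I b x.1 (ρ x.1) := by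
    intro z hz
    obtain ⟨x, hx, hzx⟩ := mem_iUnion₂.1 (ht (interior_subset hz))
    refine mem_iUnion.2 ⟨⟨x, hx⟩, interior_mono ?_ hz, hzx⟩
    rintro _ ⟨w, -, rfl⟩
    exact ⟨_, rfl⟩
  have hopen : ∀ x : t, IsOpen (chartBall I b (x.1 : M) (ρ x.1)) :=
    fun x => isOpen_chartBall _ _ _ _
  refine ⟨∑ x : t, c x.1, ENNReal.sum_ne_top.2 fun x _ => hc x.1, fun σ₁ σ₂ hσ₁ hσ₂ => ?_⟩
  obtain ⟨hm, hle⟩ := memSobolev_iUnion hopen (le_min hp hr) fun x => (h x.1 σ₁ σ₂ hσ₁ hσ₂).1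
  refine ⟨hm.mono_set hsub, (hm.sobolevENorm_mono_set (isOpen_iUnion hopen)
    (isOpen_coordInterior I b K) hsub).trans (hle.trans ?_)⟩
  rw [Finset.sum_mul]
  exact Finset.sum_le_sum fun x _ => (h x.1 σ₁ σ₂ hσ₁ hσ₂).2

end BundleProduct

/-! ### The product map on sections and its norm. -/

section ProductMap

variable {n : ℕ} {H : Type*} [TopologicalSpace H]
  {I : ModelWithCorners ℝ (EuclideanSpace ℝ (Fin n)) H}
  {M : Type*} [TopologicalSpace M] [ChartedSpace H M]
  {F₁ : Type*} [NormedAddCommGroup F₁] [NormedSpace ℝ F₁] [FiniteDimensional ℝ F₁]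
  {V₁ : M → Type*} [∀ x, AddCommGroup (V₁ x)] [∀ x, Module ℝ (V₁ x)]
  [∀ x, TopologicalSpace (V₁ x)] [TopologicalSpace (TotalSpace F₁ V₁)]
  [FiberBundle F₁ V₁] [VectorBundle ℝ F₁ V₁] [ContMDiffVectorBundle ∞ F₁ V₁ I]
  {F₂ : Type*} [NormedAddCommGroup F₂] [NormedSpace ℝ F₂] [FiniteDimensional ℝ F₂]
  {V₂ : M → Type*} [∀ x, AddCommGroup (V₂ x)] [∀ x, Module ℝ (V₂ x)]
  [∀ x, TopologicalSpace (V₂ x)] [TopologicalSpace (TotalSpace F₂ V₂)]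
  [FiberBundle F₂ V₂] [VectorBundle ℝ F₂ V₂] [ContMDiffVectorBundle ∞ F₂ V₂ I]
  {F₃ : Type*} [NormedAddCommGroup F₃] [NormedSpace ℝ F₃] [FiniteDimensional ℝ F₃]
  {V₃ : M → Type*} [∀ x, AddCommGroup (V₃ x)] [∀ x, Module ℝ (V₃ x)]
  [∀ x, TopologicalSpace (V₃ x)] [TopologicalSpace (TotalSpace F₃ V₃)]
  [FiberBundle F₃ V₃] [VectorBundle ℝ F₃ V₃] [ContMDiffVectorBundle ∞ F₃ V₃ I]
  {μ : Π x, V₁ x →ₗ[ℝ] V₂ x →ₗ[ℝ] V₃ x} {p r : ℝ≥0∞}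

/-- All summands are finite, so estimates in `ℝ≥0∞` translate into estimates of real norms. -/
theorem SobolevSection.ofReal_norm {F : Type*} [NormedAddCommGroup F] [NormedSpace ℝ F]
    [FiniteDimensional ℝ F] {V : M → Type*} [∀ x, AddCommGroup (V x)] [∀ x, Module ℝ (V x)]
    [∀ x, TopologicalSpace (V x)] [TopologicalSpace (TotalSpace F V)] [FiberBundle F V]
    [VectorBundle ℝ F V] {𝒜 : SobolevCover (H := H) F V} {q : ℝ≥0∞} [Fact (1 ≤ q)]
    (σ : SobolevSection I 𝒜 q) :
    (∑ i, sobolevENorm (coordInterior I (𝒜.center i) (𝒜.K i)) q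
      (localRep I F V (𝒜.center i) σ.toFun)) = ENNReal.ofReal ‖σ‖ := by
  change _ = ENNReal.ofReal σ.sobolevNorm
  rw [SobolevSection.sobolevNorm, ENNReal.ofReal_sum_of_nonneg fun _ _ => ENNReal.toReal_nonneg]
  exact Finset.sum_congr rfl fun i _ => (ENNReal.ofReal_toReal
    ((σ.memSobolev i).sobolevENorm_ne_top (isOpen_coordInterior _ _ _))).symm

variable [IsManifold I ∞ M] [CompactSpace M]

theorem IsLocallyLipschitzBundleMap.isSobolevSection
    (hμ : IsLocallyLipschitzBundleMap I F₁ V₁ F₂ V₂ F₃ V₃ μ) (hnp : n < p) (hp : 1 ≤ p)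
    (hr : 1 ≤ r) {σ₁ : Π x, V₁ x} {σ₂ : Π x, V₂ x} (h₁ : IsSobolevSection I F₁ V₁ p σ₁)
    (h₂ : IsSobolevSection I F₂ V₂ r σ₂) :
    IsSobolevSection I F₃ V₃ (min p r) (fun x => μ x (σ₁ x) (σ₂ x)) := by
  -- Membership does not depend on covers, but the local estimate is phrased with them; compactness
  -- of `M` provides some.
  obtain ⟨𝒜₁⟩ := SobolevCover.nonempty F₁ V₁ I
  obtain ⟨𝒜₂⟩ := SobolevCover.nonempty F₂ V₂ I
  intro b K hK hKs
  obtain ⟨c, -, h⟩ := hμ.exists_sobolevENorm_coordInterior_le hnp hp hr 𝒜₁ 𝒜₂ hK hKs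
  exact (h σ₁ σ₂ h₁ h₂).1

variable [Fact (1 ≤ p)] [Fact (1 ≤ r)]

/-- The product map on (everywhere defined) Sobolev sections. -/
def sobolevProduct (hμ : IsLocallyLipschitzBundleMap I F₁ V₁ F₂ V₂ F₃ V₃ μ) (hnp : n < p)
    (𝒜₁ : SobolevCover (H := H) F₁ V₁) (𝒜₂ : SobolevCover (H := H) F₂ V₂)
    (𝒜₃ : SobolevCover (H := H) F₃ V₃) :
    SobolevSection I 𝒜₁ p →ₗ[ℝ] SobolevSection I 𝒜₂ r →ₗ[ℝ] SobolevSection I 𝒜₃ (min p r) :=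
  LinearMap.mk₂ ℝ (fun σ₁ σ₂ => SobolevSection.ofFun 𝒜₃ (fun x => μ x (σ₁.toFun x) (σ₂.toFun x))
      (hμ.isSobolevSection hnp Fact.out Fact.out σ₁.isSobolevSection σ₂.isSobolevSection))
    (fun σ σ' τ => Subtype.ext <| funext fun x =>
      LinearMap.map_add₂ (μ x) (σ.toFun x) (σ'.toFun x) (τ.toFun x))
    (fun c σ τ => Subtype.ext <| funext fun x =>
      LinearMap.map_smul₂ (μ x) c (σ.toFun x) (τ.toFun x))
    (fun σ τ τ' => Subtype.ext <| funext fun x =>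
      map_add (μ x (σ.toFun x)) (τ.toFun x) (τ'.toFun x))
    (fun c σ τ => Subtype.ext <| funext fun x =>
      map_smul (μ x (σ.toFun x)) c (τ.toFun x))

/-- The patch estimate is summed over the compact sets of `𝒜₃`; it already has the full norms for
`𝒜₁` and `𝒜₂` on its right side, so the three covers may be unrelated. -/
theorem exists_norm_sobolevProduct_le
    (hμ : IsLocallyLipschitzBundleMap I F₁ V₁ F₂ V₂ F₃ V₃ μ) (hnp : n < p)
    (𝒜₁ : SobolevCover (H := H) F₁ V₁) (𝒜₂ : SobolevCover (H := H) F₂ V₂)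
    (𝒜₃ : SobolevCover (H := H) F₃ V₃) :
    ∃ c : ℝ, ∀ (σ₁ : SobolevSection I 𝒜₁ p) (σ₂ : SobolevSection I 𝒜₂ r),
      ‖sobolevProduct hμ hnp 𝒜₁ 𝒜₂ 𝒜₃ σ₁ σ₂‖ ≤ c * ‖σ₁‖ * ‖σ₂‖ := by
  have hloc : ∀ i, _ := fun i => hμ.exists_sobolevENorm_coordInterior_le hnp
    (Fact.out : 1 ≤ p) (Fact.out : 1 ≤ r) 𝒜₁ 𝒜₂ (𝒜₃.isCompact i) (𝒜₃.subset i)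
  choose c hc h using hloc
  refine ⟨∑ i, (c i).toReal, fun σ₁ σ₂ => ?_⟩
  have hle : ENNReal.ofReal ‖sobolevProduct hμ hnp 𝒜₁ 𝒜₂ 𝒜₃ σ₁ σ₂‖ ≤
      (∑ i, c i) * (ENNReal.ofReal ‖σ₁‖ * ENNReal.ofReal ‖σ₂‖) := by
    rw [← SobolevSection.ofReal_norm, ← SobolevSection.ofReal_norm, ← SobolevSection.ofReal_norm,
      Finset.sum_mul]
    exact Finset.sum_le_sum fun i _ =>
      (h i σ₁.toFun σ₂.toFun σ₁.isSobolevSection σ₂.isSobolevSection).2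
  have hne : (∑ i, c i) ≠ ⊤ := ENNReal.sum_ne_top.2 fun i _ => hc i
  have := ENNReal.toReal_mono (by finiteness) hle
  rwa [ENNReal.toReal_ofReal (norm_nonneg _), ENNReal.toReal_mul, ENNReal.toReal_mul,
    ENNReal.toReal_ofReal (norm_nonneg _), ENNReal.toReal_ofReal (norm_nonneg _),
    ENNReal.toReal_sum fun i _ => hc i, ← mul_assoc] at this

end ProductMap

/-! ### Descent to the quotient by null sections. -/

section Quotient

variable {S₁ S₂ S₃ : Type*} [SeminormedAddCommGroup S₁] [NormedSpace ℝ S₁]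
  [SeminormedAddCommGroup S₂] [NormedSpace ℝ S₂] [SeminormedAddCommGroup S₃] [NormedSpace ℝ S₃]

/-- A bounded bilinear map of seminormed spaces descends to the separation quotients. -/
theorem exists_bilin_separationQuotient (P : S₁ →ₗ[ℝ] S₂ →ₗ[ℝ] S₃)
    (hP : ∃ c : ℝ, ∀ a b, ‖P a b‖ ≤ c * ‖a‖ * ‖b‖) :
    ∃ A : SeparationQuotient S₁ →ₗ[ℝ] SeparationQuotient S₂ →ₗ[ℝ] SeparationQuotient S₃,
      (∀ a b, A (SeparationQuotient.mk a) (SeparationQuotient.mk b) =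
        SeparationQuotient.mk (P a b)) ∧
      Continuous (fun q : SeparationQuotient S₁ × SeparationQuotient S₂ => A q.1 q.2) := by
  obtain ⟨c, hc⟩ := hP
  have hcont : Continuous fun q : S₁ × S₂ => (SeparationQuotient.mk (P q.1 q.2)) :=
    SeparationQuotient.continuous_mk.comp (P.mkContinuous₂ c hc).continuous₂
  -- Joint continuity sends inseparable pairs to inseparable points, which are equal in the
  -- separated quotient.
  have hins : ∀ a b a' b', Inseparable a a' → Inseparable b b' →
      (SeparationQuotient.mk (P a b)) = SeparationQuotient.mk (P a' b') :=
    fun a b a' b' ha hb => ((ha.prod hb).map hcont).eq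
  refine ⟨LinearMap.mk₂ ℝ (SeparationQuotient.lift₂ (fun a b => SeparationQuotient.mk (P a b)) hins)
    ?_ ?_ ?_ ?_, fun a b => rfl, ?_⟩
  · rintro ⟨a⟩ ⟨a'⟩ ⟨b⟩
    exact congrArg SeparationQuotient.mk (LinearMap.map_add₂ P a a' b)
  · rintro t ⟨a⟩ ⟨b⟩
    exact congrArg SeparationQuotient.mk (LinearMap.map_smul₂ P t a b)
  · rintro ⟨a⟩ ⟨b⟩ ⟨b'⟩
    exact congrArg SeparationQuotient.mk (map_add (P a) b b')
  · rintro t ⟨a⟩ ⟨b⟩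
    exact congrArg SeparationQuotient.mk (map_smul (P a) t b)
  · exact (SeparationQuotient.continuous_lift₂ (hf := hins)).2 hcont

end Quotient

end SobolevBundle

end

/-! ### Conclusion. -/

open SobolevBundle in
theorem mainTheorem13
    {n : ℕ} {H : Type*} [TopologicalSpace H]
    (I : ModelWithCorners ℝ (EuclideanSpace ℝ (Fin n)) H)
    {M : Type*} [TopologicalSpace M] [ChartedSpace H M] [IsManifold I ∞ M]
    [CompactSpace M] [T2Space M]
    {F₁ : Type*} [NormedAddCommGroup F₁] [NormedSpace ℝ F₁] [FiniteDimensional ℝ F₁]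
    {V₁ : M → Type*} [∀ x, AddCommGroup (V₁ x)] [∀ x, Module ℝ (V₁ x)]
    [∀ x, TopologicalSpace (V₁ x)] [TopologicalSpace (TotalSpace F₁ V₁)]
    [FiberBundle F₁ V₁] [VectorBundle ℝ F₁ V₁] [ContMDiffVectorBundle ∞ F₁ V₁ I]
    {F₂ : Type*} [NormedAddCommGroup F₂] [NormedSpace ℝ F₂] [FiniteDimensional ℝ F₂]
    {V₂ : M → Type*} [∀ x, AddCommGroup (V₂ x)] [∀ x, Module ℝ (V₂ x)]
    [∀ x, TopologicalSpace (V₂ x)] [TopologicalSpace (TotalSpace F₂ V₂)]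
    [FiberBundle F₂ V₂] [VectorBundle ℝ F₂ V₂] [ContMDiffVectorBundle ∞ F₂ V₂ I]
    {F₃ : Type*} [NormedAddCommGroup F₃] [NormedSpace ℝ F₃] [FiniteDimensional ℝ F₃]
    {V₃ : M → Type*} [∀ x, AddCommGroup (V₃ x)] [∀ x, Module ℝ (V₃ x)]
    [∀ x, TopologicalSpace (V₃ x)] [TopologicalSpace (TotalSpace F₃ V₃)]
    [FiberBundle F₃ V₃] [VectorBundle ℝ F₃ V₃] [ContMDiffVectorBundle ∞ F₃ V₃ I]
    (μ : Π x, V₁ x →ₗ[ℝ] V₂ x →ₗ[ℝ] V₃ x)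
    (hμ : IsLocallyLipschitzBundleMap I F₁ V₁ F₂ V₂ F₃ V₃ μ)
    (p r : ℝ≥0∞) [Fact (1 ≤ p)] [Fact (1 ≤ r)] (hp : (n : ℝ≥0∞) < p)
    (𝒜₁ : SobolevCover (H := H) F₁ V₁) (𝒜₂ : SobolevCover (H := H) F₂ V₂)
    (𝒜₃ : SobolevCover (H := H) F₃ V₃) :
    ∃ hprod : ∀ (σ₁ : Π x, V₁ x) (σ₂ : Π x, V₂ x),
        IsSobolevSection I F₁ V₁ p σ₁ → IsSobolevSection I F₂ V₂ r σ₂ →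
          IsSobolevSection I F₃ V₃ (min p r) (fun x => μ x (σ₁ x) (σ₂ x)),
      ∃ A : SobolevSpace I 𝒜₁ p →ₗ[ℝ] SobolevSpace I 𝒜₂ r →ₗ[ℝ] SobolevSpace I 𝒜₃ (min p r),
        (∀ (σ₁ : SobolevSection I 𝒜₁ p) (σ₂ : SobolevSection I 𝒜₂ r),
          A (SeparationQuotient.mk σ₁) (SeparationQuotient.mk σ₂) =
            SeparationQuotient.mk (SobolevSection.ofFun 𝒜₃
              (fun x => μ x (σ₁.toFun x) (σ₂.toFun x))
              (hprod σ₁.toFun σ₂.toFun σ₁.isSobolevSection σ₂.isSobolevSection))) ∧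
        Continuous (fun q : SobolevSpace I 𝒜₁ p × SobolevSpace I 𝒜₂ r => A q.1 q.2) := by
  refine ⟨fun σ₁ σ₂ h₁ h₂ => hμ.isSobolevSection hp Fact.out Fact.out h₁ h₂, ?_⟩
  exact exists_bilin_separationQuotient (S₁ := SobolevSection I 𝒜₁ p) (S₂ := SobolevSection I 𝒜₂ r)
    (S₃ := SobolevSection I 𝒜₃ (min p r)) (sobolevProduct hμ hp 𝒜₁ 𝒜₂ 𝒜₃)
    (exists_norm_sobolevProduct_le hμ hp 𝒜₁ 𝒜₂ 𝒜₃)
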